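/- Throughout, $1\le p\le\infty$. For a Hilbert space $H$, $S^p(H)$ denotes the Schatten class: for $p<\infty$, the bounded operators $A$ with $\|A\|_p=\mathrm{Tr}(|A|^p)^{1/p}<\infty$; for $p=\infty$, the compact operators with the operator norm. For a $\sigma$-finite measure space $(X,\mu)$, identify $S^2(L^2(X,\mu))$ with $L^2(X\times X,\mu\otimes\mu)$ by means of integral kernels. For $\varphi\in L^\infty(X\times X,\mu\otimes\mu)$, let $M_\varphi$ be the multiplication of kernels by $\varphi$ on $S^2(L^2(X,\mu))$, and let $\|\varphi\|_{cbMS^p(L^2(X,\mu))}\in[0,\infty]$ be the completely bounded norm of $M_\varphi$ on $S^p$, i.e. the supremum over all Hilbert spaces $K$ of the norm of $M_\varphi\otimes\mathrm{id}$ on the dense subspace $(S^2\cap S^p)(L^2(X,\mu))\otimes S^p(K)$ of $S^p(L^2(X,\mu)\otimes_2 K)$ (it is finite if and only if $M_\varphi$ maps $S^2\cap S^p$ into $S^p$ and extends to a completely bounded map on $S^p$). Let $G$ be a locally compact (Hausdorff) second countable group with a left Haar measure $\mu$. Let $A(G)$ be the Fourier algebra, i.e. the set of coefficients $g\mapsto\langle\lambda(g)f,h\rangle$,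 $f,h\in L^2(G,\mu)$, of the left regular representation, and for $\varphi:G\to\mathbb C$ put $\check\varphi(g,h)=\varphi(g^{-1}h)$. The group $G$ has property $AP_{pcb}^{Schur}$ if there are a constant $C<\infty$ and a net $(\varphi_\alpha)$ in $A(G)$ such that $\varphi_\alpha\to1$ uniformly on compact subsets of $G$ and $\|\check\varphi_\alpha\|_{cbMS^p(L^2(G,\mu))}\le C$ for all $\alpha$; the infimum of such $C$ is denoted $\Lambda_{pcb}^{Schur}(G)$, with $\Lambda_{pcb}^{Schur}(G)=\infty$ if there is no such $C$. **Theorem.** Let $G$ be a locally compact second countable group and $\Gamma$ a lattice in $G$, i.e. a discrete subgroup of finite covolume. Then for every $1\le p\le\infty$, $$\Lambda_{pcb}^{Schur}(G)=\Lambda_{pcb}^{Schur}(\Gamma).$$ In particular, $G$ has property $AP_{pcb}^{Schur}$ if and only if $\Gamma$ does. -/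

import Mathlib

open MeasureTheory Filter
open scoped ENNReal NNReal TensorProduct ComplexConjugate

universe u

noncomputable section

namespace SchurAP

/-! ### Schatten classes -/

section Schatten

variable {H : Type*} [NormedAddCommGroup H] [InnerProductSpace ℂ H] [CompleteSpace H]

/-- The trace `∑ᵢ ⟪eᵢ, T eᵢ⟫ ∈ [0, ∞]` of a positive bounded operator `T`, computed in an
orthonormal basis `(eᵢ)` of `H`. It is only used for positive `T`, where the value does not depend
on the basis. -/
def posTrace (T : H →L[ℂ] H) : ℝ≥0∞ :=
  ∑' i, ENNReal.ofReal
    (inner ℂ ((exists_hilbertBasis ℂ H).choose_spec.choose i)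
      (T ((exists_hilbertBasis ℂ H).choose_spec.choose i))).re

open Classical in
/-- The Schatten norm of a bounded operator, with values in `[0, ∞]`: for `p < ∞` it is
`Tr(|A|^p)^{1/p}`, and for `p = ∞` it is the operator norm of `A` if `A` is compact and `∞` if
it is not. -/
def schattenNorm (p : ℝ≥0∞) (A : H →L[ℂ] H) : ℝ≥0∞ :=
  if p = ∞ then (if IsCompactOperator A then ‖A‖ₑ else ∞)
  else posTrace (CFC.abs A ^ p.toReal) ^ (1 / p.toReal)

/-- Membership in the Schatten class `S^p(H)`; in particular `S^∞(H)` is the space of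
compact operators. -/
def MemSchatten (p : ℝ≥0∞) (A : H →L[ℂ] H) : Prop :=
  schattenNorm p A < ∞

end Schatten

/-! ### Hilbert space tensor products -/

section Tensor

variable (H K : Type*) [NormedAddCommGroup H] [InnerProductSpace ℂ H]
  [NormedAddCommGroup K] [InnerProductSpace ℂ K]

/-- The Hilbert space tensor product `H ⊗₂ K`: the completion of the algebraic tensor product for
the inner product with `⟪h ⊗ k, h' ⊗ k'⟫ = ⟪h, h'⟫ ⟪k, k'⟫`. -/
abbrev HilbertTensor : Type _ :=
  UniformSpace.Completion (H ⊗[ℂ] K)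

variable {H K}

/-- The bounded operator `A ⊗ B` on `H ⊗₂ K`. -/
def tensorOp (A : H →L[ℂ] H) (B : K →L[ℂ] K) : HilbertTensor H K →L[ℂ] HilbertTensor H K :=
  (TensorProduct.mapL A B).completion

end Tensor

/-! ### Schur multipliers -/

section Schur

variable {X : Type u} [MeasurableSpace X]

/-- `A` is the Hilbert-Schmidt operator on `L²(X, μ)` with kernel `k ∈ L²(X × X, μ ⊗ μ)`, i.e.
`(A ξ)(x) = ∫ k(x, y) ξ(y) dμ(y)`. -/
def IsKernelOf (μ : Measure X) (k : X × X → ℂ) (A : Lp ℂ 2 μ →L[ℂ] Lp ℂ 2 μ) : Prop :=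
  MemLp k 2 (μ.prod μ) ∧ ∀ ξ : Lp ℂ 2 μ, A ξ =ᵐ[μ] fun x => ∫ y, k (x, y) * ξ y ∂μ

/-- The graph of the Schur multiplier with symbol `φ` on `S²(L²(X, μ)) = L²(X × X, μ ⊗ μ)`, where it
is the multiplication of kernels by `φ`: `A ∈ S²` and `A' = M_φ(A)`. -/
def IsSchurImage (μ : Measure X) (φ : X × X → ℂ) (A A' : Lp ℂ 2 μ →L[ℂ] Lp ℂ 2 μ) : Prop :=
  ∃ k : X × X → ℂ, IsKernelOf μ k A ∧ IsKernelOf μ (fun z => φ z * k z) A'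

/-- `φ ∈ L^∞(X × X, μ ⊗ μ)` and the Schur multiplier `M_φ` is completely bounded on
`S^p(L²(X, μ))` with completely bounded norm at most `C`: for every Hilbert space `K`, the map
`M_φ ⊗ id`, defined on the dense subspace `(S² ∩ S^p)(L²(X, μ)) ⊗ S^p(K)` of
`S^p(L²(X, μ) ⊗₂ K)`, is bounded by `C` for the norm of `S^p(L²(X, μ) ⊗₂ K)`; that is, it extends to
a bounded map of norm at most `C`. (With `K = ℂ` this says in particular that `M_φ` maps
`S² ∩ S^p` into `S^p` and extends to `S^p`.) -/
structure IsCBSchurBound (p : ℝ≥0∞) (μ : Measure X) (φ : X × X → ℂ) (C : ℝ≥0) : Prop where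
  memLp_top : MemLp φ ∞ (μ.prod μ)
  bound : ∀ (K : Type u) [NormedAddCommGroup K] [InnerProductSpace ℂ K] [CompleteSpace K]
    (n : ℕ) (A A' : Fin n → (Lp ℂ 2 μ →L[ℂ] Lp ℂ 2 μ)) (B : Fin n → (K →L[ℂ] K)),
    (∀ i, MemSchatten p (A i)) → (∀ i, IsSchurImage μ φ (A i) (A' i)) →
    (∀ i, MemSchatten p (B i)) →
    schattenNorm p (∑ i, tensorOp (A' i) (B i)) ≤ C * schattenNorm p (∑ i, tensorOp (A i) (B i))

/-- The completely bounded norm `‖φ‖_{cbMS^p(L²(X, μ))}` of the Schur multiplier with symbol `φ`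
(it is `∞` if the multiplier is not completely bounded on `S^p`). -/
def cbSchurNorm (p : ℝ≥0∞) (μ : Measure X) (φ : X × X → ℂ) : ℝ≥0∞ :=
  ⨅ (C : ℝ≥0) (_ : IsCBSchurBound p μ φ C), (C : ℝ≥0∞)

end Schur

/-! ### Approximation by Schur multipliers on a group -/

section GroupDefs

variable {G : Type u} [Group G] [MeasurableSpace G]

/-- The Fourier algebra `A(G)`: the coefficients `g ↦ ⟨λ(g) f, h⟩`, `f, h ∈ L²(G, μ)`, of the left
regular representation `(λ(g) f)(x) = f(g⁻¹ x)`, for a left Haar measure `μ`. -/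
def MemFourierAlgebra (μ : Measure G) (φ : G → ℂ) : Prop :=
  ∃ f h : G → ℂ, MemLp f 2 μ ∧ MemLp h 2 μ ∧ ∀ g, φ g = ∫ x, f (g⁻¹ * x) * conj (h x) ∂μ

/-- The symbol `φ̌(g, h) = φ(g⁻¹ h)`. -/
def herzSchurSymbol (φ : G → ℂ) : G × G → ℂ :=
  fun z => φ (z.1⁻¹ * z.2)

variable [TopologicalSpace G]

/-- There is a net `φ_α ∈ A(G)` that converges to `1` uniformly on compact subsets of `G` with
`‖φ̌_α‖_{cbMS^p(L²(G))} ≤ C` for all `α`. -/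
def HasSchurApprox (p : ℝ≥0∞) (μ : Measure G) (C : ℝ≥0) : Prop :=
  ∃ (ι : Type u) (_ : Preorder ι) (_ : IsDirectedOrder ι) (_ : Nonempty ι) (φ : ι → G → ℂ),
    (∀ α, MemFourierAlgebra μ (φ α)) ∧
    (∀ Q : Set G, IsCompact Q → TendstoUniformlyOn φ (fun _ => 1) atTop Q) ∧
    ∀ α, cbSchurNorm p μ (herzSchurSymbol (φ α)) ≤ C

/-- The property of completely bounded approximation by Schur multipliers on `S^p`, for a group `G`
with a left Haar measure `μ`. -/
def SchurAPpcb (p : ℝ≥0∞) (μ : Measure G) : Prop :=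
  ∃ C : ℝ≥0, HasSchurApprox p μ C

/-- The constant `Λ_{pcb}^{Schur}(G) ∈ [0, ∞]`, for a group `G` with a left Haar measure `μ`: the
infimum of the admissible constants, which is `∞` if there are none. -/
def schurConst (p : ℝ≥0∞) (μ : Measure G) : ℝ≥0∞ :=
  ⨅ (C : ℝ≥0) (_ : HasSchurApprox p μ C), (C : ℝ≥0∞)

/-- `Γ` is a lattice in `G`: a discrete subgroup of finite covolume. Here `μ` is a left Haar
measure, hence invariant under the action of `Γ` by left multiplication, and the covolume is the
measure of a fundamental domain for this action (all fundamental domains have the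
same measure). -/
structure IsLattice (Γ : Subgroup G) (μ : Measure G) : Prop where
  discrete : DiscreteTopology Γ
  finite_covolume : ∃ F : Set G, IsFundamentalDomain Γ F μ ∧ μ F < ∞

end GroupDefs

end SchurAP

end

/-! Both properties are compared for one fixed constant `C`: an approximating net on either group is
turned into a net on the other, with the same index set and the same bound. Everything rests on a
measurable equivariant map `κ : G → Γ`, with `κ (γ x) = γ κ x` (`exists_equivariant_map`). Its fibre
`F = κ⁻¹(1)` is a fundamental domain, of finite measure since `Γ` is a lattice, and this makes `G`
unimodular.

From `Γ` to `G`: `induced` averages `φ (κ (y g))` over `y ∈ F`. By invariance its symbol is the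
average over `y` of `φ̌ (κ (y g), κ (y h))`, that is, of pullbacks of `φ̌` along maps `G → Γ`. A
pullback does not increase the cb norm, because it acts on block matrices as the original multiplier
acts on matrices with operator entries (`IsCBSchurBound.amplification`, `IsCBSchurBound.pullback`);
an average does not either, by convexity (`IsCBSchurBound.average`). Unfolding `Γ × F` onto `G`
exhibits the average as a coefficient of the regular representation. Finite covolume and the uniform
bound on the net give convergence on compact sets.

From `G` to `Γ`: `sampled` averages `φ (u⁻¹ γ u')` over a compact `U ⊆ F` of positive measure. The
translates `γ U` are disjoint, so their normalized indicators span a copy of `ℓ²(Γ)` in `L²(G)`, and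
compressing `M_φ̌` to it gives the multiplier of the sampled symbol (`IsCBSchurBound.sample`). The
average is again a coefficient of `λ_G`; its restriction to `Γ` is a coefficient of `λ_Γ`, because
`L²(G)` is a multiple of `ℓ²(Γ)` and cyclic subrepresentations of such a multiple embed in `ℓ²(Γ)`
(`exists_coefficient_eq`).

The Schatten norm enters only through a variational formula (`schattenNorm_le_iff`): for compact `T`
it is the supremum of the `ℓ^p` norms of `(⟨f i, T (e i)⟩)` over finite orthonormal families.
Stability under compression, weak limits and averaging follows at once. -/

set_option linter.unusedSectionVars false

namespace SchurAP

/-! ### Factorization through `|T|` and Jensen's inequality for positive operators. -/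

section Operators

variable {H E F : Type*} [NormedAddCommGroup H] [InnerProductSpace ℂ H] [CompleteSpace H]
  [NormedAddCommGroup E] [InnerProductSpace ℂ E] [CompleteSpace E]
  [NormedAddCommGroup F] [InnerProductSpace ℂ F] [CompleteSpace F]

/-- Douglas' factorization lemma. -/
theorem exists_contraction_comp_eq (A : E →L[ℂ] F) (B : E →L[ℂ] H) (h : ∀ x, ‖A x‖ ≤ ‖B x‖) :
    ∃ V : H →L[ℂ] F, ‖V‖ ≤ 1 ∧ V ∘L B = A := by
  let R : Submodule ℂ H := (LinearMap.range B.toLinearMap).topologicalClosure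
  have : CompleteSpace R :=
    (Submodule.isClosed_topologicalClosure _).completeSpace_coe
  have hmem : ∀ x, B x ∈ R := fun x => Submodule.le_topologicalClosure _ ⟨x, rfl⟩
  let e : E →ₗ[ℂ] R := B.toLinearMap.codRestrict R hmem
  have hd : DenseRange e := by
    intro y
    rw [closure_subtype]
    have : (Subtype.val '' Set.range e) = (LinearMap.range B.toLinearMap : Set H) := by
      ext z
      constructor
      · rintro ⟨_, ⟨x, rfl⟩, rfl⟩
        exact ⟨x, rfl⟩
      · rintro ⟨x, rfl⟩
        exact ⟨e x, ⟨x, rfl⟩, rfl⟩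
    rw [this]
    exact y.2
  have hn : ∀ x, ‖A.toLinearMap x‖ ≤ 1 * ‖e x‖ := fun x => by
    simpa [e] using h x
  -- The map `B x ↦ A x` extends to the closure `R` of the range of `B`; the projection makes it
  -- zero on the orthogonal complement.
  refine ⟨(A.toLinearMap.extendOfNorm e) ∘L R.orthogonalProjectionOnto, ?_, ?_⟩
  · refine (ContinuousLinearMap.opNorm_comp_le _ _).trans ?_
    exact mul_le_one₀ (LinearMap.opNorm_extendOfNorm_le hd zero_le_one hn) (norm_nonneg _)
      (Submodule.orthogonalProjectionOnto_norm_le _)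
  · ext x
    have h1 : R.orthogonalProjectionOnto (B x) = e x :=
      Submodule.orthogonalProjectionOnto_mem_subspace_eq_self (K := R) ⟨B x, hmem x⟩
    simp only [ContinuousLinearMap.comp_apply, h1]
    exact LinearMap.extendOfNorm_eq hd ⟨1, hn⟩ x

theorem norm_cfcAbs_apply (T : H →L[ℂ] H) (x : H) : ‖CFC.abs T x‖ = ‖T x‖ := by
  have h1 : inner ℂ (CFC.abs T x) (CFC.abs T x) = inner ℂ (T x) (T x) := by
    rw [← ContinuousLinearMap.adjoint_inner_right, ← ContinuousLinearMap.adjoint_inner_right T]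
    have h2 : ContinuousLinearMap.adjoint (CFC.abs T) = CFC.abs T :=
      (CFC.abs_nonneg T).isSelfAdjoint
    have h3 := congrArg (fun A : H →L[ℂ] H => A x) (CFC.abs_mul_abs T)
    rw [h2]
    exact congrArg _ h3
  have := congrArg Complex.re h1
  rw [inner_self_eq_norm_sq_to_K, inner_self_eq_norm_sq_to_K] at this
  norm_cast at this
  exact (sq_eq_sq₀ (norm_nonneg _) (norm_nonneg _)).1 this

theorem norm_sqrt_apply_sq {P : H →L[ℂ] H} (hP : 0 ≤ P) (x : H) :
    ‖CFC.sqrt P x‖ ^ 2 = (inner ℂ x (P x)).re := by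
  have h2 : ContinuousLinearMap.adjoint (CFC.sqrt P) = CFC.sqrt P :=
    (CFC.sqrt_nonneg P).isSelfAdjoint
  have h3 := congrArg (fun A : H →L[ℂ] H => A x) (CFC.sqrt_mul_sqrt_self P hP)
  have h4 : P x = CFC.sqrt P (CFC.sqrt P x) := h3.symm
  rw [h4, ← ContinuousLinearMap.adjoint_inner_left, h2, inner_self_eq_norm_sq_to_K]
  norm_cast

theorem norm_inner_le_of_nonneg {P : H →L[ℂ] H} (hP : 0 ≤ P) (x y : H) :
    ‖inner ℂ x (P y)‖ ≤ ‖CFC.sqrt P x‖ * ‖CFC.sqrt P y‖ := by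
  have h2 : ContinuousLinearMap.adjoint (CFC.sqrt P) = CFC.sqrt P :=
    (CFC.sqrt_nonneg P).isSelfAdjoint
  have h4 : P y = CFC.sqrt P (CFC.sqrt P y) :=
    (congrArg (fun A : H →L[ℂ] H => A y) (CFC.sqrt_mul_sqrt_self P hP)).symm
  rw [h4, ← ContinuousLinearMap.adjoint_inner_left, h2]
  exact norm_inner_le_norm _ _

theorem re_inner_le_of_le {P Q : H →L[ℂ] H} (h : P ≤ Q) (x : H) :
    (inner ℂ x (P x)).re ≤ (inner ℂ x (Q x)).re := by
  have := ((ContinuousLinearMap.le_def P Q).1 h).re_inner_nonneg_right x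
  simp only [sub_apply, inner_sub_right] at this
  have h3 : (0 : ℝ) ≤ (inner ℂ x (Q x) - inner ℂ x (P x)).re := this
  rw [Complex.sub_re] at h3
  linarith

/-- Jensen's inequality for the functional calculus of a positive operator. -/
theorem re_inner_rpow_le {P : H →L[ℂ] H} (hP : 0 ≤ P) {r : ℝ} (hr : 1 ≤ r) {x : H}
    (hx : ‖x‖ ≤ 1) : (inner ℂ x (P x)).re ^ r ≤ (inner ℂ x ((P ^ r) x)).re := by
  set s : ℝ := (inner ℂ x (P x)).re with hs
  have hs0 : 0 ≤ s := by rw [hs, ← norm_sqrt_apply_sq hP]; positivity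
  have hsa : IsSelfAdjoint P := hP.isSelfAdjoint
  rcases hs0.eq_or_lt with h0 | hpos
  · rw [← h0, Real.zero_rpow (by linarith)]
    have := ((ContinuousLinearMap.nonneg_iff_isPositive (P ^ r)).1
      CFC.rpow_nonneg).re_inner_nonneg_right x
    exact this
  -- The tangent line of `t ↦ t ^ r` at `t = s` lies below the graph (Bernoulli's inequality at `t /
  -- s - 1`, hence the separate case `s = 0`), and the functional calculus preserves this order.
  have hle : cfc (fun t : ℝ => (s ^ r - r * s ^ (r - 1) * s) + (r * s ^ (r - 1)) * t) P ≤ P ^ r := by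
    rw [CFC.rpow_eq_cfc_real hP]
    refine cfc_mono (fun t ht => ?_) (by fun_prop) ?_
    · have ht0 : 0 ≤ t := spectrum_nonneg_of_nonneg hP ht
      have hb := one_add_mul_self_le_rpow_one_add (s := t / s - 1)
        (by have : 0 ≤ t / s := by positivity
            linarith) hr
      rw [add_sub_cancel, Real.div_rpow ht0 hpos.le, le_div_iff₀ (by positivity)] at hb
      have h1 : s ^ r = s ^ (r - 1) * s := by
        rw [← Real.rpow_add_one hpos.ne']; ring_nf
      calc s ^ r - r * s ^ (r - 1) * s + r * s ^ (r - 1) * t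
          = (1 + r * (t / s - 1)) * s ^ r := by rw [h1]; field_simp; ring
        _ ≤ t ^ r := hb
    · exact (Real.continuous_rpow_const (by linarith)).continuousOn
  have h2 : cfc (fun t : ℝ => (s ^ r - r * s ^ (r - 1) * s) + (r * s ^ (r - 1)) * t) P
      = algebraMap ℝ _ (s ^ r - r * s ^ (r - 1) * s) + (r * s ^ (r - 1)) • P := by
    rw [cfc_const_add _ _ P, cfc_const_mul _ _ P, cfc_id' ℝ P]
  have h3 := re_inner_le_of_le hle x
  rw [h2] at h3
  refine le_trans ?_ h3
  have h1 : s ^ r = s ^ (r - 1) * s := by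
    rw [← Real.rpow_add_one hpos.ne']; ring_nf
  have h4 : (inner ℂ x ((algebraMap ℝ (H →L[ℂ] H) (s ^ r - r * s ^ (r - 1) * s)
      + (r * s ^ (r - 1)) • P) x)).re
      = (s ^ r - r * s ^ (r - 1) * s) * ‖x‖ ^ 2 + (r * s ^ (r - 1)) * s := by
    rw [add_apply, inner_add_right, Complex.add_re, Algebra.algebraMap_eq_smul_one,
      smul_apply, smul_apply,
      one_apply_eq_self, inner_smul_right_eq_smul, inner_smul_right_eq_smul,
      Complex.smul_re, Complex.smul_re, ← hs, inner_self_eq_norm_sq_to_K]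
    norm_cast
  rw [h4, h1]
  have hx2 : ‖x‖ ^ 2 ≤ 1 := by
    have := norm_nonneg x
    nlinarith
  have hp0 : 0 ≤ s ^ (r - 1) * s := by positivity
  -- The constant term `(1 - r) s ^ r` of the tangent line is nonpositive, so `‖x‖ ≤ 1` works in the
  -- right direction.
  nlinarith [mul_nonneg (mul_nonneg hp0 (sub_nonneg.2 hr)) (sub_nonneg.2 hx2)]

end Operators

/-! ### Traces, half of the variational formula, and Hilbert–Schmidt operators. -/

section Operators

variable {H E F : Type*} [NormedAddCommGroup H] [InnerProductSpace ℂ H] [CompleteSpace H]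
  [NormedAddCommGroup E] [InnerProductSpace ℂ E] [CompleteSpace E]
  [NormedAddCommGroup F] [InnerProductSpace ℂ F] [CompleteSpace F]

theorem tsum_enorm_inner_sq {ι : Type*} (b : HilbertBasis ι ℂ H) (x : H) :
    ∑' i, ‖inner ℂ (b i) x‖ₑ ^ 2 = ‖x‖ₑ ^ 2 := by
  have h := b.hasSum_inner_mul_inner x x
  have h1 : HasSum (fun i => ‖inner ℂ (b i) x‖ ^ 2) (‖x‖ ^ 2) := by
    have h2 := (Complex.hasSum_re h)
    convert h2 using 1
    · ext i
      rw [← inner_conj_symm, Complex.mul_conj, Complex.ofReal_re,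
        Complex.normSq_eq_norm_sq, RCLike.norm_conj]
    · rw [inner_self_eq_norm_sq_to_K]; norm_cast
  have h3 : ∀ y : ℂ, ‖y‖ₑ ^ 2 = ENNReal.ofReal (‖y‖ ^ 2) := fun y => by
    rw [ENNReal.ofReal_pow (norm_nonneg _), ofReal_norm]
  simp_rw [h3]
  rw [← ENNReal.ofReal_tsum_of_nonneg (fun i => by positivity) h1.summable, h1.tsum_eq,
    ENNReal.ofReal_pow (norm_nonneg _), ofReal_norm]

theorem sum_enorm_inner_sq_le {ι : Type*} {e : ι → H} (he : Orthonormal ℂ e) (s : Finset ι)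
    (x : H) : ∑ i ∈ s, ‖inner ℂ (e i) x‖ₑ ^ 2 ≤ ‖x‖ₑ ^ 2 := by
  have h3 : ∀ y : ℂ, ‖y‖ₑ ^ 2 = ENNReal.ofReal (‖y‖ ^ 2) := fun y => by
    rw [ENNReal.ofReal_pow (norm_nonneg _), ofReal_norm]
  simp_rw [h3]
  rw [← ENNReal.ofReal_sum_of_nonneg (fun i _ => by positivity), ← ofReal_norm,
    ← ENNReal.ofReal_pow (norm_nonneg _)]
  exact ENNReal.ofReal_le_ofReal (he.sum_inner_products_le x)

/-- Both sides add up the squares of all matrix coefficients of `A`. With the bases chosen freely,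
this gives the basis independence of the Hilbert–Schmidt norm. -/
theorem tsum_enorm_sq_adjoint {ι κ : Type*} (A : E →L[ℂ] F) (b : HilbertBasis ι ℂ E)
    (c : HilbertBasis κ ℂ F) :
    ∑' i, ‖A (b i)‖ₑ ^ 2 = ∑' j, ‖ContinuousLinearMap.adjoint A (c j)‖ₑ ^ 2 := by
  simp_rw [← tsum_enorm_inner_sq c (A _), ← tsum_enorm_inner_sq b (ContinuousLinearMap.adjoint A _)]
  rw [ENNReal.tsum_comm]
  refine tsum_congr fun j => tsum_congr fun i => ?_
  rw [ContinuousLinearMap.adjoint_inner_right, ← inner_conj_symm, RCLike.enorm_conj]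

/-- Frees `posTrace` from the basis chosen in its definition: it is the squared Hilbert–Schmidt norm
of the square root. -/
theorem posTrace_eq_tsum {ι : Type*} {P : H →L[ℂ] H} (hP : 0 ≤ P) (b : HilbertBasis ι ℂ H) :
    posTrace P = ∑' i, ‖CFC.sqrt P (b i)‖ₑ ^ 2 := by
  have h2 : ContinuousLinearMap.adjoint (CFC.sqrt P) = CFC.sqrt P :=
    (CFC.sqrt_nonneg P).isSelfAdjoint
  rw [tsum_enorm_sq_adjoint (CFC.sqrt P) b (exists_hilbertBasis ℂ H).choose_spec.choose, h2]
  refine tsum_congr fun i => ?_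
  rw [← norm_sqrt_apply_sq hP, ENNReal.ofReal_pow (norm_nonneg _), ofReal_norm]

/-- This is `Tr (X* P X) ≤ Tr P` with the left trace cut off: expand `P^{1/2} X e i` in a basis `b`,
move `X` to the other side, and apply Bessel's inequality to `e`. -/
theorem sum_inner_le_posTrace {ι : Type*} {P : H →L[ℂ] H} (hP : 0 ≤ P) {e : ι → E}
    (he : Orthonormal ℂ e) (X : E →L[ℂ] H) (hX : ‖X‖ ≤ 1) (s : Finset ι) :
    ∑ i ∈ s, ENNReal.ofReal (inner ℂ (X (e i)) (P (X (e i)))).re ≤ posTrace P := by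
  obtain ⟨w, b, -⟩ := exists_hilbertBasis ℂ H
  have h2 : ContinuousLinearMap.adjoint (CFC.sqrt P) = CFC.sqrt P :=
    (CFC.sqrt_nonneg P).isSelfAdjoint
  rw [posTrace_eq_tsum hP b]
  simp_rw [← norm_sqrt_apply_sq hP, ENNReal.ofReal_pow (norm_nonneg _), ofReal_norm,
    ← tsum_enorm_inner_sq b (CFC.sqrt P (X _))]
  rw [← Summable.tsum_finsetSum (fun i _ => ENNReal.summable)]
  refine ENNReal.tsum_le_tsum fun j => ?_
  have h3 : ∀ i, ‖inner ℂ (b j) (CFC.sqrt P (X (e i)))‖ₑ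
      = ‖inner ℂ (e i) (ContinuousLinearMap.adjoint X (CFC.sqrt P (b j)))‖ₑ := fun i => by
    rw [ContinuousLinearMap.adjoint_inner_right, ← inner_conj_symm, RCLike.enorm_conj,
      ← ContinuousLinearMap.adjoint_inner_right, h2]
  simp_rw [h3]
  refine (sum_enorm_inner_sq_le he s _).trans ?_
  gcongr
  rw [← ofReal_norm, ← ofReal_norm]
  refine ENNReal.ofReal_le_ofReal ((ContinuousLinearMap.le_opNorm _ _).trans ?_)
  rw [LinearIsometryEquiv.norm_map]
  exact mul_le_of_le_one_left (norm_nonneg _) hX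

theorem exists_contraction_comp_abs_eq (T : H →L[ℂ] H) :
    ∃ U : H →L[ℂ] H, ‖U‖ ≤ 1 ∧ U ∘L CFC.abs T = T :=
  exists_contraction_comp_eq T (CFC.abs T) fun x => (norm_cfcAbs_apply T x).ge

/-- Half of the variational formula for the Schatten norm. -/
theorem sum_norm_inner_rpow_le_posTrace {ι : Type*} (T : H →L[ℂ] H) {r : ℝ} (hr : 1 ≤ r)
    {e : ι → E} {f : ι → F} (he : Orthonormal ℂ e) (hf : Orthonormal ℂ f)
    {X : E →L[ℂ] H} {Y : F →L[ℂ] H} (hX : ‖X‖ ≤ 1) (hY : ‖Y‖ ≤ 1) (s : Finset ι) :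
    ∑ i ∈ s, ENNReal.ofReal (‖inner ℂ (Y (f i)) (T (X (e i)))‖ ^ r)
      ≤ posTrace (CFC.abs T ^ r) := by
  obtain ⟨U, hU, hUT⟩ := exists_contraction_comp_abs_eq T
  set P := CFC.abs T with hPdef
  have hP : 0 ≤ P := CFC.abs_nonneg T
  have hPr : 0 ≤ P ^ r := CFC.rpow_nonneg
  -- Since `T = U P` with `P = |T|`, moving `U` to the left vectors leaves a coefficient of the
  -- positive operator `P`.
  set Z : F →L[ℂ] H := ContinuousLinearMap.adjoint U ∘L Y with hZ
  have hZ1 : ‖Z‖ ≤ 1 := by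
    refine (ContinuousLinearMap.opNorm_comp_le _ _).trans ?_
    rw [LinearIsometryEquiv.norm_map]
    exact mul_le_one₀ hU (norm_nonneg _) hY
  -- Cauchy–Schwarz for the form of `P`, then `2ab ≤ a² + b²`, then Jensen's inequality on each of
  -- the two vectors.
  have key : ∀ i, ENNReal.ofReal (‖inner ℂ (Y (f i)) (T (X (e i)))‖ ^ r) ≤
      2⁻¹ * ENNReal.ofReal (inner ℂ (Z (f i)) ((P ^ r) (Z (f i)))).re
      + 2⁻¹ * ENNReal.ofReal (inner ℂ (X (e i)) ((P ^ r) (X (e i)))).re := by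
    intro i
    have hxi : ‖X (e i)‖ ≤ 1 := by
      refine (X.le_opNorm _).trans ?_
      rw [he.1 i, mul_one]; exact hX
    have hzi : ‖Z (f i)‖ ≤ 1 := by
      refine (Z.le_opNorm _).trans ?_
      rw [hf.1 i, mul_one]; exact hZ1
    have h1 : inner ℂ (Y (f i)) (T (X (e i))) = inner ℂ (Z (f i)) (P (X (e i))) := by
      rw [hZ, ContinuousLinearMap.comp_apply, ContinuousLinearMap.adjoint_inner_left, ← hUT]
      rfl
    have h2 : (2⁻¹ : ℝ≥0∞) = ENNReal.ofReal 2⁻¹ := by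
      rw [ENNReal.ofReal_inv_of_pos (by norm_num)]; norm_num
    have n1 : 0 ≤ (inner ℂ (Z (f i)) ((P ^ r) (Z (f i)))).re := by
      rw [← norm_sqrt_apply_sq hPr]; positivity
    have n2 : 0 ≤ (inner ℂ (X (e i)) ((P ^ r) (X (e i)))).re := by
      rw [← norm_sqrt_apply_sq hPr]; positivity
    rw [h2, ← ENNReal.ofReal_mul (by norm_num), ← ENNReal.ofReal_mul (by norm_num),
      ← ENNReal.ofReal_add (by positivity) (by positivity)]
    refine ENNReal.ofReal_le_ofReal ?_
    have j1 := re_inner_rpow_le hP hr hxi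
    have j2 := re_inner_rpow_le hP hr hzi
    rw [← norm_sqrt_apply_sq hP] at j1 j2
    have h3 := norm_inner_le_of_nonneg hP (Z (f i)) (X (e i))
    rw [h1]
    set a := ‖CFC.sqrt P (Z (f i))‖ with ha
    set b := ‖CFC.sqrt P (X (e i))‖ with hb
    have ha0 : 0 ≤ a := norm_nonneg _
    have hb0 : 0 ≤ b := norm_nonneg _
    calc ‖inner ℂ (Z (f i)) (P (X (e i)))‖ ^ r ≤ (a * b) ^ r :=
          Real.rpow_le_rpow (norm_nonneg _) h3 (by linarith)
      _ = a ^ r * b ^ r := Real.mul_rpow ha0 hb0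
      _ ≤ 2⁻¹ * (a ^ r) ^ 2 + 2⁻¹ * (b ^ r) ^ 2 := by nlinarith [sq_nonneg (a ^ r - b ^ r)]
      _ = 2⁻¹ * (a ^ 2) ^ r + 2⁻¹ * (b ^ 2) ^ r := by
          rw [Real.rpow_pow_comm ha0, Real.rpow_pow_comm hb0]
      _ ≤ _ := by gcongr
  calc _ ≤ ∑ i ∈ s, (2⁻¹ * ENNReal.ofReal (inner ℂ (Z (f i)) ((P ^ r) (Z (f i)))).re
      + 2⁻¹ * ENNReal.ofReal (inner ℂ (X (e i)) ((P ^ r) (X (e i)))).re) :=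
        Finset.sum_le_sum fun i _ => key i
    _ ≤ 2⁻¹ * posTrace (P ^ r) + 2⁻¹ * posTrace (P ^ r) := by
        rw [Finset.sum_add_distrib, ← Finset.mul_sum, ← Finset.mul_sum]
        gcongr
        · exact sum_inner_le_posTrace hPr hf Z hZ1 s
        · exact sum_inner_le_posTrace hPr he X hX s
    _ = posTrace (P ^ r) := by rw [← add_mul, ENNReal.inv_two_add_inv_two, one_mul]

/-- Operators with square summable images of a Hilbert basis are compact. -/
theorem isCompactOperator_of_tsum_ne_top {ι : Type*} (b : HilbertBasis ι ℂ H) (A : H →L[ℂ] F)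
    (h : ∑' i, ‖A (b i)‖ₑ ^ 2 ≠ ∞) : IsCompactOperator A := by
  classical
  have hsum : Summable fun i => ‖A (b i)‖ ^ 2 := by
    have := ENNReal.summable_toReal h
    simpa [ENNReal.toReal_pow] using this
  let AP : Finset ι → (H →L[ℂ] F) := fun s =>
    ∑ i ∈ s, (innerSL ℂ (b i)).smulRight (A (b i))
  have hAP : ∀ s x, AP s x = ∑ i ∈ s, inner ℂ (b i) x • A (b i) := fun s x => by
    simp [AP]
  have hcomp : ∀ s, IsCompactOperator (AP s) := by
    intro s
    refine Submodule.sum_mem (compactOperator (RingHom.id ℂ) H F) (t := s)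
      (f := fun i => (innerSL ℂ (b i)).smulRight (A (b i))) ?_ 
    intro i _
    have h1 : IsCompactOperator (innerSL ℂ (b i)) :=
      isCompactOperator_of_locallyCompactSpace_dom (innerSL ℂ (b i))
    exact h1.clm_comp (ContinuousLinearMap.toSpanSingleton ℂ (A (b i)))
  -- By Cauchy–Schwarz, the norm of the difference between `A` and its truncation to `s` is at most
  -- the square root of the tail sum outside `s`.
  have htail : Tendsto (fun s : Finset ι => ∑' i : { i // i ∉ s }, ‖A (b i)‖ ^ 2) atTop (nhds 0) :=
    tendsto_tsum_compl_atTop_zero fun i => ‖A (b i)‖ ^ 2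
  refine isCompactOperator_of_tendsto (F := AP) (l := atTop) ?_ (Eventually.of_forall hcomp)
  rw [tendsto_iff_norm_sub_tendsto_zero]
  have hs := (Real.continuous_sqrt.tendsto 0).comp htail
  rw [Real.sqrt_zero] at hs
  refine squeeze_zero (fun _ => norm_nonneg _) (fun s => ?_) hs
  refine ContinuousLinearMap.opNorm_le_bound _ (Real.sqrt_nonneg _) fun x => ?_
  have h1 : HasSum (fun i => inner ℂ (b i) x • A (b i)) (A x) := by
    have := (b.hasSum_repr x).mapL A
    simpa [b.repr_apply_apply] using this
  have h2 : Tendsto (fun t : Finset ι => ∑ i ∈ t, inner ℂ (b i) x • A (b i) - AP s x) atTop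
      (nhds (A x - AP s x)) := h1.sub_const _
  rw [sub_apply, ← norm_neg, neg_sub]
  refine le_of_tendsto h2.norm ?_
  filter_upwards [eventually_ge_atTop s] with t ht
  rw [hAP, ← Finset.sum_sdiff ht, add_sub_cancel_right]
  calc _ ≤ ∑ i ∈ t \ s, ‖inner ℂ (b i) x‖ * ‖A (b i)‖ := by
        refine (norm_sum_le _ _).trans (le_of_eq ?_)
        simp [norm_smul]
    _ ≤ √(∑ i ∈ t \ s, ‖inner ℂ (b i) x‖ ^ 2) * √(∑ i ∈ t \ s, ‖A (b i)‖ ^ 2) :=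
        Real.sum_mul_le_sqrt_mul_sqrt _ _ _
    _ ≤ ‖x‖ * √(∑' i : { i // i ∉ s }, ‖A (b i)‖ ^ 2) := by
        gcongr
        · exact Real.sqrt_le_iff.2 ⟨norm_nonneg _, b.orthonormal.sum_inner_products_le x⟩
        · have : ∑ i ∈ t \ s, ‖A (b i)‖ ^ 2
              = ∑ i ∈ (t \ s).subtype (· ∉ s), ‖A (b i)‖ ^ 2 := by
            rw [Finset.sum_subtype_of_mem (fun i => ‖A (b i)‖ ^ 2)]
            simp
          rw [this]
          exact (hsum.subtype _).sum_le_tsum _ fun _ _ => by positivity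
    _ = _ := mul_comm _ _

end Operators

/-! ### Compactness from finite Schatten norm, and diagonalization. -/

section Operators

variable {H E F : Type*} [NormedAddCommGroup H] [InnerProductSpace ℂ H] [CompleteSpace H]
  [NormedAddCommGroup E] [InnerProductSpace ℂ E] [CompleteSpace E]
  [NormedAddCommGroup F] [InnerProductSpace ℂ F] [CompleteSpace F]

theorem isCompactOperator_of_norm_le {A : E →L[ℂ] F} {B : E →L[ℂ] H} (hB : IsCompactOperator B)
    (h : ∀ x, ‖A x‖ ≤ ‖B x‖) : IsCompactOperator A := by
  obtain ⟨V, -, rfl⟩ := exists_contraction_comp_eq A B h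
  exact hB.clm_comp V

/-- On the unit ball `‖S x - S y‖² = ⟨x - y, S² (x - y)⟩ ≤ 2 ‖S² x - S² y‖`, so an `ε²/2`-net for
the image under `S²` yields an `ε`-net for the image under `S`. -/
theorem isCompactOperator_of_mul_self {S : H →L[ℂ] H} (hS : IsSelfAdjoint S)
    (h : IsCompactOperator (S * S)) : IsCompactOperator S := by
  have h2 : ContinuousLinearMap.adjoint S = S := hS
  have key : ∀ x y, ‖x‖ ≤ 1 → ‖y‖ ≤ 1 → ‖S x - S y‖ ^ 2 ≤ 2 * ‖(S * S) x - (S * S) y‖ := by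
    intro x y hx hy
    have h1 : ‖S (x - y)‖ ^ 2 = (inner ℂ (x - y) ((S * S) (x - y))).re := by
      rw [mul_apply_eq_comp, ← ContinuousLinearMap.adjoint_inner_left, h2,
        inner_self_eq_norm_sq_to_K]
      norm_cast
    rw [← map_sub, ← map_sub, h1]
    refine (Complex.re_le_norm _).trans ((norm_inner_le_norm _ _).trans ?_)
    gcongr
    exact (norm_sub_le _ _).trans (by linarith)
  have htb : TotallyBounded ((S * S) '' Metric.closedBall 0 1) := by
    have := (IsCompactOperator.isCompact_closure_image_closedBall
      (f := ((S * S : H →L[ℂ] H) : H →ₗ[ℂ] H)) h 1)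
    exact this.totallyBounded.subset subset_closure
  refine (isCompactOperator_iff_isCompact_closure_image_closedBall
    ((S : H →L[ℂ] H) : H →ₗ[ℂ] H) one_pos).2 ?_
  refine TotallyBounded.isCompact_of_isClosed (TotallyBounded.closure ?_) isClosed_closure
  rw [Metric.totallyBounded_iff]
  intro ε hε
  obtain ⟨t, hts, htf, hcov⟩ := totallyBounded_iff_subset.1 htb _
    (Metric.dist_mem_uniformity (show (0 : ℝ) < ε ^ 2 / 2 by positivity))
  have hts' : ∀ z ∈ t, ∃ x, x ∈ Metric.closedBall (0 : H) 1 ∧ (S * S) x = z := fun z hz => hts hz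
  choose! g hg1 hg2 using hts'
  refine ⟨(fun z => S (g z)) '' t, htf.image _, ?_⟩
  rintro _ ⟨x, hx, rfl⟩
  have hx' := hcov ⟨x, hx, rfl⟩
  simp only [Set.mem_iUnion, Set.mem_ofPred_eq] at hx' ⊢
  obtain ⟨z, hz, hd⟩ := hx'
  refine ⟨S (g z), ⟨z, hz, rfl⟩, ?_⟩
  have := key x (g z) (by simpa using hx) (by simpa using hg1 z hz)
  rw [hg2 z hz] at this
  rw [Metric.mem_ball, dist_eq_norm]
  have hd' : ‖(S * S) x - z‖ < ε ^ 2 / 2 := by simpa [dist_eq_norm] using hd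
  exact lt_of_pow_lt_pow_left₀ 2 hε.le (by
    calc _ ≤ 2 * ‖(S * S) x - z‖ := this
      _ < ε ^ 2 := by linarith)

/-- Halve the exponent repeatedly until it is below `1`, then multiply by the complementary power to
reach `P`. -/
theorem isCompactOperator_of_nnrpow {P : H →L[ℂ] H} (hP : 0 ≤ P) {s : ℝ≥0} (hs : 0 < s)
    (h : IsCompactOperator (P ^ s : H →L[ℂ] H)) : IsCompactOperator P := by
  have hn : ∀ n : ℕ, IsCompactOperator (P ^ (s / 2 ^ n) : H →L[ℂ] H) := by
    intro n
    induction n with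
    | zero => simpa using h
    | succ n ih =>
      refine isCompactOperator_of_mul_self CFC.nnrpow_nonneg.isSelfAdjoint ?_
      rw [← CFC.nnrpow_add (by positivity) (by positivity)]
      convert ih using 4
      rw [pow_succ]; field_simp; norm_num
  obtain ⟨n, hn1⟩ := pow_unbounded_of_one_lt s (one_lt_two)
  have hlt : s / 2 ^ n < 1 := (div_lt_one (by positivity)).2 hn1
  have h1 : P = P ^ (1 - s / 2 ^ n) * P ^ (s / 2 ^ n) := by
    rw [← CFC.nnrpow_add (tsub_pos_of_lt hlt) (by positivity), tsub_add_cancel_of_le hlt.le,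
      CFC.nnrpow_one P]
  rw [h1]
  exact (hn n).clm_comp (P ^ (1 - s / 2 ^ n))

/-- If `|T| ^ r` has finite trace, `|T| ^ (r/2)` is Hilbert–Schmidt, hence compact, and compactness
climbs back to `|T|` and to `T`. -/
theorem isCompactOperator_of_posTrace_ne_top (T : H →L[ℂ] H) {r : ℝ} (hr : 0 < r)
    (h : posTrace (CFC.abs T ^ r) ≠ ∞) : IsCompactOperator T := by
  obtain ⟨w, b, -⟩ := exists_hilbertBasis ℂ H
  obtain ⟨r, rfl⟩ : ∃ r' : ℝ≥0, (r' : ℝ) = r := ⟨⟨r, hr.le⟩, rfl⟩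
  have hr0 : 0 < r := by exact_mod_cast hr
  have hn : (0 : H →L[ℂ] H) ≤ CFC.abs T ^ r := CFC.nnrpow_nonneg
  rw [← CFC.nnrpow_eq_rpow hr0, posTrace_eq_tsum hn b, CFC.sqrt_nnrpow] at h
  have h1 := isCompactOperator_of_nnrpow (CFC.abs_nonneg T)
    (s := r / 2) (half_pos hr0) (isCompactOperator_of_tsum_ne_top b _ h)
  exact isCompactOperator_of_norm_le h1 fun x => (norm_cfcAbs_apply T x).ge

/-- The functional calculus on an eigenvector. -/
theorem cfc_apply_eigenvector {P : H →L[ℂ] H} (hP : IsSelfAdjoint P) {s : ℝ} {v : H}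
    (hv : v ≠ 0) (h : P v = (s : ℂ) • v) {f : ℝ → ℝ} (hf : Continuous f) :
    cfc f P v = (f s : ℂ) • v := by
  have hs : s ∈ spectrum ℝ P := by
    rw [spectrum.mem_iff]
    intro hu
    obtain ⟨u, hu⟩ := hu
    have h0 : (algebraMap ℝ (H →L[ℂ] H) s - P) v = 0 := by
      rw [sub_apply, Algebra.algebraMap_eq_smul_one, smul_apply, one_apply_eq_self, h]
      simp
    apply hv
    have : ((u⁻¹ : (H →L[ℂ] H)ˣ) : H →L[ℂ] H) ((u : H →L[ℂ] H) v) = v := by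
      rw [← mul_apply_eq_comp, Units.inv_mul, one_apply_eq_self]
    rw [← this, hu, h0, map_zero]
  -- The identity holds for constants and for the coordinate function, is stable under sums,
  -- products and limits, and hence holds on all of `C(spectrum ℝ P, ℝ)` by Stone–Weierstrass.
  have key : ∀ g : C(spectrum ℝ P, ℝ), cfcHom hP g v = (g ⟨s, hs⟩ : ℂ) • v := by
    intro g
    have : CompactSpace (spectrum ℝ P) := inferInstance
    refine ContinuousMap.induction_on_of_compact (𝕜 := ℝ) (s := spectrum ℝ P)
      (p := fun g => cfcHom hP g v = (g ⟨s, hs⟩ : ℂ) • v) ?_ ?_ ?_ ?_ ?_ ?_ g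
    · intro r
      have h1 : ContinuousMap.const (spectrum ℝ P) r = algebraMap ℝ C(spectrum ℝ P, ℝ) r := rfl
      rw [h1, AlgHomClass.commutes, Algebra.algebraMap_eq_smul_one, smul_apply, one_apply_eq_self]
      simp
    · rw [cfcHom_id]
      simpa using h
    · rw [map_star, cfcHom_id, hP.star_eq]
      simpa using h
    · intro f g hf hg
      rw [map_add, add_apply, hf, hg]
      simp [add_smul]
    · intro f g hf hg
      rw [map_mul, mul_apply_eq_comp, hg, ContinuousLinearMap.map_smul, hf, smul_smul, mul_comm]
      simp
    · intro f hfr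
      have hcl : IsClosed {g : C(spectrum ℝ P, ℝ) | cfcHom hP g v = (g ⟨s, hs⟩ : ℂ) • v} := by
        refine isClosed_eq ?_ ?_
        · exact (ContinuousLinearMap.apply ℂ H v).continuous.comp (cfcHom_continuous hP)
        · have : Continuous fun g : C(spectrum ℝ P, ℝ) => g ⟨s, hs⟩ :=
            continuous_eval_const _
          exact (Complex.continuous_ofReal.comp this).smul continuous_const
      exact hcl.mem_of_frequently_of_tendsto hfr tendsto_id
  rw [cfc_apply f P hP hf.continuousOn]
  exact key _

open scoped ComplexOrder in
/-- Diagonalization of positive compact operators. -/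
theorem exists_eigenbasis {H : Type u} [NormedAddCommGroup H] [InnerProductSpace ℂ H]
    [CompleteSpace H] {P : H →L[ℂ] H} (hP : 0 ≤ P) (hc : IsCompactOperator P) :
    ∃ (ι : Type u) (b : HilbertBasis ι ℂ H) (s : ι → ℝ),
      (∀ i, 0 ≤ s i) ∧ ∀ i, P (b i) = (s i : ℂ) • b i := by
  have hpos := (ContinuousLinearMap.nonneg_iff_isPositive P).1 hP
  have hsym : (P : H →ₗ[ℂ] H).IsSymmetric := hP.isSelfAdjoint.isSymmetric
  have hcl : ∀ μ : ℂ, CompleteSpace (Module.End.eigenspace (P : H →ₗ[ℂ] H) μ) := by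
    intro μ
    have : IsClosed ((Module.End.eigenspace (P : H →ₗ[ℂ] H) μ : Submodule ℂ H) : Set H) := by
      have h1 : ((Module.End.eigenspace (P : H →ₗ[ℂ] H) μ : Submodule ℂ H) : Set H)
          = {x | P x = μ • x} := by
        ext x
        simp
      rw [h1]
      exact isClosed_eq P.continuous (continuous_const_smul μ)
    exact this.completeSpace_coe
  choose w b _ using fun μ : ℂ => exists_hilbertBasis ℂ (Module.End.eigenspace (P : H →ₗ[ℂ] H) μ)
  have hon : Orthonormal ℂ fun a : Σ μ, w μ =>
      (Module.End.eigenspace (P : H →ₗ[ℂ] H) a.1).subtypeₗᵢ (b a.1 a.2) :=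
    hsym.orthogonalFamily_eigenspaces.orthonormal_sigma_orthonormal fun μ => (b μ).orthonormal
  -- A vector orthogonal to a basis of each eigenspace is orthogonal to all eigenspaces, so it
  -- vanishes by the spectral theorem for compact symmetric operators.
  have hbot : (Submodule.span ℂ (Set.range fun a : Σ μ, w μ =>
      (Module.End.eigenspace (P : H →ₗ[ℂ] H) a.1).subtypeₗᵢ (b a.1 a.2)))ᗮ = ⊥ := by
    rw [eq_bot_iff, ← ContinuousLinearMap.orthogonalComplement_iSup_eigenspaces_eq_bot hc hsym]
    intro x hx
    rw [← Submodule.iInf_orthogonal, Submodule.mem_iInf]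
    intro μ
    rw [Submodule.mem_orthogonal]
    intro u hu
    have h1 : ∀ i, inner ℂ ((b μ i : Module.End.eigenspace (P : H →ₗ[ℂ] H) μ) : H) x = 0 :=
      fun i => (Submodule.mem_orthogonal _ _).1 hx _ (Submodule.subset_span ⟨⟨μ, i⟩, rfl⟩)
    have h2 := (b μ).hasSum_repr ⟨u, hu⟩
    have h3 := (h2.mapL (Submodule.subtypeL _)).mapL (innerSL ℂ x)
    have h4 : HasSum (fun _ : w μ => (0 : ℂ)) (inner ℂ x u) := by
      have h5 : (fun _ : w μ => (0 : ℂ)) = fun i => innerSL ℂ x (Submodule.subtypeL _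
          ((b μ).repr ⟨u, hu⟩ i • b μ i)) := by
        funext i
        simp [inner_eq_zero_symm.1 (h1 i)]
      rw [h5]
      exact h3
    exact inner_eq_zero_symm.1 (h4.unique hasSum_zero)
  refine ⟨Σ μ, w μ, HilbertBasis.mkOfOrthogonalEqBot hon hbot, fun a => a.1.re, ?_⟩
  have hap : ∀ a : Σ μ, w μ, P (HilbertBasis.mkOfOrthogonalEqBot hon hbot a)
      = a.1 • HilbertBasis.mkOfOrthogonalEqBot hon hbot a := by
    intro a
    rw [HilbertBasis.coe_mkOfOrthogonalEqBot]
    exact Module.End.mem_eigenspace_iff.1 (b a.1 a.2).2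
  have hin : ∀ a : Σ μ, w μ, inner ℂ (HilbertBasis.mkOfOrthogonalEqBot hon hbot a)
      (P (HilbertBasis.mkOfOrthogonalEqBot hon hbot a)) = a.1 := by
    intro a
    rw [hap, inner_smul_right, inner_self_eq_norm_sq_to_K,
      (HilbertBasis.mkOfOrthogonalEqBot hon hbot).orthonormal.1 a]
    simp
  have hnn : ∀ a : Σ μ, w μ, 0 ≤ a.1 := fun a => by
    rw [← hin a]
    exact hpos.inner_nonneg_right _
  refine ⟨fun a => (Complex.nonneg_iff.1 (hnn a)).1, fun a => ?_⟩
  rw [hap]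
  congr 1
  exact Complex.ext (by simp) (by simpa using (Complex.nonneg_iff.1 (hnn a)).2.symm)

end Operators

/-! ### The other half of the variational formula. -/

section Operators
variable {H : Type*} [NormedAddCommGroup H] [InnerProductSpace ℂ H] [CompleteSpace H]
/-- The other half of the variational formula for the Schatten norm. -/
theorem posTrace_le_of_forall_sum_le (T : H →L[ℂ] H) (hT : IsCompactOperator T) {r : ℝ}
    (hr : 0 < r) {c : ℝ≥0∞}
    (h : ∀ (n : ℕ) (e f : Fin n → H), Orthonormal ℂ e → Orthonormal ℂ f →
      ∑ i, ENNReal.ofReal (‖inner ℂ (f i) (T (e i))‖ ^ r) ≤ c) :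
    posTrace (CFC.abs T ^ r) ≤ c := by
  classical
  have hP : 0 ≤ CFC.abs T := CFC.abs_nonneg T
  obtain ⟨ι, b, s, hs0, hs⟩ := exists_eigenbasis hP
    (isCompactOperator_of_norm_le hT fun x => (norm_cfcAbs_apply T x).le)
  have hb0 : ∀ i, b i ≠ 0 := fun i h0 => by
    have := b.orthonormal.1 i
    simp [h0] at this
  have hpow : ∀ i, (CFC.abs T ^ r) (b i) = ((s i ^ r : ℝ) : ℂ) • b i := fun i => by
    rw [CFC.rpow_eq_cfc_real hP]
    exact cfc_apply_eigenvector hP.isSelfAdjoint (hb0 i) (hs i)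
      (Real.continuous_rpow_const hr.le)
  have hn : (0 : H →L[ℂ] H) ≤ CFC.abs T ^ r := CFC.rpow_nonneg
  rw [posTrace_eq_tsum hn b]
  have hterm : ∀ i, ‖CFC.sqrt (CFC.abs T ^ r) (b i)‖ₑ ^ 2 = ENNReal.ofReal (s i ^ r) := fun i => by
    rw [← ofReal_norm, ← ENNReal.ofReal_pow (norm_nonneg _), norm_sqrt_apply_sq hn,
      hpow, inner_smul_right, inner_self_eq_norm_sq_to_K, b.orthonormal.1 i]
    simp
  simp_rw [hterm]
  rw [ENNReal.tsum_eq_iSup_sum]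
  refine iSup_le fun t => ?_
  -- Zero eigenvalues contribute nothing, and dropping them allows division by `s i` in the test
  -- family.
  set t' := t.filter fun i => s i ≠ 0 with ht'
  have hsum : ∑ i ∈ t, ENNReal.ofReal (s i ^ r) = ∑ i ∈ t', ENNReal.ofReal (s i ^ r) := by
    rw [ht', Finset.sum_filter]
    refine Finset.sum_congr rfl fun i _ => ?_
    split_ifs with hi
    · rfl
    · rw [not_not.1 hi, Real.zero_rpow hr.ne', ENNReal.ofReal_zero]
  rw [hsum]
  let φ : Fin t'.card ≃ t' := t'.equivFin.symm
  have hne : ∀ j, s (φ j) ≠ 0 := fun j => (Finset.mem_filter.1 (φ j).2).2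
  have hTT : ∀ i j, inner ℂ (T (b i)) (T (b j)) = inner ℂ (b i) (((s j) ^ 2 : ℂ) • b j) := by
    intro i j
    rw [← ContinuousLinearMap.adjoint_inner_right]
    have h1 := congrArg (fun A : H →L[ℂ] H => A (b j)) (CFC.abs_mul_abs T)
    have h2 : ContinuousLinearMap.adjoint T (T (b j)) = CFC.abs T (CFC.abs T (b j)) := h1.symm
    rw [h2, hs, map_smul, hs, smul_smul, sq]
  have hinn : ∀ i j, inner ℂ (b i) (b j) = if i = j then (1 : ℂ) else 0 :=
    orthonormal_iff_ite.1 b.orthonormal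
  have hinj : ∀ i j, ((φ i : ι) = φ j) ↔ i = j := fun i j =>
    ⟨fun h => φ.injective (Subtype.ext h), fun h => by rw [h]⟩
  -- The optimal test pair is read off the polar decomposition: eigenvectors `b i` of `|T|` and
  -- their normalized images `T (b i) / s i`, for which the coefficient is `s i`.
  have := h t'.card (fun j => b (φ j)) (fun j => ((s (φ j) : ℂ)⁻¹) • T (b (φ j)))
    (b.orthonormal.comp _ (Subtype.val_injective.comp φ.injective)) (by
      rw [orthonormal_iff_ite]
      intro i j
      rw [inner_smul_left, inner_smul_right, hTT, inner_smul_right, hinn]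
      simp only [hinj]
      split_ifs with hij
      · subst hij
        have : (s (φ i) : ℂ) ≠ 0 := by exact_mod_cast hne i
        simp
        field_simp
      · simp)
  refine le_trans (le_of_eq ?_) this
  rw [← Finset.sum_coe_sort t', ← φ.sum_comp]
  refine Finset.sum_congr rfl fun j _ => ?_
  congr 1
  rw [inner_smul_left, hTT, inner_smul_right, hinn]
  have : (s (φ j) : ℂ) ≠ 0 := by exact_mod_cast hne j
  simp only [map_inv₀, Complex.conj_ofReal, if_true, mul_one, sq]
  rw [inv_mul_cancel_left₀ this, Complex.norm_real, Real.norm_of_nonneg (hs0 _)]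

end Operators

/-! ### The variational formula for the Schatten norm and its consequences. -/

section SchattenNorm

variable {H E F : Type*} [NormedAddCommGroup H] [InnerProductSpace ℂ H] [CompleteSpace H]
  [NormedAddCommGroup E] [InnerProductSpace ℂ E] [CompleteSpace E]
  [NormedAddCommGroup F] [InnerProductSpace ℂ F] [CompleteSpace F]

theorem norm_toLp_le_iff {ι : Type*} [Fintype ι] {p : ℝ≥0∞} (hp : 1 ≤ p) (hp' : p ≠ ∞)
    (v : ι → ℂ) (c : ℝ≥0) :
    ‖WithLp.toLp p v‖ ≤ c ↔
      ∑ i, ENNReal.ofReal (‖v i‖ ^ p.toReal) ≤ (c : ℝ≥0∞) ^ p.toReal := by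
  have h1 : 1 ≤ p.toReal := by
    rw [← ENNReal.toReal_one]
    exact ENNReal.toReal_mono hp' hp
  have h0 : 0 < p.toReal := by linarith
  rw [PiLp.norm_eq_sum h0, one_div, Real.rpow_inv_le_iff_of_pos
      (Finset.sum_nonneg fun i _ => by positivity) c.coe_nonneg h0,
    ← ENNReal.ofReal_sum_of_nonneg (fun i _ => by positivity), ← ENNReal.ofReal_coe_nnreal,
    ENNReal.ofReal_rpow_of_nonneg c.coe_nonneg h0.le, ENNReal.ofReal_le_ofReal_iff (by positivity)]

theorem norm_toLp_le_of_schattenNorm_le {p : ℝ≥0∞} (hp : 1 ≤ p) {T : H →L[ℂ] H} {c : ℝ≥0}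
    (h : schattenNorm p T ≤ c) {n : ℕ} {e : Fin n → E} {f : Fin n → F}
    (he : Orthonormal ℂ e) (hf : Orthonormal ℂ f) {X : E →L[ℂ] H} {Y : F →L[ℂ] H}
    (hX : ‖X‖ ≤ 1) (hY : ‖Y‖ ≤ 1) :
    ‖WithLp.toLp p fun i => inner ℂ (Y (f i)) (T (X (e i)))‖ ≤ c := by
  unfold schattenNorm at h
  split_ifs at h with hpt hcomp
  · subst hpt
    have hT : ‖T‖ ≤ c := by
      rw [← ofReal_norm, ← ENNReal.ofReal_coe_nnreal] at h
      exact (ENNReal.ofReal_le_ofReal_iff c.coe_nonneg).1 h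
    rw [PiLp.norm_eq_ciSup]
    refine Real.iSup_le (fun i => ?_) c.coe_nonneg
    refine (norm_inner_le_norm _ _).trans ?_
    have h1 : ‖Y (f i)‖ ≤ 1 := by
      refine (Y.le_opNorm _).trans ?_
      rw [hf.1 i, mul_one]; exact hY
    have h2 : ‖X (e i)‖ ≤ 1 := by
      refine (X.le_opNorm _).trans ?_
      rw [he.1 i, mul_one]; exact hX
    calc _ ≤ 1 * (‖T‖ * 1) := by
          gcongr
          exact (T.le_opNorm _).trans (by gcongr)
      _ ≤ c := by simpa using hT
  · exact absurd h (by simp)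
  · have h1 : 1 ≤ p.toReal := by
      rw [← ENNReal.toReal_one]
      exact ENNReal.toReal_mono hpt hp
    rw [norm_toLp_le_iff hp hpt]
    rw [one_div, ENNReal.rpow_inv_le_iff (by linarith)] at h
    exact (sum_norm_inner_rpow_le_posTrace T h1 he hf hX hY _).trans h

theorem isCompactOperator_of_memSchatten {p : ℝ≥0∞} (hp : 1 ≤ p) {T : H →L[ℂ] H}
    (h : MemSchatten p T) : IsCompactOperator T := by
  unfold MemSchatten schattenNorm at h
  split_ifs at h with hpt hcomp
  · exact hcomp
  · exact absurd h (by simp)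
  · have h1 : 1 ≤ p.toReal := by
      rw [← ENNReal.toReal_one]
      exact ENNReal.toReal_mono hpt hp
    refine isCompactOperator_of_posTrace_ne_top T (r := p.toReal) (by linarith) fun h0 => ?_
    rw [h0, ENNReal.top_rpow_of_pos (by positivity)] at h
    exact lt_irrefl _ h

/-- Variational description of the Schatten norm. -/
theorem schattenNorm_le_iff {p : ℝ≥0∞} (hp : 1 ≤ p) {T : H →L[ℂ] H} {c : ℝ≥0} :
    schattenNorm p T ≤ c ↔ IsCompactOperator T ∧
      ∀ (n : ℕ) (e f : Fin n → H), Orthonormal ℂ e → Orthonormal ℂ f →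
        ‖WithLp.toLp p fun i => inner ℂ (f i) (T (e i))‖ ≤ c := by
  constructor
  · intro h
    refine ⟨isCompactOperator_of_memSchatten hp (h.trans_lt ENNReal.coe_lt_top),
      fun n e f he hf => ?_⟩
    exact norm_toLp_le_of_schattenNorm_le hp h he hf (X := ContinuousLinearMap.id ℂ H)
      (Y := ContinuousLinearMap.id ℂ H) ContinuousLinearMap.norm_id_le
      ContinuousLinearMap.norm_id_le
  · rintro ⟨hc, h⟩
    unfold schattenNorm
    split_ifs with hpt
    · subst hpt
      rw [← ofReal_norm, ← ENNReal.ofReal_coe_nnreal, ENNReal.ofReal_le_ofReal_iff c.coe_nonneg]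
      refine ContinuousLinearMap.opNorm_le_of_unit_norm c.coe_nonneg fun x hx => ?_
      by_cases h0 : T x = 0
      · rw [h0, norm_zero]; exact c.coe_nonneg
      -- For `p = ∞` families of length one suffice: test on `x` and `T x / ‖T x‖`.
      have h1 := h 1 (fun _ => x) (fun _ => ((‖T x‖ : ℂ)⁻¹) • T x) ?_ ?_
      · rw [PiLp.norm_eq_ciSup] at h1
        simp only [ciSup_const] at h1
        rw [inner_smul_left, inner_self_eq_norm_sq_to_K] at h1
        have h2 : (‖T x‖ : ℂ) ≠ 0 := by exact_mod_cast norm_ne_zero_iff.2 h0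
        simpa [sq, h2] using h1
      · exact orthonormal_iff_ite.2 fun i j => by
          rw [Subsingleton.elim i j, inner_self_eq_norm_sq_to_K, hx]; simp
      · refine orthonormal_iff_ite.2 fun i j => ?_
        have h2 : (‖T x‖ : ℂ) ≠ 0 := by exact_mod_cast norm_ne_zero_iff.2 h0
        rw [Subsingleton.elim i j, inner_self_eq_norm_sq_to_K, norm_smul]
        simp [h0]
    · have h1 : 1 ≤ p.toReal := by
        rw [← ENNReal.toReal_one]
        exact ENNReal.toReal_mono hpt hp
      rw [one_div, ENNReal.rpow_inv_le_iff (by linarith)]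
      refine posTrace_le_of_forall_sum_le T hc (by linarith) fun n e f he hf => ?_
      exact (norm_toLp_le_iff hp hpt _ c).1 (h n e f he hf)

/-- The coefficients of `Y* T X` against orthonormal `e`, `f` are those of `T` against `X e`, `Y f`,
and the upper half of the variational formula allows contractions there. -/
theorem schattenNorm_conj_le {p : ℝ≥0∞} (hp : 1 ≤ p) (T : H →L[ℂ] H) {X Y : E →L[ℂ] H}
    (hX : ‖X‖ ≤ 1) (hY : ‖Y‖ ≤ 1) :
    schattenNorm p (ContinuousLinearMap.adjoint Y ∘L T ∘L X) ≤ schattenNorm p T := by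
  by_cases htop : schattenNorm p T = ∞
  · rw [htop]; exact le_top
  obtain ⟨c, hc⟩ : ∃ c : ℝ≥0, (c : ℝ≥0∞) = schattenNorm p T := ⟨_, ENNReal.coe_toNNReal htop⟩
  rw [← hc, schattenNorm_le_iff hp]
  refine ⟨?_, fun n e f he hf => ?_⟩
  · have := isCompactOperator_of_memSchatten hp (lt_top_iff_ne_top.2 htop)
    exact (this.comp_clm X).clm_comp (ContinuousLinearMap.adjoint Y)
  · have := norm_toLp_le_of_schattenNorm_le hp hc.ge he hf hX hY
    simpa [ContinuousLinearMap.adjoint_inner_right] using this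

/-- Each variational test sees finitely many matrix coefficients, so the bound passes to weak
limits. Compactness does not, which is why it is assumed of `T`. -/
theorem schattenNorm_le_of_tendsto {p : ℝ≥0∞} (hp : 1 ≤ p) {T : H →L[ℂ] H}
    (hT : IsCompactOperator T) {ι : Type*} {l : Filter ι} [l.NeBot] {S : ι → (H →L[ℂ] H)}
    (hS : ∀ x y, Tendsto (fun i => inner ℂ x (S i y)) l (nhds (inner ℂ x (T y)))) {c : ℝ≥0∞}
    (h : ∀ i, schattenNorm p (S i) ≤ c) : schattenNorm p T ≤ c := by
  by_cases htop : c = ∞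
  · rw [htop]; exact le_top
  lift c to ℝ≥0 using htop
  have : Fact (1 ≤ p) := ⟨hp⟩
  rw [schattenNorm_le_iff hp]
  refine ⟨hT, fun n e f he hf => ?_⟩
  have h1 : Tendsto (fun i => WithLp.toLp p fun j => inner ℂ (f j) (S i (e j))) l
      (nhds (WithLp.toLp p fun j => inner ℂ (f j) (T (e j)))) :=
    ((PiLp.continuous_toLp p _).tendsto _).comp (tendsto_pi_nhds.2 fun j => hS _ _)
  exact le_of_tendsto h1.norm (Eventually.of_forall fun i =>
    ((schattenNorm_le_iff hp).1 (h i)).2 n e f he hf)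

/-- In each variational test this is the inequality between the norm of an integral and a uniform
bound of the integrand, in a finite-dimensional `ℓ^p`. -/
theorem schattenNorm_le_of_integral {p : ℝ≥0∞} (hp : 1 ≤ p) {T : H →L[ℂ] H}
    (hT : IsCompactOperator T) {Ω : Type*} [MeasurableSpace Ω] {m : Measure Ω}
    [IsProbabilityMeasure m] {S : Ω → (H →L[ℂ] H)}
    (hS : ∀ x y, Integrable (fun ω => inner ℂ x (S ω y)) m ∧
      ∫ ω, inner ℂ x (S ω y) ∂m = inner ℂ x (T y)) {c : ℝ≥0∞}
    (h : ∀ ω, schattenNorm p (S ω) ≤ c) : schattenNorm p T ≤ c := by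
  by_cases htop : c = ∞
  · rw [htop]; exact le_top
  lift c to ℝ≥0 using htop
  have : Fact (1 ≤ p) := ⟨hp⟩
  rw [schattenNorm_le_iff hp]
  refine ⟨hT, fun n e f he hf => ?_⟩
  let L := (PiLp.continuousLinearEquiv p ℂ fun _ : Fin n => ℂ).symm
  have hI : Integrable (fun ω j => inner ℂ (f j) (S ω (e j))) m :=
    Integrable.of_eval fun j => (hS _ _).1
  have h1 : ∫ ω, L (fun j => inner ℂ (f j) (S ω (e j))) ∂m
      = WithLp.toLp p fun j => inner ℂ (f j) (T (e j)) := by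
    rw [L.integral_comp_comm]
    have : ∫ ω, (fun j => inner ℂ (f j) (S ω (e j))) ∂m = fun j => inner ℂ (f j) (T (e j)) := by
      funext j
      rw [eval_integral fun j => (hS _ _).1]
      exact (hS _ _).2
    rw [this]
    rfl
  rw [← h1]
  refine (norm_integral_le_of_norm_le_const (C := c) (Eventually.of_forall fun ω => ?_)).trans ?_
  · exact ((schattenNorm_le_iff hp).1 (h ω)).2 n e f he hf
  · simp

/-- The `ℓ^p` norm of the test vector is at most its `ℓ¹` norm, which Cauchy–Schwarz and two Bessel
inequalities bound by `‖x‖ ‖y‖`. -/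
theorem schattenNorm_rankOne_le {p : ℝ≥0∞} (hp : 1 ≤ p) (x y : H) :
    schattenNorm p (InnerProductSpace.rankOne ℂ x y) ≤ ((‖x‖₊ * ‖y‖₊ : ℝ≥0) : ℝ≥0∞) := by
  have : Fact (1 ≤ p) := ⟨hp⟩
  rw [schattenNorm_le_iff hp]
  refine ⟨?_, fun n e f he hf => ?_⟩
  · have h1 : IsCompactOperator (innerSL ℂ y) := isCompactOperator_of_locallyCompactSpace_dom _
    exact h1.clm_comp (ContinuousLinearMap.toSpanSingleton ℂ x)
  · have h1 : (WithLp.toLp p fun i => inner ℂ (f i) (InnerProductSpace.rankOne ℂ x y (e i)))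
        = ∑ i, (PiLp.single p i (inner ℂ (f i) (InnerProductSpace.rankOne ℂ x y (e i))) :
          PiLp p fun _ : Fin n => ℂ) := by
      ext j
      simp [Finset.sum_apply, Pi.single_apply]
    rw [h1]
    refine (norm_sum_le _ _).trans ?_
    simp only [PiLp.norm_single, InnerProductSpace.rankOne_apply, inner_smul_right, norm_mul]
    refine (Real.sum_mul_le_sqrt_mul_sqrt _ _ _).trans ?_
    rw [mul_comm]
    push_cast
    gcongr
    · exact Real.sqrt_le_iff.2 ⟨norm_nonneg _, hf.sum_inner_products_le x⟩
    · refine Real.sqrt_le_iff.2 ⟨norm_nonneg _, ?_⟩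
      simpa [norm_inner_symm] using he.sum_inner_products_le (s := Finset.univ) y

theorem memSchatten_rankOne {p : ℝ≥0∞} (hp : 1 ≤ p) (x y : H) :
    MemSchatten p (InnerProductSpace.rankOne ℂ x y) :=
  (schattenNorm_rankOne_le hp x y).trans_lt ENNReal.coe_lt_top

end SchattenNorm

/-! ### Operators on Hilbert space tensor products. -/

section Tensor

variable {H H' H'' K K' K'' : Type*} [NormedAddCommGroup H] [InnerProductSpace ℂ H]
  [NormedAddCommGroup K] [InnerProductSpace ℂ K]
  [NormedAddCommGroup H'] [InnerProductSpace ℂ H']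
  [NormedAddCommGroup K'] [InnerProductSpace ℂ K']
  [NormedAddCommGroup H''] [InnerProductSpace ℂ H'']
  [NormedAddCommGroup K''] [InnerProductSpace ℂ K'']

/-- The bounded operator `A ⊗ B` between Hilbert space tensor products. -/
noncomputable def tensorMap (A : H →L[ℂ] H') (B : K →L[ℂ] K') :
    HilbertTensor H K →L[ℂ] HilbertTensor H' K' :=
  (TensorProduct.mapL A B).completion

/-- The elementary tensor `h ⊗ k` in the Hilbert space tensor product. -/
noncomputable def pureTensor (h : H) (k : K) : HilbertTensor H K :=
  ((h ⊗ₜ[ℂ] k : H ⊗[ℂ] K) : HilbertTensor H K)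

theorem tensorOp_eq_tensorMap (A : H →L[ℂ] H) (B : K →L[ℂ] K) : tensorOp A B = tensorMap A B := rfl

theorem tensorMap_coe (A : H →L[ℂ] H') (B : K →L[ℂ] K') (z : H ⊗[ℂ] K) :
    tensorMap A B (z : HilbertTensor H K) = ((TensorProduct.mapL A B z : H' ⊗[ℂ] K') :
      HilbertTensor H' K') :=
  ContinuousLinearMap.completion_apply_coe _ _

@[simp]
theorem tensorMap_pureTensor (A : H →L[ℂ] H') (B : K →L[ℂ] K') (h : H) (k : K) :
    tensorMap A B (pureTensor h k) = pureTensor (A h) (B k) := by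
  rw [pureTensor, tensorMap_coe, TensorProduct.mapL_tmul, pureTensor]

theorem inner_pureTensor (h h' : H) (k k' : K) :
    inner ℂ (pureTensor h k) (pureTensor h' k') = inner ℂ h h' * inner ℂ k k' := by
  rw [pureTensor, pureTensor, UniformSpace.Completion.inner_coe, TensorProduct.inner_tmul]

/-- Density induction for Hilbert space tensor products. -/
theorem hilbertTensor_induction {p : HilbertTensor H K → Prop} (z : HilbertTensor H K)
    (hcl : IsClosed {z | p z}) (hzero : p 0) (hadd : ∀ x y, p x → p y → p (x + y))
    (hpure : ∀ h k, p (pureTensor h k)) : p z := by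
  refine UniformSpace.Completion.induction_on z hcl fun a => ?_
  induction a using TensorProduct.induction_on with
  | zero => rw [UniformSpace.Completion.coe_zero]; exact hzero
  | tmul x y => exact hpure x y
  | add x y hx hy => rw [UniformSpace.Completion.coe_add]; exact hadd _ _ hx hy

theorem hilbertTensor_ext {F : Type*} [NormedAddCommGroup F] [NormedSpace ℂ F]
    {A B : HilbertTensor H K →L[ℂ] F} (h : ∀ x y, A (pureTensor x y) = B (pureTensor x y)) :
    A = B := by
  ext z
  refine hilbertTensor_induction (p := fun z => A z = B z) z
    (isClosed_eq A.continuous B.continuous) (by simp) (fun x y hx hy => by simp [hx, hy]) h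

theorem tensorMap_comp (A : H' →L[ℂ] H'') (B : K' →L[ℂ] K'') (A' : H →L[ℂ] H') (B' : K →L[ℂ] K') :
    tensorMap (A ∘L A') (B ∘L B') = tensorMap A B ∘L tensorMap A' B' :=
  hilbertTensor_ext fun x y => by simp

theorem pureTensor_add_left (x x' : H) (y : K) :
    pureTensor (x + x') y = pureTensor x y + pureTensor x' y := by
  simp only [pureTensor, TensorProduct.add_tmul, UniformSpace.Completion.coe_add]

theorem pureTensor_smul_left (c : ℂ) (x : H) (y : K) :
    pureTensor (c • x) y = c • pureTensor x y := by
  simp only [pureTensor, ← TensorProduct.smul_tmul', UniformSpace.Completion.coe_smul]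

theorem pureTensor_add_right (x : H) (y y' : K) :
    pureTensor x (y + y') = pureTensor x y + pureTensor x y' := by
  simp only [pureTensor, TensorProduct.tmul_add, UniformSpace.Completion.coe_add]

theorem pureTensor_smul_right (c : ℂ) (x : H) (y : K) :
    pureTensor x (c • y) = c • pureTensor x y := by
  simp only [pureTensor, TensorProduct.tmul_smul, UniformSpace.Completion.coe_smul]

theorem tensorMap_add_left (A A' : H →L[ℂ] H') (B : K →L[ℂ] K') :
    tensorMap (A + A') B = tensorMap A B + tensorMap A' B :=
  hilbertTensor_ext fun x y => by simp [pureTensor_add_left]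

theorem tensorMap_smul_left (c : ℂ) (A : H →L[ℂ] H') (B : K →L[ℂ] K') :
    tensorMap (c • A) B = c • tensorMap A B :=
  hilbertTensor_ext fun x y => by simp [pureTensor_smul_left]

theorem tensorMap_add_right (A : H →L[ℂ] H') (B B' : K →L[ℂ] K') :
    tensorMap A (B + B') = tensorMap A B + tensorMap A B' :=
  hilbertTensor_ext fun x y => by simp [pureTensor_add_right]

theorem tensorMap_smul_right (c : ℂ) (A : H →L[ℂ] H') (B : K →L[ℂ] K') :
    tensorMap A (c • B) = c • tensorMap A B :=
  hilbertTensor_ext fun x y => by simp [pureTensor_smul_right]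

theorem norm_pureTensor (x : H) (y : K) : ‖pureTensor x y‖ = ‖x‖ * ‖y‖ := by
  rw [pureTensor, UniformSpace.Completion.norm_coe, TensorProduct.norm_tmul]

theorem norm_tensorMap_le (A : H →L[ℂ] H') (B : K →L[ℂ] K') : ‖tensorMap A B‖ ≤ ‖A‖ * ‖B‖ := by
  refine ContinuousLinearMap.opNorm_le_bound _ (by positivity) fun z => ?_
  refine UniformSpace.Completion.induction_on z (isClosed_le (by fun_prop) (by fun_prop))
    fun a => ?_
  rw [tensorMap_coe, UniformSpace.Completion.norm_coe, UniformSpace.Completion.norm_coe]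
  exact (ContinuousLinearMap.le_opNorm _ _).trans
    (by gcongr; exact TensorProduct.norm_mapL_le A B)

theorem tensorMap_zero_left (B : K →L[ℂ] K') : tensorMap (0 : H →L[ℂ] H') B = 0 := by
  rw [← zero_smul ℂ (0 : H →L[ℂ] H'), tensorMap_smul_left, zero_smul]

theorem tensorMap_zero_right (A : H →L[ℂ] H') : tensorMap A (0 : K →L[ℂ] K') = 0 := by
  rw [← zero_smul ℂ (0 : K →L[ℂ] K'), tensorMap_smul_right, zero_smul]

theorem tensorMap_sum_left {ι : Type*} (s : Finset ι) (A : ι → (H →L[ℂ] H')) (B : K →L[ℂ] K') :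
    tensorMap (∑ i ∈ s, A i) B = ∑ i ∈ s, tensorMap (A i) B := by
  classical
  induction s using Finset.induction_on with
  | empty => simp only [Finset.sum_empty, tensorMap_zero_left]
  | insert a s ha ih => rw [Finset.sum_insert ha, Finset.sum_insert ha, tensorMap_add_left, ih]

theorem continuous_tensorMap_left (B : K →L[ℂ] K') :
    Continuous fun A : H →L[ℂ] H' => tensorMap A B := by
  refine (LipschitzWith.of_dist_le_mul (K := ‖B‖₊)
    (f := fun A : H →L[ℂ] H' => tensorMap A B) fun A A' => ?_).continuous
  rw [dist_eq_norm A A']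
  refine (dist_eq_norm (tensorMap A B) (tensorMap A' B)).trans_le ?_
  have h : tensorMap A B - tensorMap A' B = tensorMap (A - A') B := by
    rw [sub_eq_iff_eq_add, ← tensorMap_add_left, sub_add_cancel]
  rw [h, mul_comm]
  exact norm_tensorMap_le _ _

theorem continuous_tensorMap_right (A : H →L[ℂ] H') :
    Continuous fun B : K →L[ℂ] K' => tensorMap A B := by
  refine (LipschitzWith.of_dist_le_mul (K := ‖A‖₊)
    (f := fun B : K →L[ℂ] K' => tensorMap A B) fun B B' => ?_).continuous
  rw [dist_eq_norm B B']
  refine (dist_eq_norm (tensorMap A B) (tensorMap A B')).trans_le ?_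
  have h : tensorMap A B - tensorMap A B' = tensorMap A (B - B') := by
    rw [sub_eq_iff_eq_add, ← tensorMap_add_right, sub_add_cancel]
  rw [h]
  exact norm_tensorMap_le _ _

/-- Tensoring with a fixed vector on the left. -/
noncomputable def pureTensorLeft (K : Type*) [NormedAddCommGroup K] [InnerProductSpace ℂ K]
    (x : H) : K →L[ℂ] HilbertTensor H K :=
  LinearMap.mkContinuous
    { toFun := fun y => pureTensor x y
      map_add' := pureTensor_add_right x
      map_smul' := fun c y => pureTensor_smul_right c x y } ‖x‖
    fun y => (norm_pureTensor x y).le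

@[simp]
theorem pureTensorLeft_apply (x : H) (y : K) : pureTensorLeft K x y = pureTensor x y := rfl

theorem tensorMap_adjoint [CompleteSpace H] [CompleteSpace H'] [CompleteSpace K] [CompleteSpace K']
    (A : H →L[ℂ] H') (B : K →L[ℂ] K') :
    ContinuousLinearMap.adjoint (tensorMap A B)
      = tensorMap (ContinuousLinearMap.adjoint A) (ContinuousLinearMap.adjoint B) := by
  refine hilbertTensor_ext fun x y => ?_
  refine ext_inner_right ℂ fun z => ?_
  refine hilbertTensor_induction (p := fun z => inner ℂ _ z = inner ℂ _ z) z
    (isClosed_eq (by fun_prop) (by fun_prop)) (by simp) (fun a b ha hb => ?_) fun h k => ?_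
  · rw [inner_add_right, inner_add_right, ha, hb]
  · rw [ContinuousLinearMap.adjoint_inner_left, tensorMap_pureTensor, tensorMap_pureTensor,
      inner_pureTensor, inner_pureTensor, ContinuousLinearMap.adjoint_inner_left,
      ContinuousLinearMap.adjoint_inner_left]

/-- A strongly convergent net of contractions converges uniformly on the range of a
compact operator. -/
theorem tendsto_comp_of_isCompactOperator {ι : Type*} {l : Filter ι} {P : ι → (H' →L[ℂ] H')}
    (hP : ∀ i, ‖P i‖ ≤ 1) (hl : ∀ x, Tendsto (fun i => P i x) l (nhds x)) {A : H →L[ℂ] H'}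
    (hA : IsCompactOperator A) : Tendsto (fun i => P i ∘L A) l (nhds A) := by
  rw [Metric.tendsto_nhds]
  intro ε hε
  have htb : TotallyBounded (A '' Metric.closedBall 0 1) := by
    have := (IsCompactOperator.isCompact_closure_image_closedBall
      (f := ((A : H →L[ℂ] H') : H →ₗ[ℂ] H')) hA 1)
    exact this.totallyBounded.subset subset_closure
  obtain ⟨t, htf, hcov⟩ := Metric.totallyBounded_iff.1 htb (ε / 6) (by positivity)
  have hev : ∀ᶠ i in l, ∀ z ∈ t, dist (P i z) z < ε / 6 :=
    (htf.eventually_all).2 fun z _ => (Metric.tendsto_nhds.1 (hl z)) _ (by positivity)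
  filter_upwards [hev] with i hi
  rw [dist_eq_norm]
  refine lt_of_le_of_lt (b := ε / 2) ?_ (by linarith)
  refine ContinuousLinearMap.opNorm_le_of_unit_norm (by positivity) fun x hx => ?_
  have hx' := hcov ⟨x, by simp [hx], rfl⟩
  simp only [Set.mem_iUnion, Metric.mem_ball] at hx'
  obtain ⟨z, hz, hd⟩ := hx'
  have h1 : ‖P i (A x - z)‖ ≤ ‖A x - z‖ :=
    ((P i).le_opNorm _).trans (mul_le_of_le_one_left (norm_nonneg _) (hP i))
  have h2 := hi z hz
  rw [dist_eq_norm] at hd h2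
  have h3 : (P i ∘L A - A) x = P i (A x - z) + (P i z - z) - (A x - z) := by
    simp
  rw [h3]
  have := norm_sub_le (P i (A x - z) + (P i z - z)) (A x - z)
  have := norm_add_le (P i (A x - z)) (P i z - z)
  linarith

theorem isCompactOperator_rankOne (x : H') (y : H) :
    IsCompactOperator (InnerProductSpace.rankOne ℂ x y) := by
  have h1 : IsCompactOperator (innerSL ℂ y) := isCompactOperator_of_locallyCompactSpace_dom _
  exact h1.clm_comp (ContinuousLinearMap.toSpanSingleton ℂ x)

/-- Compact operators on Hilbert spaces are limits of finite sums of rank one operators. -/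
theorem isCompactOperator_induction [CompleteSpace H] {A : H →L[ℂ] H} (hA : IsCompactOperator A)
    {p : (H →L[ℂ] H) → Prop} (hcl : IsClosed {A | p A}) (hzero : p 0)
    (hadd : ∀ A B, p A → p B → p (A + B))
    (hrank : ∀ x y, p (InnerProductSpace.rankOne ℂ x y)) : p A := by
  classical
  obtain ⟨w, b, -⟩ := exists_hilbertBasis ℂ H
  let P : Finset w → (H →L[ℂ] H) := fun s => ∑ i ∈ s, InnerProductSpace.rankOne ℂ (b i) (b i)
  have hPx : ∀ s x, P s x = ∑ i ∈ s, inner ℂ (b i) x • b i := fun s x => by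
    simp [P]
  have hP : ∀ s, ‖P s‖ ≤ 1 := by
    intro s
    refine ContinuousLinearMap.opNorm_le_bound _ zero_le_one fun x => ?_
    rw [one_mul, hPx]
    have h1 : ‖∑ i ∈ s, inner ℂ (b i) x • b i‖ ^ 2 = ∑ i ∈ s, ‖inner ℂ (b i) x‖ ^ 2 := by
      have := b.orthonormal.inner_sum (fun i => inner ℂ (b i) x) (fun i => inner ℂ (b i) x) s
      rw [inner_self_eq_norm_sq_to_K] at this
      have h2 : ∀ i, conj (inner ℂ (b i) x) * inner ℂ (b i) x
          = ((‖inner ℂ (b i) x‖ ^ 2 : ℝ) : ℂ) := fun i => by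
        rw [← Complex.normSq_eq_conj_mul_self, Complex.normSq_eq_norm_sq]
      simp_rw [h2] at this
      apply Complex.ofReal_injective
      push_cast at this ⊢
      exact this
    refine (sq_le_sq₀ (norm_nonneg _) (norm_nonneg _)).1 ?_
    rw [h1]
    exact b.orthonormal.sum_inner_products_le x
  have hlim := tendsto_comp_of_isCompactOperator (l := atTop) hP (fun x => by
    simp_rw [hPx]
    have := b.hasSum_repr x
    simp only [b.repr_apply_apply] at this
    exact this) hA
  refine hcl.mem_of_tendsto hlim (Eventually.of_forall fun s => ?_)
  have h1 : P s ∘L A = ∑ i ∈ s, InnerProductSpace.rankOne ℂ (b i)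
      (ContinuousLinearMap.adjoint A (b i)) := by
    ext x
    simp [hPx, ContinuousLinearMap.adjoint_inner_left]
  change p (P s ∘L A)
  rw [h1]
  exact Finset.sum_induction _ p hadd hzero fun i _ => hrank _ _

theorem tensorMap_rankOne (x y : H) (x' y' : K) :
    tensorMap (InnerProductSpace.rankOne ℂ x y) (InnerProductSpace.rankOne ℂ x' y')
      = InnerProductSpace.rankOne ℂ (pureTensor x x') (pureTensor y y') :=
  hilbertTensor_ext fun h k => by
    simp [inner_pureTensor, pureTensor_smul_left, pureTensor_smul_right, smul_smul,
      mul_comm]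

/-- `A ⊗ B` depends continuously on each factor and compact operators form a closed set, so both
factors may be taken of rank one; then `A ⊗ B` has rank one as well. -/
theorem isCompactOperator_tensorMap [CompleteSpace H] [CompleteSpace K] {A : H →L[ℂ] H}
    {B : K →L[ℂ] K} (hA : IsCompactOperator A) (hB : IsCompactOperator B) :
    IsCompactOperator (tensorMap A B) := by
  have hcl : IsClosed {T : HilbertTensor H K →L[ℂ] HilbertTensor H K | IsCompactOperator T} :=
    isClosed_setOfPred_isCompactOperator
  refine isCompactOperator_induction hA (p := fun A => IsCompactOperator (tensorMap A B))
    (hcl.preimage (continuous_tensorMap_left B)) ?_ ?_ ?_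
  · rw [tensorMap_zero_left]; exact isCompactOperator_zero
  · intro A A' h h'
    rw [tensorMap_add_left]; exact h.add h'
  · intro x y
    refine isCompactOperator_induction hB
      (p := fun B => IsCompactOperator (tensorMap (InnerProductSpace.rankOne ℂ x y) B))
      (hcl.preimage (continuous_tensorMap_right _)) ?_ ?_ ?_
    · rw [tensorMap_zero_right]; exact isCompactOperator_zero
    · intro A A' h h'
      rw [tensorMap_add_right]; exact h.add h'
    · intro x' y'
      rw [tensorMap_rankOne]
      exact isCompactOperator_rankOne _ _

/-- The operators are contractions, so by an `ε/3` argument the vectors on which convergence holds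
form a closed set; pure tensors then suffice. -/
theorem tendsto_tensorMap_id {ι : Type*} {l : Filter ι} {P : ι → (H →L[ℂ] H)}
    (hP : ∀ i, ‖P i‖ ≤ 1) (hl : ∀ x, Tendsto (fun i => P i x) l (nhds x)) (z : HilbertTensor H K) :
    Tendsto (fun i => tensorMap (P i) (ContinuousLinearMap.id ℂ K) z) l (nhds z) := by
  have hn : ∀ i, ‖tensorMap (P i) (ContinuousLinearMap.id ℂ K)‖ ≤ 1 := fun i =>
    (norm_tensorMap_le _ _).trans
      (mul_le_one₀ (hP i) (norm_nonneg _) ContinuousLinearMap.norm_id_le)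
  refine hilbertTensor_induction (p := fun z =>
    Tendsto (fun i => tensorMap (P i) (ContinuousLinearMap.id ℂ K) z) l (nhds z)) z ?_ ?_ ?_ ?_
  · refine isClosed_of_closure_subset fun z hz => ?_
    rw [Set.mem_ofPred_eq, Metric.tendsto_nhds]
    intro ε hε
    obtain ⟨y, hy, hd⟩ := Metric.mem_closure_iff.1 hz (ε / 3) (by positivity)
    filter_upwards [Metric.tendsto_nhds.1 hy (ε / 3) (by positivity)] with i hi
    have h1 : ‖tensorMap (P i) (ContinuousLinearMap.id ℂ K) (z - y)‖ ≤ ‖z - y‖ :=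
      (ContinuousLinearMap.le_opNorm _ _).trans (mul_le_of_le_one_left (norm_nonneg _) (hn i))
    rw [map_sub] at h1
    rw [dist_eq_norm] at hd hi ⊢
    have h3 : tensorMap (P i) (ContinuousLinearMap.id ℂ K) z - z
        = (tensorMap (P i) (ContinuousLinearMap.id ℂ K) z
          - tensorMap (P i) (ContinuousLinearMap.id ℂ K) y)
          + (tensorMap (P i) (ContinuousLinearMap.id ℂ K) y - y) - (z - y) := by abel
    rw [h3]
    have := norm_sub_le ((tensorMap (P i) (ContinuousLinearMap.id ℂ K) z
          - tensorMap (P i) (ContinuousLinearMap.id ℂ K) y)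
          + (tensorMap (P i) (ContinuousLinearMap.id ℂ K) y - y)) (z - y)
    have := norm_add_le (tensorMap (P i) (ContinuousLinearMap.id ℂ K) z
          - tensorMap (P i) (ContinuousLinearMap.id ℂ K) y)
          (tensorMap (P i) (ContinuousLinearMap.id ℂ K) y - y)
    linarith
  · simp only [map_zero]
    exact tendsto_const_nhds
  · intro x y hx hy
    simpa using hx.add hy
  · intro h k
    simp only [tensorMap_pureTensor, ContinuousLinearMap.id_apply]
    have hc : Continuous fun x : H => pureTensor x k := by
      unfold pureTensor
      exact (UniformSpace.Completion.continuous_coe _).comp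
        (TensorProduct.continuous_tmul.comp (by fun_prop : Continuous fun x : H => (x, k)))
    exact (hc.tendsto h).comp (hl h)

/-- `T` is the weak integral of the family `S`. -/
def IsWeakIntegral {L : Type*} [NormedAddCommGroup L] [InnerProductSpace ℂ L] {Ω : Type*}
    [MeasurableSpace Ω] (m : Measure Ω) (S : Ω → (L →L[ℂ] L)) (T : L →L[ℂ] L) : Prop :=
  ∀ x y, Integrable (fun ω => inner ℂ x (S ω y)) m ∧ ∫ ω, inner ℂ x (S ω y) ∂m = inner ℂ x (T y)

theorem IsWeakIntegral.sum {L : Type*} [NormedAddCommGroup L] [InnerProductSpace ℂ L] {Ω : Type*}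
    [MeasurableSpace Ω] {m : Measure Ω} {ι : Type*} (s : Finset ι) {S : ι → Ω → (L →L[ℂ] L)}
    {T : ι → (L →L[ℂ] L)} (h : ∀ i, IsWeakIntegral m (S i) (T i)) :
    IsWeakIntegral m (fun ω => ∑ i ∈ s, S i ω) (∑ i ∈ s, T i) := by
  intro x y
  simp only [sum_apply, inner_sum]
  refine ⟨integrable_finsetSum _ fun i _ => (h i x y).1, ?_⟩
  rw [integral_finsetSum _ fun i _ => (h i x y).1]
  exact Finset.sum_congr rfl fun i _ => (h i x y).2

/-- On pure tensors the coefficients factor and the claim is the one for `S`. The uniform bound `M`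
dominates the integrands, so the identity survives limits in either vector. -/
theorem IsWeakIntegral.tensorMap {Ω : Type*} [MeasurableSpace Ω] {m : Measure Ω}
    [IsFiniteMeasure m] {S : Ω → (H →L[ℂ] H)} {T : H →L[ℂ] H} (h : IsWeakIntegral m S T) {M : ℝ}
    (hM : ∀ ω, ‖S ω‖ ≤ M) (B : K →L[ℂ] K) :
    IsWeakIntegral m (fun ω => tensorMap (S ω) B) (tensorMap T B) := by
  have hb : ∀ ω x y, ‖inner ℂ x (SchurAP.tensorMap (S ω) B y)‖ ≤ ‖x‖ * ((M * ‖B‖) * ‖y‖) := by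
    intro ω x y
    refine (norm_inner_le_norm _ _).trans ?_
    gcongr
    refine (ContinuousLinearMap.le_opNorm _ _).trans ?_
    gcongr
    exact (norm_tensorMap_le _ _).trans (by gcongr; exact hM ω)
  -- The map `p` records which of the two vectors varies, so that one closedness argument serves
  -- both density inductions.
  have hcl : ∀ p : HilbertTensor H K → HilbertTensor H K × HilbertTensor H K, Continuous p →
      IsClosed {z : HilbertTensor H K |
        Integrable (fun ω => inner ℂ (p z).1 (SchurAP.tensorMap (S ω) B (p z).2)) m ∧
        ∫ ω, inner ℂ (p z).1 (SchurAP.tensorMap (S ω) B (p z).2) ∂m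
          = inner ℂ (p z).1 (SchurAP.tensorMap T B (p z).2)} := by
    intro p hp
    refine isClosed_of_closure_subset fun z hz => ?_
    obtain ⟨u, hu, hlim⟩ := mem_closure_iff_seq_limit.1 hz
    have hpl : Tendsto (fun n => p (u n)) atTop (nhds (p z)) := (hp.tendsto z).comp hlim
    have hpt : ∀ ω, Tendsto (fun n => inner ℂ (p (u n)).1 (SchurAP.tensorMap (S ω) B (p (u n)).2))
        atTop (nhds (inner ℂ (p z).1 (SchurAP.tensorMap (S ω) B (p z).2))) := fun ω =>
      (hpl.fst_nhds).inner (((SchurAP.tensorMap (S ω) B).continuous.tendsto _).comp hpl.snd_nhds)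
    have hbd := (hpl.fst_nhds.norm.mul ((hpl.snd_nhds.norm).const_mul (M * ‖B‖)))
    have hmeas : AEStronglyMeasurable
        (fun ω => inner ℂ (p z).1 (SchurAP.tensorMap (S ω) B (p z).2)) m :=
      aestronglyMeasurable_of_tendsto_ae atTop (fun n => (hu n).1.aestronglyMeasurable)
        (Eventually.of_forall hpt)
    have hintg : Integrable (fun ω => inner ℂ (p z).1 (SchurAP.tensorMap (S ω) B (p z).2)) m :=
      Integrable.of_bound hmeas _ (Eventually.of_forall fun ω => hb ω _ _)
    refine ⟨hintg, ?_⟩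
    set N := ‖(p z).1‖ * (M * ‖B‖ * ‖(p z).2‖) with hN
    have h1 := tendsto_integral_filter_of_dominated_convergence (μ := m) (fun _ => N + 1)
      (Eventually.of_forall fun n => (hu n).1.aestronglyMeasurable)
      ((hbd.eventually_lt_const (lt_add_one N)).mono fun n hn =>
        Eventually.of_forall fun ω => (hb ω _ _).trans hn.le)
      (integrable_const _) (Eventually.of_forall hpt)
    have h2 : Tendsto (fun n => inner ℂ (p (u n)).1 (SchurAP.tensorMap T B (p (u n)).2)) atTop
        (nhds (inner ℂ (p z).1 (SchurAP.tensorMap T B (p z).2))) :=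
      (hpl.fst_nhds).inner (((SchurAP.tensorMap T B).continuous.tendsto _).comp hpl.snd_nhds)
    refine tendsto_nhds_unique h1 (h2.congr fun n => ?_)
    exact (hu n).2.symm
  intro x y
  refine hilbertTensor_induction x (hcl (fun z => (z, y)) (by fun_prop)) (by simp) ?_ ?_
  · intro a b ha hb
    simp only [inner_add_left]
    refine ⟨ha.1.add hb.1, ?_⟩
    rw [integral_add ha.1 hb.1, ha.2, hb.2]
  intro a b
  refine hilbertTensor_induction y (hcl (fun z => (pureTensor a b, z)) (by fun_prop)) (by simp) ?_ ?_
  · intro c d hc hd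
    simp only [map_add, inner_add_right]
    refine ⟨hc.1.add hd.1, ?_⟩
    rw [integral_add hc.1 hd.1, hc.2, hd.2]
  intro c d
  simp only [tensorMap_pureTensor, inner_pureTensor]
  refine ⟨(h a c).1.mul_const _, ?_⟩
  rw [integral_mul_const, (h a c).2]

end Tensor

/-! ### Square integrable kernels and their Hilbert–Schmidt operators. -/

section Kernels

variable {X : Type u} [MeasurableSpace X] {μ : Measure X}

theorem eLpNorm_two_sq {Y F : Type*} [MeasurableSpace Y] [NormedAddCommGroup F] (m : Measure Y)
    (f : Y → F) : eLpNorm f 2 m ^ 2 = ∫⁻ x, ‖f x‖ₑ ^ 2 ∂m := by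
  have := eLpNorm_nnreal_pow_eq_lintegral (μ := m) (f := f) (p := 2) (by norm_num)
  simpa using this

theorem enorm_sq_Lp (f : Lp ℂ 2 μ) : ‖f‖ₑ ^ 2 = ∫⁻ x, ‖f x‖ₑ ^ 2 ∂μ := by
  rw [Lp.enorm_def, eLpNorm_two_sq]

theorem inner_toLp_left {f : X → ℂ} (hf : MemLp f 2 μ) (ξ : Lp ℂ 2 μ) :
    inner ℂ (hf.toLp f) ξ = ∫ x, conj (f x) * ξ x ∂μ := by
  rw [L2.inner_def]
  refine integral_congr_ae ?_
  filter_upwards [hf.coeFn_toLp] with x hx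
  rw [hx, RCLike.inner_apply, mul_comm]

variable [SFinite μ]

/-- Almost every section of `k` is square integrable; with `v` its conjugate, the kernel integral
becomes an inner product, to which linearity, Cauchy–Schwarz and Bessel apply pointwise in `x`. -/
theorem ae_exists_section_vector {k : X × X → ℂ} (hk : MemLp k 2 (μ.prod μ)) :
    ∀ᵐ x ∂μ, ∃ v : Lp ℂ 2 μ, (∀ ξ : Lp ℂ 2 μ, ∫ y, k (x, y) * ξ y ∂μ = inner ℂ v ξ) ∧
      ‖v‖ₑ ^ 2 = ∫⁻ y, ‖k (x, y)‖ₑ ^ 2 ∂μ := by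
  have hintg : ∫⁻ x, ∫⁻ y, ‖k (x, y)‖ₑ ^ 2 ∂μ ∂μ ≠ ∞ := by
    rw [← lintegral_prod (fun z : X × X => ‖k z‖ₑ ^ 2) (hk.1.enorm.pow_const 2), ← eLpNorm_two_sq]
    exact ENNReal.pow_ne_top hk.2.ne
  have hm : AEMeasurable (fun x => ∫⁻ y, ‖k (x, y)‖ₑ ^ 2 ∂μ) μ :=
    (hk.1.enorm.pow_const 2).lintegral_prod_right'
  filter_upwards [hk.1.prodMk_left, ae_lt_top' hm hintg] with x h1 h2
  have hx : MemLp (fun y => conj (k (x, y))) 2 μ := by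
    refine ⟨RCLike.continuous_conj.comp_aestronglyMeasurable h1, ?_⟩
    by_contra h
    rw [not_lt, top_le_iff] at h
    have := eLpNorm_two_sq μ (fun y => conj (k (x, y)))
    rw [h] at this
    simp only [RCLike.enorm_conj] at this
    rw [← this] at h2
    simp at h2
  refine ⟨hx.toLp _, fun ξ => ?_, ?_⟩
  · rw [inner_toLp_left]
    simp
  · rw [Lp.enorm_toLp, eLpNorm_two_sq]
    simp

theorem lintegral_section_sq {k : X × X → ℂ} (hk : MemLp k 2 (μ.prod μ)) :
    ∫⁻ x, ∫⁻ y, ‖k (x, y)‖ₑ ^ 2 ∂μ ∂μ = eLpNorm k 2 (μ.prod μ) ^ 2 := by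
  rw [eLpNorm_two_sq, lintegral_prod (fun z : X × X => ‖k z‖ₑ ^ 2) (hk.1.enorm.pow_const 2)]

theorem eLpNorm_kernel_apply_le {k : X × X → ℂ} (hk : MemLp k 2 (μ.prod μ)) (ξ : Lp ℂ 2 μ) :
    eLpNorm (fun x => ∫ y, k (x, y) * ξ y ∂μ) 2 μ ≤ eLpNorm k 2 (μ.prod μ) * ‖ξ‖ₑ := by
  rw [← ENNReal.pow_le_pow_left_iff (n := 2) (by norm_num), eLpNorm_two_sq, mul_pow,
    ← lintegral_section_sq hk]
  have hm : AEMeasurable (fun x => ∫⁻ y, ‖k (x, y)‖ₑ ^ 2 ∂μ) μ :=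
    (hk.1.enorm.pow_const 2).lintegral_prod_right'
  rw [← lintegral_mul_const'' _ hm]
  refine lintegral_mono_ae ?_
  filter_upwards [ae_exists_section_vector hk] with x ⟨v, hv, hvn⟩
  rw [hv, ← hvn, ← mul_pow]
  gcongr
  rw [← ofReal_norm, ← ofReal_norm, ← ofReal_norm, ← ENNReal.ofReal_mul (norm_nonneg _)]
  exact ENNReal.ofReal_le_ofReal (norm_inner_le_norm _ _)

theorem memLp_kernel_apply {k : X × X → ℂ} (hk : MemLp k 2 (μ.prod μ)) (ξ : Lp ℂ 2 μ) :
    MemLp (fun x => ∫ y, k (x, y) * ξ y ∂μ) 2 μ := by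
  refine ⟨?_, (eLpNorm_kernel_apply_le hk ξ).trans_lt
    (ENNReal.mul_lt_top hk.2 enorm_lt_top)⟩
  exact (hk.1.mul ((Lp.aestronglyMeasurable ξ).comp_snd)).integral_prod_right'

/-- Square integrable kernels define bounded operators. -/
theorem exists_isKernelOf {k : X × X → ℂ} (hk : MemLp k 2 (μ.prod μ)) :
    ∃ A : Lp ℂ 2 μ →L[ℂ] Lp ℂ 2 μ, IsKernelOf μ k A ∧ ‖A‖ ≤ (eLpNorm k 2 (μ.prod μ)).toReal := by
  let A₀ : Lp ℂ 2 μ →ₗ[ℂ] Lp ℂ 2 μ :=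
    { toFun := fun ξ => (memLp_kernel_apply hk ξ).toLp _
      map_add' := fun ξ η => by
        rw [← MemLp.toLp_add, MemLp.toLp_eq_toLp_iff]
        filter_upwards [ae_exists_section_vector hk] with x ⟨v, hv, _⟩
        rw [Pi.add_apply, hv, hv, hv, inner_add_right]
      map_smul' := fun c ξ => by
        rw [RingHom.id_apply, ← MemLp.toLp_const_smul, MemLp.toLp_eq_toLp_iff]
        filter_upwards [ae_exists_section_vector hk] with x ⟨v, hv, _⟩
        rw [Pi.smul_apply, hv, hv, inner_smul_right, smul_eq_mul] }
  have hb : ∀ ξ, ‖A₀ ξ‖ ≤ (eLpNorm k 2 (μ.prod μ)).toReal * ‖ξ‖ := fun ξ => by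
    change ‖(memLp_kernel_apply hk ξ).toLp _‖ ≤ _
    rw [Lp.norm_toLp, ← toReal_enorm ξ, ← ENNReal.toReal_mul]
    exact ENNReal.toReal_mono (ENNReal.mul_ne_top hk.2.ne enorm_ne_top)
      (eLpNorm_kernel_apply_le hk ξ)
  refine ⟨A₀.mkContinuous _ hb, ⟨hk, fun ξ => ?_⟩,
    LinearMap.mkContinuous_norm_le _ ENNReal.toReal_nonneg _⟩
  exact (memLp_kernel_apply hk ξ).coeFn_toLp

/-- Bessel's inequality for the sections, integrated over `x`, gives `∑ ‖A (b i)‖² ≤ ‖k‖²`. -/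
theorem IsKernelOf.isCompactOperator {k : X × X → ℂ} {A : Lp ℂ 2 μ →L[ℂ] Lp ℂ 2 μ}
    (h : IsKernelOf μ k A) : IsCompactOperator A := by
  obtain ⟨w, b, -⟩ := exists_hilbertBasis ℂ (Lp ℂ 2 μ)
  refine isCompactOperator_of_tsum_ne_top b A (ne_top_of_le_ne_top
    (ENNReal.pow_ne_top (n := 2) h.1.2.ne) ?_)
  rw [ENNReal.tsum_eq_iSup_sum]
  refine iSup_le fun s => ?_
  rw [← lintegral_section_sq h.1]
  simp_rw [enorm_sq_Lp]
  rw [← lintegral_finsetSum' _ fun i _ => (Lp.aestronglyMeasurable _).enorm.pow_const 2]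
  refine lintegral_mono_ae ?_
  have hall : ∀ᵐ x ∂μ, ∀ i ∈ s, A (b i) x = ∫ y, k (x, y) * b i y ∂μ :=
    (Finset.eventually_all s).2 fun i _ => h.2 (b i)
  filter_upwards [ae_exists_section_vector h.1, hall] with x ⟨v, hv, hvn⟩ hx
  rw [← hvn]
  calc _ = ∑ i ∈ s, ‖inner ℂ (b i) v‖ₑ ^ 2 := by
        refine Finset.sum_congr rfl fun i hi => ?_
        rw [hx i hi, hv, ← inner_conj_symm, RCLike.enorm_conj]
    _ ≤ _ := sum_enorm_inner_sq_le b.orthonormal s v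

theorem memLp_tensor {f g : X → ℂ} (hf : MemLp f 2 μ) (hg : MemLp g 2 μ) :
    MemLp (fun z : X × X => f z.1 * g z.2) 2 (μ.prod μ) := by
  refine ⟨hf.1.comp_fst.mul hg.1.comp_snd, ?_⟩
  by_contra h
  rw [not_lt, top_le_iff] at h
  have := eLpNorm_two_sq (μ.prod μ) fun z : X × X => f z.1 * g z.2
  rw [h] at this
  simp only [enorm_mul, mul_pow] at this
  rw [lintegral_prod_mul (hf.1.enorm.pow_const 2) (hg.1.enorm.pow_const 2), ← eLpNorm_two_sq,
    ← eLpNorm_two_sq] at this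
  exact ENNReal.mul_ne_top (ENNReal.pow_ne_top hf.2.ne) (ENNReal.pow_ne_top hg.2.ne)
    (by rw [← this]; simp)

theorem integrable_kernel_inner {k : X × X → ℂ} (hk : MemLp k 2 (μ.prod μ)) (ξ η : Lp ℂ 2 μ) :
    Integrable (fun z : X × X => conj (ξ z.1) * k z * η z.2) (μ.prod μ) := by
  have h := hk.integrable_mul (memLp_tensor (Lp.memLp ξ).star (Lp.memLp η))
  refine h.congr (Eventually.of_forall fun z => ?_)
  simp [mul_comm, mul_left_comm]

theorem IsKernelOf.inner_eq {k : X × X → ℂ} {A : Lp ℂ 2 μ →L[ℂ] Lp ℂ 2 μ}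
    (h : IsKernelOf μ k A) (ξ η : Lp ℂ 2 μ) :
    inner ℂ ξ (A η) = ∫ z : X × X, conj (ξ z.1) * k z * η z.2 ∂(μ.prod μ) := by
  rw [integral_prod _ (integrable_kernel_inner h.1 ξ η), L2.inner_def]
  refine integral_congr_ae ?_
  filter_upwards [h.2 η] with x hx
  rw [hx, RCLike.inner_apply, mul_comm, ← integral_const_mul]
  simp only [mul_assoc]

end Kernels

/-! ### Elementary facts on Schur multipliers and their cb norm. -/

section Multipliers

variable {X : Type u} [MeasurableSpace X] {μ : Measure X}

theorem IsKernelOf.const_smul {k : X × X → ℂ} {A : Lp ℂ 2 μ →L[ℂ] Lp ℂ 2 μ}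
    (h : IsKernelOf μ k A) (c : ℂ) : IsKernelOf μ (fun z => c * k z) (c • A) := by
  refine ⟨h.1.const_mul c, fun ξ => ?_⟩
  rw [smul_apply]
  filter_upwards [Lp.coeFn_smul c (A ξ), h.2 ξ] with x h1 h2
  rw [h1, Pi.smul_apply, h2, smul_eq_mul, ← integral_const_mul]
  simp only [mul_assoc]

theorem isKernelOf_rankOne [SFinite μ] (ξ η : Lp ℂ 2 μ) :
    IsKernelOf μ (fun z => ξ z.1 * conj (η z.2)) (InnerProductSpace.rankOne ℂ ξ η) := by
  refine ⟨memLp_tensor (Lp.memLp ξ) (Lp.memLp η).star, fun ζ => ?_⟩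
  rw [InnerProductSpace.rankOne_apply]
  filter_upwards [Lp.coeFn_smul (inner ℂ η ζ) ξ] with x h1
  rw [h1, Pi.smul_apply, L2.inner_def, smul_eq_mul, ← integral_mul_const]
  refine integral_congr_ae (Eventually.of_forall fun y => ?_)
  simp only [RCLike.inner_apply]
  ring

theorem IsCBSchurBound.mono {p : ℝ≥0∞} {φ : X × X → ℂ} {C C' : ℝ≥0}
    (h : IsCBSchurBound p μ φ C) (hC : C ≤ C') : IsCBSchurBound p μ φ C' :=
  ⟨h.1, fun K _ _ _ n A A' B hA hA' hB => (h.2 K n A A' B hA hA' hB).trans (by gcongr)⟩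

theorem IsCBSchurBound.bound_fintype {p : ℝ≥0∞} {φ : X × X → ℂ} {C : ℝ≥0}
    (h : IsCBSchurBound p μ φ C) (K : Type u) [NormedAddCommGroup K] [InnerProductSpace ℂ K]
    [CompleteSpace K] {ι : Type*} [Fintype ι] (A A' : ι → (Lp ℂ 2 μ →L[ℂ] Lp ℂ 2 μ))
    (B : ι → (K →L[ℂ] K)) (hA : ∀ i, MemSchatten p (A i))
    (hA' : ∀ i, IsSchurImage μ φ (A i) (A' i)) (hB : ∀ i, MemSchatten p (B i)) :
    schattenNorm p (∑ i, tensorMap (A' i) (B i))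
      ≤ C * schattenNorm p (∑ i, tensorMap (A i) (B i)) := by
  let e := (Fintype.equivFin ι).symm
  have := h.2 K (Fintype.card ι) (A ∘ e) (A' ∘ e) (B ∘ e) (fun i => hA _) (fun i => hA' _)
    fun i => hB _
  simp only [Function.comp_apply, tensorOp_eq_tensorMap] at this
  rwa [e.sum_comp fun i => tensorMap (A' i) (B i), e.sum_comp fun i => tensorMap (A i) (B i)]
    at this

/-- The norm is an infimum of admissible bounds, so a norm bound `C` is used through the admissible
constants strictly above it; this avoids any question of attainment. -/
theorem cbSchurNorm_le_iff {p : ℝ≥0∞} {φ : X × X → ℂ} {C : ℝ≥0} :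
    cbSchurNorm p μ φ ≤ C ↔ ∀ C' : ℝ≥0, C < C' → IsCBSchurBound p μ φ C' := by
  constructor
  · intro h C' hC
    have h1 : cbSchurNorm p μ φ < C' := h.trans_lt (by exact_mod_cast hC)
    unfold cbSchurNorm at h1
    simp only [iInf_lt_iff] at h1
    obtain ⟨D, hD, hlt⟩ := h1
    exact hD.mono (by exact_mod_cast hlt.le)
  · intro h
    refine ENNReal.le_of_forall_pos_le_add fun ε hε _ => ?_
    have := h (C + ε) (lt_add_of_pos_right _ hε)
    unfold cbSchurNorm
    exact (iInf₂_le (C + ε) this).trans (by simp)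

end Multipliers

/-! ### Multipliers over a discrete space, and operator valued matrices. -/

section Discrete

variable {Λ : Type u} [MeasurableSpace Λ] [MeasurableSingletonClass Λ] [Countable Λ]
  {ν : Measure Λ} {c : ℝ}

theorem eq_of_ae_eq_of_singleton (hc : 0 < c) (hν : ∀ γ, ν {γ} = ENNReal.ofReal c) {Y : Type*}
    {f g : Λ → Y} (h : f =ᵐ[ν] g) : f = g := by
  funext γ
  by_contra hne
  have h1 : ν {γ} ≤ ν {x | ¬ f x = g x} := measure_mono (by simpa using hne)
  have h2 : ν {x | ¬ f x = g x} = 0 := h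
  rw [h2, hν] at h1
  simp only [nonpos_iff_eq_zero, ENNReal.ofReal_eq_zero] at h1
  linarith

open Classical in
/-- The normalized point masses form a Hilbert basis of `L²` of a discrete space. -/
theorem exists_pointBasis (hc : 0 < c) (hν : ∀ γ, ν {γ} = ENNReal.ofReal c) :
    ∃ b : HilbertBasis Λ ℂ (Lp ℂ 2 ν),
      (∀ γ (ξ : Lp ℂ 2 ν), inner ℂ (b γ) ξ = (√c : ℂ) * ξ γ) ∧
      ∀ γ x, b γ x = if x = γ then ((√c : ℂ))⁻¹ else 0 := by
  have hfin : ∀ γ, ν {γ} ≠ ∞ := fun γ => by rw [hν]; exact ENNReal.ofReal_ne_top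
  have hs : 0 < √c := Real.sqrt_pos.2 hc
  have hsc : (√c : ℂ) ≠ 0 := by exact_mod_cast hs.ne'
  have hsq : (√c : ℂ) * (√c : ℂ) = c := by
    rw [← Complex.ofReal_mul, Real.mul_self_sqrt hc.le]
  let v : Λ → Lp ℂ 2 ν := fun γ =>
    indicatorConstLp 2 (measurableSet_singleton γ) (hfin γ) ((√c : ℂ)⁻¹)
  have hv : ∀ γ x, v γ x = if x = γ then ((√c : ℂ))⁻¹ else 0 := by
    intro γ x
    have := congrFun (eq_of_ae_eq_of_singleton hc hν
      (indicatorConstLp_coeFn (p := 2) (μ := ν) (hs := measurableSet_singleton γ)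
        (hμs := hfin γ) (c := (√c : ℂ)⁻¹))) x
    change (indicatorConstLp 2 (measurableSet_singleton γ) (hfin γ) ((√c : ℂ)⁻¹)) x = _
    rw [this]
    simp [Set.indicator_apply]
  have hin : ∀ γ (ξ : Lp ℂ 2 ν), inner ℂ (v γ) ξ = (√c : ℂ) * ξ γ := by
    intro γ ξ
    have hreal : ν.real {γ} = c := by
      rw [measureReal_def, hν, ENNReal.toReal_ofReal hc.le]
    rw [L2.inner_indicatorConstLp_eq_inner_setIntegral ℂ (measurableSet_singleton γ),
      integral_singleton, hreal, RCLike.inner_apply]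
    simp only [Complex.real_smul, map_inv₀, Complex.conj_ofReal]
    rw [← hsq]
    field_simp
  have hon : Orthonormal ℂ v := by
    rw [orthonormal_iff_ite]
    intro i j
    rw [hin, hv]
    split_ifs <;> simp [hsc]
  have hbot : (Submodule.span ℂ (Set.range v))ᗮ = ⊥ := by
    rw [eq_bot_iff]
    intro ξ hξ
    rw [Submodule.mem_bot]
    refine Lp.ext (Eventually.of_forall fun γ => ?_)
    have h1 := (Submodule.mem_orthogonal _ _).1 hξ (v γ) (Submodule.subset_span ⟨γ, rfl⟩)
    rw [hin] at h1
    rw [congrFun (eq_of_ae_eq_of_singleton hc hν (Lp.coeFn_zero ℂ 2 ν)) γ]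
    exact (mul_eq_zero.1 h1).resolve_left hsc
  refine ⟨HilbertBasis.mkOfOrthogonalEqBot hon hbot, ?_, ?_⟩
  · intro γ ξ
    rw [HilbertBasis.coe_mkOfOrthogonalEqBot]
    exact hin γ ξ
  · intro γ x
    rw [HilbertBasis.coe_mkOfOrthogonalEqBot]
    exact hv γ x

/-- The matrix coefficients of a Schur multiplier over a discrete space. -/
theorem IsSchurImage.inner_eq (hc : 0 < c) (hν : ∀ γ, ν {γ} = ENNReal.ofReal c)
    {b : HilbertBasis Λ ℂ (Lp ℂ 2 ν)}
    (hb1 : ∀ γ (ξ : Lp ℂ 2 ν), inner ℂ (b γ) ξ = (√c : ℂ) * ξ γ)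
    {φ : Λ × Λ → ℂ} {A A' : Lp ℂ 2 ν →L[ℂ] Lp ℂ 2 ν} (h : IsSchurImage ν φ A A') (γ γ' : Λ) :
    inner ℂ (b γ) (A' (b γ')) = φ (γ, γ') * inner ℂ (b γ) (A (b γ')) := by
  classical
  -- The value of `b γ` at `x` is, up to `√c`, its coefficient along `b x`, so orthonormality
  -- confines `b γ` to the point `γ`.
  have hb2 : ∀ γ x, x ≠ γ → b γ x = 0 := by
    intro γ x hx
    have := orthonormal_iff_ite.1 b.orthonormal x γ
    rw [hb1, if_neg hx, mul_eq_zero] at this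
    refine this.resolve_left ?_
    exact_mod_cast (Real.sqrt_pos.2 hc).ne'
  obtain ⟨k, hk, hk'⟩ := h
  rw [hb1, hb1, congrFun (eq_of_ae_eq_of_singleton hc hν (hk.2 (b γ'))) γ,
    congrFun (eq_of_ae_eq_of_singleton hc hν (hk'.2 (b γ'))) γ, mul_left_comm]
  congr 1
  rw [← integral_const_mul]
  refine integral_congr_ae (Eventually.of_forall fun y => ?_)
  by_cases hy : y = γ'
  · subst hy; simp only; ring
  · simp only [hb2 γ' y hy, mul_zero]

/-- Matrix units are eigenvectors of a Schur multiplier: the kernel lives on the single point `(γ,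
γ')`. -/
theorem isSchurImage_rankOne [SFinite ν] (hc : 0 < c)
    {b : HilbertBasis Λ ℂ (Lp ℂ 2 ν)}
    (hb1 : ∀ γ (ξ : Lp ℂ 2 ν), inner ℂ (b γ) ξ = (√c : ℂ) * ξ γ) (φ : Λ × Λ → ℂ) (γ γ' : Λ) :
    IsSchurImage ν φ (InnerProductSpace.rankOne ℂ (b γ) (b γ'))
      (φ (γ, γ') • InnerProductSpace.rankOne ℂ (b γ) (b γ')) := by
  classical
  have hb2 : ∀ γ x, x ≠ γ → b γ x = 0 := by
    intro γ x hx
    have := orthonormal_iff_ite.1 b.orthonormal x γ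
    rw [hb1, if_neg hx, mul_eq_zero] at this
    refine this.resolve_left ?_
    exact_mod_cast (Real.sqrt_pos.2 hc).ne'
  refine ⟨_, isKernelOf_rankOne (b γ) (b γ'), ?_⟩
  convert (isKernelOf_rankOne (b γ) (b γ')).const_smul (φ (γ, γ')) using 1
  funext ⟨x, y⟩
  by_cases hx : x = γ
  · by_cases hy : y = γ'
    · subst hx hy; rfl
    · simp [hb2 γ' y hy]
  · simp [hb2 γ x hx]

set_option maxHeartbeats 800000 in
/-- Amplification of a Schur multiplier over a discrete space to operator valued matrices. -/
theorem IsCBSchurBound.amplification [SFinite ν] (hc : 0 < c)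
    (hν : ∀ γ, ν {γ} = ENNReal.ofReal c) {p : ℝ≥0∞} (hp : 1 ≤ p) {φ : Λ × Λ → ℂ} {C : ℝ≥0}
    (h : IsCBSchurBound p ν φ C) {H : Type u} [NormedAddCommGroup H] [InnerProductSpace ℂ H]
    [CompleteSpace H] (P : Λ → (H →L[ℂ] H)) (hsa : ∀ γ, ContinuousLinearMap.adjoint (P γ) = P γ)
    (hid : ∀ γ, P γ ∘L P γ = P γ) (E : Finset Λ) (hE : ∀ x, ∑ γ ∈ E, ‖P γ x‖ ^ 2 ≤ ‖x‖ ^ 2)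
    (hP : ∀ γ, ‖P γ‖ ≤ 1) {T : H →L[ℂ] H} (hT : MemSchatten p T) :
    schattenNorm p (∑ γ ∈ E, ∑ γ' ∈ E, φ (γ, γ') • (P γ ∘L T ∘L P γ'))
      ≤ C * schattenNorm p T := by
  classical
  obtain ⟨b, hb1, -⟩ := exists_pointBasis hc hν
  have hbb : ∀ i j, inner ℂ (b i) (b j) = if i = j then (1 : ℂ) else 0 :=
    orthonormal_iff_ite.1 b.orthonormal
  -- `V x = ∑ b γ ⊗ P γ x` is a contraction, and `V T V*` is the matrix with operator entries `P γ T
  -- P γ'`. The multiplier acts on it with coefficient space `K = H`, and compressing by `V`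
  -- restores an operator on `H`.
  let V : H →L[ℂ] HilbertTensor (Lp ℂ 2 ν) H := ∑ γ ∈ E, pureTensorLeft H (b γ) ∘L P γ
  have hVx : ∀ x, V x = ∑ γ ∈ E, pureTensor (b γ) (P γ x) := fun x => by simp [V]
  clear_value V
  have hV : ‖V‖ ≤ 1 := by
    refine ContinuousLinearMap.opNorm_le_bound _ zero_le_one fun x => ?_
    rw [one_mul]
    refine (sq_le_sq₀ (norm_nonneg _) (norm_nonneg _)).1 ?_
    refine le_trans (le_of_eq ?_) (hE x)
    apply Complex.ofReal_injective
    have h1 : ((‖V x‖ ^ 2 : ℝ) : ℂ) = inner ℂ (V x) (V x) := by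
      rw [inner_self_eq_norm_sq_to_K]; norm_cast
    rw [h1, hVx, sum_inner]
    push_cast
    refine Finset.sum_congr rfl fun γ hγ => ?_
    rw [inner_sum, Finset.sum_eq_single γ]
    · rw [inner_pureTensor, hbb, if_pos rfl, one_mul, inner_self_eq_norm_sq_to_K]
      norm_cast
    · intro γ' _ hne
      rw [inner_pureTensor, hbb, if_neg hne.symm, zero_mul]
    · exact fun h => absurd hγ h
  have hVadj : ∀ ξ y, ContinuousLinearMap.adjoint V (pureTensor ξ y)
      = ∑ γ ∈ E, inner ℂ (b γ) ξ • P γ y := by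
    intro ξ y
    refine ext_inner_left ℂ fun x => ?_
    rw [ContinuousLinearMap.adjoint_inner_right, hVx, sum_inner, inner_sum]
    refine Finset.sum_congr rfl fun γ _ => ?_
    rw [inner_pureTensor, inner_smul_right, ← ContinuousLinearMap.adjoint_inner_right, hsa]
  have hVn : ‖ContinuousLinearMap.adjoint V‖ ≤ 1 := by
    rw [LinearIsometryEquiv.norm_map]; exact hV
  have hB : ∀ i : E × E, MemSchatten p (P i.1 ∘L T ∘L P i.2) := fun i => by
    have := schattenNorm_conj_le hp T (hP i.2) (hP i.1)
    rw [hsa] at this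
    exact this.trans_lt hT
  have key := h.bound_fintype H (ι := E × E)
    (fun i => InnerProductSpace.rankOne ℂ (b i.1) (b i.2))
    (fun i => φ (i.1, i.2) • InnerProductSpace.rankOne ℂ (b i.1) (b i.2))
    (fun i => P i.1 ∘L T ∘L P i.2) (fun i => memSchatten_rankOne hp _ _)
    (fun i => isSchurImage_rankOne hc hb1 φ _ _) hB
  have e1 : ∑ i : E × E, tensorMap (InnerProductSpace.rankOne ℂ (b i.1) (b i.2))
      (P i.1 ∘L T ∘L P i.2) = V ∘L T ∘L ContinuousLinearMap.adjoint V := by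
    refine hilbertTensor_ext fun ξ y => ?_
    rw [ContinuousLinearMap.comp_apply, ContinuousLinearMap.comp_apply, hVadj, hVx, sum_apply,
      Fintype.sum_prod_type, ← Finset.sum_coe_sort E]
    refine Finset.sum_congr rfl fun γ _ => ?_
    rw [map_sum, map_sum, ← pureTensorLeft_apply (b (γ : Λ)), map_sum, ← Finset.sum_coe_sort E]
    refine Finset.sum_congr rfl fun γ' _ => ?_
    simp [pureTensor_smul_left]
  -- The compression adds a second `P γ` on either side, absorbed by idempotence.
  have e2 : ContinuousLinearMap.adjoint V ∘L (∑ i : E × E,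
      tensorMap (φ (i.1, i.2) • InnerProductSpace.rankOne ℂ (b i.1) (b i.2))
        (P i.1 ∘L T ∘L P i.2)) ∘L V = ∑ γ ∈ E, ∑ γ' ∈ E, φ (γ, γ') • (P γ ∘L T ∘L P γ') := by
    have hid' : ∀ γ y, P γ (P γ y) = P γ y := fun γ y =>
      congrArg (fun A : H →L[ℂ] H => A y) (hid γ)
    have hpt : ∀ γ ∈ E, ∀ y, ContinuousLinearMap.adjoint V (pureTensor (b γ) y) = P γ y := by
      intro γ hγ y
      rw [hVadj, Finset.sum_eq_single γ]
      · rw [hbb, if_pos rfl, one_smul]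
      · intro δ _ hne
        rw [hbb, if_neg hne, zero_smul]
      · exact fun h => absurd hγ h
    have hrk : ∀ γ, ∀ γ' ∈ E, ∀ (B : H →L[ℂ] H) x,
        tensorMap (φ (γ, γ') • InnerProductSpace.rankOne ℂ (b γ) (b γ')) B (V x)
          = φ (γ, γ') • pureTensor (b γ) (B (P γ' x)) := by
      intro γ γ' hγ' B x
      rw [hVx, map_sum, Finset.sum_eq_single γ']
      · rw [tensorMap_pureTensor, smul_apply, InnerProductSpace.rankOne_apply, hbb, if_pos rfl,
          one_smul, pureTensor_smul_left]
      · intro δ _ hne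
        rw [tensorMap_pureTensor, smul_apply, InnerProductSpace.rankOne_apply, hbb,
          if_neg hne.symm, zero_smul, smul_zero, ← zero_smul ℂ (0 : Lp ℂ 2 ν),
          pureTensor_smul_left, zero_smul]
      · exact fun h => absurd hγ' h
    have hterm : ∀ γ ∈ E, ∀ γ' ∈ E, ∀ x, ContinuousLinearMap.adjoint V
        (tensorMap (φ (γ, γ') • InnerProductSpace.rankOne ℂ (b γ) (b γ')) (P γ ∘L T ∘L P γ') (V x))
          = (φ (γ, γ') • (P γ ∘L T ∘L P γ')) x := by
      intro γ hγ γ' hγ' x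
      rw [hrk γ γ' hγ', map_smul, hpt γ hγ, smul_apply]
      simp only [ContinuousLinearMap.comp_apply, hid']
    ext x
    rw [ContinuousLinearMap.comp_apply, ContinuousLinearMap.comp_apply, sum_apply, map_sum,
      Fintype.sum_prod_type, sum_apply,
      ← Finset.sum_coe_sort E fun i => (∑ γ' ∈ E, φ (i, γ') • (P i ∘L T ∘L P γ')) x]
    refine Finset.sum_congr rfl fun γ _ => ?_
    rw [sum_apply, ← Finset.sum_coe_sort E fun γ' => (φ (γ, γ') • (P γ ∘L T ∘L P γ')) x]
    refine Finset.sum_congr rfl fun γ' _ => ?_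
    exact hterm γ γ.2 γ' γ'.2 x
  rw [← e2]
  refine (schattenNorm_conj_le hp _ hV hV).trans (key.trans ?_)
  gcongr
  rw [e1]
  have := schattenNorm_conj_le hp T hVn hVn
  rwa [ContinuousLinearMap.adjoint_adjoint] at this

end Discrete

/-! ### Multiplication by the indicators of the fibres of a map. -/

section Projections

variable {X : Type u} [MeasurableSpace X] {μ : Measure X}

/-- Multiplication by the indicator function of a measurable set on `L²`. -/
noncomputable def indicatorCLM (μ : Measure X) {s : Set X} (hs : MeasurableSet s) :
    Lp ℂ 2 μ →L[ℂ] Lp ℂ 2 μ :=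
  LinearMap.mkContinuous
    { toFun := fun f => ((Lp.memLp f).indicator hs).toLp _
      map_add' := fun f g => by
        rw [← MemLp.toLp_add, MemLp.toLp_eq_toLp_iff]
        filter_upwards [Lp.coeFn_add f g] with x hx
        by_cases h : x ∈ s
        · simp only [Set.indicator_of_mem h, hx, Pi.add_apply]
        · simp [h]
      map_smul' := fun c f => by
        rw [RingHom.id_apply, ← MemLp.toLp_const_smul, MemLp.toLp_eq_toLp_iff]
        filter_upwards [Lp.coeFn_smul c f] with x hx
        by_cases h : x ∈ s
        · simp only [Set.indicator_of_mem h, hx, Pi.smul_apply]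
        · simp [h] } 1 fun f => by
    rw [one_mul]
    change ‖((Lp.memLp f).indicator hs).toLp _‖ ≤ _
    rw [Lp.norm_toLp, Lp.norm_def]
    exact ENNReal.toReal_mono (Lp.memLp f).2.ne (eLpNorm_indicator_le _)

theorem indicatorCLM_coe {s : Set X} (hs : MeasurableSet s) (f : Lp ℂ 2 μ) :
    indicatorCLM μ hs f =ᵐ[μ] s.indicator f :=
  ((Lp.memLp f).indicator hs).coeFn_toLp

theorem norm_indicatorCLM_le {s : Set X} (hs : MeasurableSet s) : ‖indicatorCLM μ hs‖ ≤ 1 :=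
  LinearMap.mkContinuous_norm_le _ zero_le_one _

theorem adjoint_indicatorCLM {s : Set X} (hs : MeasurableSet s) :
    ContinuousLinearMap.adjoint (indicatorCLM μ hs) = indicatorCLM μ hs := by
  symm
  rw [ContinuousLinearMap.eq_adjoint_iff]
  intro f g
  rw [L2.inner_def, L2.inner_def]
  refine integral_congr_ae ?_
  filter_upwards [indicatorCLM_coe hs f, indicatorCLM_coe hs g] with x h1 h2
  rw [h1, h2]
  by_cases h : x ∈ s <;> simp [h]

theorem indicatorCLM_comp_self {s : Set X} (hs : MeasurableSet s) :
    indicatorCLM μ hs ∘L indicatorCLM μ hs = indicatorCLM μ hs := by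
  ext1 f
  refine Lp.ext ?_
  rw [ContinuousLinearMap.comp_apply]
  filter_upwards [indicatorCLM_coe hs (indicatorCLM μ hs f), indicatorCLM_coe hs f] with x h1 h2
  rw [h1, h2]
  by_cases h : x ∈ s <;> simp [h, h2]

theorem indicatorCLM_comp_of_disjoint {s t : Set X} (hs : MeasurableSet s) (ht : MeasurableSet t)
    (hst : Disjoint s t) : indicatorCLM μ hs ∘L indicatorCLM μ ht = 0 := by
  ext1 f
  refine Lp.ext ?_
  rw [ContinuousLinearMap.comp_apply]
  filter_upwards [indicatorCLM_coe hs (indicatorCLM μ ht f), indicatorCLM_coe ht f,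
    Lp.coeFn_zero ℂ 2 μ] with x h1 h2 h3
  rw [h1, zero_apply, h3]
  by_cases h : x ∈ s
  · have : x ∉ t := fun h' => hst.le_bot ⟨h, h'⟩
    simp [h, h2, this]
  · simp [h]

/-- For `Q = ∑ P γ`, Pythagoras gives `‖Q x‖² = ∑ ‖P γ x‖² = ⟨x, Q x⟩ ≤ ‖x‖ ‖Q x‖`. -/
theorem sum_norm_sq_le_of_orthogonal {H : Type*} [NormedAddCommGroup H] [InnerProductSpace ℂ H]
    [CompleteSpace H] {Λ : Type*} {P : Λ → (H →L[ℂ] H)}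
    (hsa : ∀ γ, ContinuousLinearMap.adjoint (P γ) = P γ) (hid : ∀ γ, P γ ∘L P γ = P γ)
    (ho : ∀ γ γ', γ ≠ γ' → P γ ∘L P γ' = 0) (E : Finset Λ) (x : H) :
    ∑ γ ∈ E, ‖P γ x‖ ^ 2 ≤ ‖x‖ ^ 2 ∧ ‖∑ γ ∈ E, P γ x‖ ≤ ‖x‖ := by
  have h1 : ∀ γ, inner ℂ x (P γ x) = ((‖P γ x‖ ^ 2 : ℝ) : ℂ) := by
    intro γ
    conv_lhs => rw [← hid γ, ContinuousLinearMap.comp_apply, ← ContinuousLinearMap.adjoint_inner_left,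
      hsa, inner_self_eq_norm_sq_to_K]
    norm_cast
  have h2 : ∀ γ γ', γ ≠ γ' → inner ℂ (P γ x) (P γ' x) = 0 := by
    intro γ γ' hne
    rw [← ContinuousLinearMap.adjoint_inner_right, hsa, ← ContinuousLinearMap.comp_apply,
      ho γ γ' hne, zero_apply, inner_zero_right]
  have h3 : ‖∑ γ ∈ E, P γ x‖ ^ 2 = ∑ γ ∈ E, ‖P γ x‖ ^ 2 := by
    classical
    apply Complex.ofReal_injective
    have : ((‖∑ γ ∈ E, P γ x‖ ^ 2 : ℝ) : ℂ) = inner ℂ (∑ γ ∈ E, P γ x) (∑ γ ∈ E, P γ x) := by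
      rw [inner_self_eq_norm_sq_to_K]; norm_cast
    rw [this, sum_inner]
    push_cast
    refine Finset.sum_congr rfl fun γ hγ => ?_
    rw [inner_sum, Finset.sum_eq_single γ (fun γ' _ hne => h2 γ γ' hne.symm)
      (fun h => absurd hγ h), inner_self_eq_norm_sq_to_K]
    norm_cast
  have h4 : ‖∑ γ ∈ E, P γ x‖ ^ 2 ≤ ‖x‖ * ‖∑ γ ∈ E, P γ x‖ := by
    have : ((‖∑ γ ∈ E, P γ x‖ ^ 2 : ℝ) : ℂ) = inner ℂ x (∑ γ ∈ E, P γ x) := by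
      rw [h3, inner_sum]
      push_cast
      refine Finset.sum_congr rfl fun γ _ => ?_
      rw [h1]; norm_cast
    calc ‖∑ γ ∈ E, P γ x‖ ^ 2 = ‖((‖∑ γ ∈ E, P γ x‖ ^ 2 : ℝ) : ℂ)‖ := by
          rw [Complex.norm_real, Real.norm_of_nonneg (sq_nonneg _)]
      _ ≤ _ := by rw [this]; exact norm_inner_le_norm _ _
  have h5 : ‖∑ γ ∈ E, P γ x‖ ≤ ‖x‖ := by
    by_contra hlt
    rw [not_le] at hlt
    nlinarith [norm_nonneg x]
  exact ⟨h3 ▸ pow_le_pow_left₀ (norm_nonneg _) h5 2, h5⟩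

variable {Λ : Type u} [MeasurableSpace Λ] [MeasurableSingletonClass Λ] [Countable Λ]

/-- The fibres of `q` partition `X`, so this is dominated convergence in `L²`. -/
theorem tendsto_sum_indicatorCLM {q : X → Λ} (hq : Measurable q) (f : Lp ℂ 2 μ) :
    Tendsto (fun E : Finset Λ =>
      (∑ γ ∈ E, indicatorCLM μ (hq (measurableSet_singleton γ))) f) atTop (nhds f) := by
  have hval : ∀ E : Finset Λ, (∑ γ ∈ E, indicatorCLM μ (hq (measurableSet_singleton γ))) f
      =ᵐ[μ] {x | q x ∈ E}.indicator f := by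
    classical
    intro E
    induction E using Finset.induction_on with
    | empty =>
      filter_upwards [Lp.coeFn_zero ℂ 2 μ] with x hx
      rw [Finset.sum_empty, zero_apply, hx]
      simp
    | insert a s ha ih =>
      rw [Finset.sum_insert ha, add_apply]
      filter_upwards [Lp.coeFn_add (indicatorCLM μ (hq (measurableSet_singleton a)) f)
        ((∑ γ ∈ s, indicatorCLM μ (hq (measurableSet_singleton γ))) f), ih,
        indicatorCLM_coe (hq (measurableSet_singleton a)) f] with x h1 h2 h3
      rw [h1, Pi.add_apply, h2, h3]
      by_cases h : q x = a
      · simp [h, ha]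
      · simp [Set.indicator_apply, h]
  rw [tendsto_iff_edist_tendsto_0]
  have hsq : Tendsto (fun E : Finset Λ => ∫⁻ x, ‖{x | q x ∈ E}.indicator f x - f x‖ₑ ^ 2 ∂μ) atTop
      (nhds (∫⁻ _, 0 ∂μ)) := by
    refine tendsto_lintegral_filter_of_dominated_convergence (fun x => ‖f x‖ₑ ^ 2) ?_ ?_ ?_ ?_
    · refine Eventually.of_forall fun E => ?_
      have hm : MeasurableSet {x | q x ∈ E} := hq E.measurableSet
      exact (((Lp.stronglyMeasurable f).indicator hm).sub (Lp.stronglyMeasurable f)).enorm.pow_const 2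
    · refine Eventually.of_forall fun E => Eventually.of_forall fun x => ?_
      by_cases h : q x ∈ E <;> simp [h]
    · rw [← enorm_sq_Lp]
      exact ENNReal.pow_ne_top enorm_ne_top
    · refine Eventually.of_forall fun x => ?_
      refine tendsto_const_nhds.congr' ?_
      filter_upwards [eventually_ge_atTop {q x}] with E hE
      have : q x ∈ E := hE (Finset.mem_singleton_self _)
      simp [this]
  rw [lintegral_zero] at hsq
  have h2 := ((ENNReal.continuous_rpow_const (y := 1 / 2)).tendsto 0).comp hsq
  rw [ENNReal.zero_rpow_of_pos (by norm_num)] at h2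
  refine h2.congr fun E => ?_
  rw [Function.comp_apply, edist_eq_enorm_sub]
  have : ∫⁻ x, ‖{x | q x ∈ E}.indicator f x - f x‖ₑ ^ 2 ∂μ
      = ‖(∑ γ ∈ E, indicatorCLM μ (hq (measurableSet_singleton γ))) f - f‖ₑ ^ 2 := by
    rw [enorm_sq_Lp]
    refine lintegral_congr_ae ?_
    filter_upwards [hval E, Lp.coeFn_sub
      ((∑ γ ∈ E, indicatorCLM μ (hq (measurableSet_singleton γ))) f) f] with x h1 h3
    rw [h3, Pi.sub_apply, h1]
  rw [this, ← ENNReal.rpow_natCast, ← ENNReal.rpow_mul]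
  norm_num

/-- The pulled back symbol is constant on the rectangle `q⁻¹(γ) × q⁻¹(γ')`, so the multiplier scales
that block of the operator. -/
theorem IsSchurImage.indicatorCLM_comp [SFinite μ] {q : X → Λ} (hq : Measurable q) {φ : Λ × Λ → ℂ}
    {A A' : Lp ℂ 2 μ →L[ℂ] Lp ℂ 2 μ} (h : IsSchurImage μ (fun z => φ (q z.1, q z.2)) A A')
    (γ γ' : Λ) :
    indicatorCLM μ (hq (measurableSet_singleton γ)) ∘L A' ∘L
        indicatorCLM μ (hq (measurableSet_singleton γ'))
      = φ (γ, γ') • (indicatorCLM μ (hq (measurableSet_singleton γ)) ∘L A ∘L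
        indicatorCLM μ (hq (measurableSet_singleton γ'))) := by
  obtain ⟨k, hA, hA'⟩ := h
  refine ContinuousLinearMap.ext fun η => ext_inner_left ℂ fun ξ => ?_
  simp only [smul_apply, ContinuousLinearMap.comp_apply, inner_smul_right]
  have hmove : ∀ ζ, inner ℂ ξ (indicatorCLM μ (hq (measurableSet_singleton γ)) ζ)
      = inner ℂ (indicatorCLM μ (hq (measurableSet_singleton γ)) ξ) ζ := fun ζ => by
    rw [← ContinuousLinearMap.adjoint_inner_left, adjoint_indicatorCLM]
  rw [hmove, hmove, hA'.inner_eq, hA.inner_eq, ← integral_const_mul]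
  refine integral_congr_ae ?_
  filter_upwards [Measure.quasiMeasurePreserving_fst.ae
      (indicatorCLM_coe (hq (measurableSet_singleton γ)) ξ),
    Measure.quasiMeasurePreserving_snd.ae
      (indicatorCLM_coe (hq (measurableSet_singleton γ')) η)] with z h1 h2
  rw [h1, h2]
  by_cases hz1 : q z.1 = γ
  · by_cases hz2 : q z.2 = γ'
    · rw [hz1, hz2]; ring
    · simp [hz2]
  · simp [hz1]

end Projections

/-! ### Pullbacks of discrete multipliers and their averages. -/

section Pullback

variable {X : Type u} [MeasurableSpace X] {μ : Measure X} [SFinite μ]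
  {Λ : Type u} [MeasurableSpace Λ] [MeasurableSingletonClass Λ] [Countable Λ]
  {ν : Measure Λ} [SFinite ν] {c : ℝ}

theorem IsSchurImage.isCompactOperator {φ : X × X → ℂ} {A A' : Lp ℂ 2 μ →L[ℂ] Lp ℂ 2 μ}
    (h : IsSchurImage μ φ A A') : IsCompactOperator A' :=
  let ⟨_, _, h'⟩ := h; h'.isCompactOperator

theorem isCompactOperator_sum {H : Type*} [NormedAddCommGroup H] [NormedSpace ℂ H] {ι : Type*}
    (s : Finset ι) {T : ι → (H →L[ℂ] H)} (hT : ∀ i, IsCompactOperator (T i)) :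
    IsCompactOperator (∑ i ∈ s, T i : H →L[ℂ] H) := by
  classical
  induction s using Finset.induction_on with
  | empty => rw [Finset.sum_empty]; exact isCompactOperator_zero
  | insert a s ha ih => rw [Finset.sum_insert ha]; exact (hT a).add ih

set_option maxHeartbeats 800000 in
/-- A Schur multiplier over a discrete space, pulled back along a measurable map. -/
theorem IsCBSchurBound.pullback (hc : 0 < c) (hν : ∀ γ, ν {γ} = ENNReal.ofReal c) {p : ℝ≥0∞}
    (hp : 1 ≤ p) {φ : Λ × Λ → ℂ} {C : ℝ≥0} (h : IsCBSchurBound p ν φ C) {q : X → Λ}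
    (hq : Measurable q) {K : Type u} [NormedAddCommGroup K] [InnerProductSpace ℂ K]
    [CompleteSpace K] {ι : Type*} [Fintype ι] {A A' : ι → (Lp ℂ 2 μ →L[ℂ] Lp ℂ 2 μ)}
    {B : ι → (K →L[ℂ] K)} (hA : ∀ i, IsSchurImage μ (fun z => φ (q z.1, q z.2)) (A i) (A' i))
    (hB : ∀ i, IsCompactOperator (B i)) (hT : MemSchatten p (∑ i, tensorMap (A i) (B i))) :
    schattenNorm p (∑ i, tensorMap (A' i) (B i)) ≤ C * schattenNorm p (∑ i, tensorMap (A i) (B i)) := by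
  let R : Λ → (Lp ℂ 2 μ →L[ℂ] Lp ℂ 2 μ) := fun γ => indicatorCLM μ (hq (measurableSet_singleton γ))
  let P : Λ → (HilbertTensor (Lp ℂ 2 μ) K →L[ℂ] HilbertTensor (Lp ℂ 2 μ) K) :=
    fun γ => tensorMap (R γ) (ContinuousLinearMap.id ℂ K)
  have hRsa : ∀ γ, ContinuousLinearMap.adjoint (R γ) = R γ := fun γ => adjoint_indicatorCLM _
  have hRid : ∀ γ, R γ ∘L R γ = R γ := fun γ => indicatorCLM_comp_self _
  have hRo : ∀ γ γ', γ ≠ γ' → R γ ∘L R γ' = 0 := fun γ γ' hne =>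
    indicatorCLM_comp_of_disjoint _ _ (Disjoint.preimage _ (by simpa using hne))
  have hRn : ∀ γ, ‖R γ‖ ≤ 1 := fun γ => norm_indicatorCLM_le _
  have hPsa : ∀ γ, ContinuousLinearMap.adjoint (P γ) = P γ := fun γ => by
    change ContinuousLinearMap.adjoint (tensorMap _ _) = tensorMap _ _
    rw [tensorMap_adjoint, hRsa]
    congr 1
    exact ContinuousLinearMap.adjoint_id
  have hPid : ∀ γ, P γ ∘L P γ = P γ := fun γ => by
    change tensorMap _ _ ∘L tensorMap _ _ = tensorMap _ _
    rw [← tensorMap_comp, hRid, ContinuousLinearMap.id_comp]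
  have hPo : ∀ γ γ', γ ≠ γ' → P γ ∘L P γ' = 0 := fun γ γ' hne => by
    change tensorMap _ _ ∘L tensorMap _ _ = 0
    rw [← tensorMap_comp, hRo γ γ' hne, tensorMap_zero_left]
  have hPn : ∀ γ, ‖P γ‖ ≤ 1 := fun γ => (norm_tensorMap_le _ _).trans
    (mul_le_one₀ (hRn γ) (norm_nonneg _) ContinuousLinearMap.norm_id_le)
  have hQn : ∀ E : Finset Λ, ‖∑ γ ∈ E, R γ‖ ≤ 1 := fun E =>
    ContinuousLinearMap.opNorm_le_bound _ zero_le_one fun x => by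
      rw [sum_apply, one_mul]
      exact (sum_norm_sq_le_of_orthogonal hRsa hRid hRo E x).2
  have hlim : ∀ z, Tendsto (fun E : Finset Λ => (∑ γ ∈ E, P γ) z) atTop (nhds z) := fun z => by
    have := tendsto_tensorMap_id (K := K) hQn (fun x => tendsto_sum_indicatorCLM hq x) z
    simpa only [tensorMap_sum_left] using this
  -- The tensored multiplier acts on the `(γ, γ')` block of `∑ A i ⊗ B i` as the scalar `φ (γ, γ')`:
  -- the situation of the amplification.
  have hcut : ∀ γ γ', P γ ∘L (∑ i, tensorMap (A' i) (B i)) ∘L P γ'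
      = φ (γ, γ') • (P γ ∘L (∑ i, tensorMap (A i) (B i)) ∘L P γ') := by
    intro γ γ'
    have h1 : ∀ D : ι → (Lp ℂ 2 μ →L[ℂ] Lp ℂ 2 μ), P γ ∘L (∑ i, tensorMap (D i) (B i)) ∘L P γ'
        = ∑ i, tensorMap (R γ ∘L D i ∘L R γ') (B i) := by
      intro D
      rw [ContinuousLinearMap.finsetSum_comp, ContinuousLinearMap.comp_finsetSum]
      refine Finset.sum_congr rfl fun i _ => ?_
      change tensorMap _ _ ∘L tensorMap _ _ ∘L tensorMap _ _ = _
      rw [← tensorMap_comp, ← tensorMap_comp, ContinuousLinearMap.id_comp,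
        ContinuousLinearMap.comp_id]
    rw [h1, h1, Finset.smul_sum]
    refine Finset.sum_congr rfl fun i _ => ?_
    rw [(hA i).indicatorCLM_comp hq γ γ', tensorMap_smul_left]
  have hcomp := isCompactOperator_sum Finset.univ fun i => isCompactOperator_tensorMap (hA i).isCompactOperator (hB i)
  have hPmove : ∀ (E : Finset Λ) x y, inner ℂ x ((∑ γ ∈ E, P γ) y) = inner ℂ ((∑ γ ∈ E, P γ) x) y := by
    intro E x y
    rw [sum_apply, sum_apply, inner_sum, sum_inner]
    refine Finset.sum_congr rfl fun γ _ => ?_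
    rw [← ContinuousLinearMap.adjoint_inner_left, hPsa]
  -- Only finitely many blocks are treated at a time; the truncations to `E` converge weakly and
  -- lower semicontinuity gives the bound for all blocks.
  refine schattenNorm_le_of_tendsto hp hcomp (l := atTop)
    (S := fun E : Finset Λ => (∑ γ ∈ E, P γ) ∘L (∑ i, tensorMap (A' i) (B i)) ∘L (∑ γ ∈ E, P γ))
    (fun x y => ?_) fun E => ?_
  · have h1 := (hlim x).inner (𝕜 := ℂ)
      (((∑ i, tensorMap (A' i) (B i)).continuous.tendsto y).comp (hlim y))
    refine h1.congr fun E => ?_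
    rw [ContinuousLinearMap.comp_apply, hPmove]
    rfl
  · have h2 := h.amplification hc hν hp P hPsa hPid E
      (fun x => (sum_norm_sq_le_of_orthogonal hPsa hPid hPo E x).1) hPn hT
    refine le_trans (le_of_eq ?_) h2
    congr 1
    rw [ContinuousLinearMap.finsetSum_comp]
    refine Finset.sum_congr rfl fun γ _ => ?_
    rw [ContinuousLinearMap.comp_finsetSum, ContinuousLinearMap.comp_finsetSum]
    exact Finset.sum_congr rfl fun γ' _ => hcut γ γ'

set_option maxHeartbeats 800000 in
/-- Values of a completely bounded Schur multiplier over a discrete space. -/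
theorem IsCBSchurBound.norm_le (hc : 0 < c) (hν : ∀ γ, ν {γ} = ENNReal.ofReal c) {p : ℝ≥0∞}
    (hp : 1 ≤ p) {φ : Λ × Λ → ℂ} {C : ℝ≥0} (h : IsCBSchurBound p ν φ C) (z : Λ × Λ) :
    ‖φ z‖ ≤ C := by
  obtain ⟨b, hb1, -⟩ := exists_pointBasis hc hν
  have hfact : Fact (1 ≤ p) := ⟨hp⟩
  -- Test on a matrix unit, tensored with a rank one projection: the multiplier scales it by `φ z`.
  -- The choice of `K` only supplies a unit vector.
  have key := h.bound_fintype (Lp ℂ 2 ν) (ι := Unit)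
    (fun _ => InnerProductSpace.rankOne ℂ (b z.1) (b z.2))
    (fun _ => φ (z.1, z.2) • InnerProductSpace.rankOne ℂ (b z.1) (b z.2))
    (fun _ => InnerProductSpace.rankOne ℂ (b z.1) (b z.1)) (fun _ => memSchatten_rankOne hp _ _)
    (fun _ => isSchurImage_rankOne hc hb1 φ _ _) (fun _ => memSchatten_rankOne hp _ _)
  rw [Fintype.sum_unique, Fintype.sum_unique, tensorMap_smul_left, tensorMap_rankOne] at key
  have hn : ∀ γ, ‖b γ‖ = 1 := b.orthonormal.1
  have hu : ∀ γ γ', ‖pureTensor (b γ) (b γ')‖ = 1 := fun γ γ' => by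
    rw [norm_pureTensor, hn, hn, one_mul]
  have hnn : ∀ γ γ', ‖pureTensor (b γ) (b γ')‖₊ = 1 := fun γ γ' => NNReal.eq (hu γ γ')
  have h1 := key.trans (mul_le_mul_right (schattenNorm_rankOne_le hp _ _) _)
  rw [hnn, hnn, one_mul, ENNReal.coe_one, mul_one, schattenNorm_le_iff hp] at h1
  have h2 := h1.2 1 (fun _ => pureTensor (b z.2) (b z.1)) (fun _ => pureTensor (b z.1) (b z.1))
    ⟨fun _ => hu _ _, fun i j hij => absurd (Subsingleton.elim i j) hij⟩
    ⟨fun _ => hu _ _, fun i j hij => absurd (Subsingleton.elim i j) hij⟩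
  refine le_trans ?_ h2
  refine le_trans (le_of_eq ?_) (PiLp.norm_apply_le _ (0 : Fin 1))
  rw [PiLp.toLp_apply, smul_apply, InnerProductSpace.rankOne_apply, inner_smul_right,
    inner_smul_right, inner_self_eq_norm_sq_to_K, inner_self_eq_norm_sq_to_K, hu, hu]
  simp

set_option maxHeartbeats 800000 in
/-- Averages of pullbacks of a Schur multiplier over a discrete space. -/
theorem IsCBSchurBound.average (hc : 0 < c) (hν : ∀ γ, ν {γ} = ENNReal.ofReal c) {p : ℝ≥0∞}
    (hp : 1 ≤ p) {φ : Λ × Λ → ℂ} {C : ℝ≥0} (hC : 0 < C) (h : IsCBSchurBound p ν φ C)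
    {Ω : Type*} [MeasurableSpace Ω] {m : Measure Ω} [IsProbabilityMeasure m] {q : Ω → X → Λ}
    (hq : Measurable (Function.uncurry q)) :
    IsCBSchurBound p μ (fun z => ∫ ω, φ (q ω z.1, q ω z.2) ∂m) C := by
  have hb := h.norm_le hc hν hp
  have hq1 : ∀ ω, Measurable (q ω) := fun ω => hq.comp measurable_prodMk_left
  have hmeas : Measurable fun w : (X × X) × Ω => φ (q w.2 w.1.1, q w.2 w.1.2) := by
    refine (measurable_from_top (f := φ)).comp ?_
    -- `Λ × Λ` is countable with measurable points, so every function on it is measurable, in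
    -- particular `φ`.
    have : MeasurableSpace.prod ‹MeasurableSpace Λ› ‹MeasurableSpace Λ› = ⊤ := by
      rw [eq_top_iff]
      exact fun s _ => s.to_countable.measurableSet
    rw [← this]
    exact (hq.comp (measurable_snd.prodMk (measurable_fst.comp measurable_fst))).prodMk
      (hq.comp (measurable_snd.prodMk (measurable_snd.comp measurable_fst)))
  refine ⟨?_, fun K _ _ _ n A A' B hA hA' hB => ?_⟩
  · refine memLp_top_of_bound (hmeas.stronglyMeasurable.integral_prod_right').aestronglyMeasurable C
      (Eventually.of_forall fun z => ?_)
    refine (norm_integral_le_of_norm_le_const (C := C) (Eventually.of_forall fun ω => hb _)).trans ?_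
    simp
  simp only [tensorOp_eq_tensorMap]
  by_cases htop : schattenNorm p (∑ i, tensorMap (A i) (B i)) = ∞
  · rw [htop, ENNReal.mul_top (by exact_mod_cast hC.ne')]
    exact le_top
  choose k hk hk' using hA'
  have hsec : ∀ ω, Measurable fun z : X × X => φ (q ω z.1, q ω z.2) := fun ω =>
    hmeas.comp measurable_prodMk_right
  have hmem : ∀ i ω, MemLp (fun z => φ (q ω z.1, q ω z.2) * k i z) 2 (μ.prod μ) := fun i ω =>
    (hk i).1.of_le_mul (c := C) ((hsec ω).aestronglyMeasurable.mul (hk i).1.1)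
      (Eventually.of_forall fun z => by
        rw [norm_mul]
        gcongr
        exact hb _)
  -- `D i ω` is the image of `A i` under the pullback along `q ω`. By Fubini its weak integral over
  -- `ω` is the image `A' i` under the averaged symbol.
  choose D hD hDn using fun i ω => exists_isKernelOf (hmem i ω)
  have hDb : ∀ i, ∃ M : ℝ, ∀ ω, ‖D i ω‖ ≤ M := fun i =>
    ⟨(C * eLpNorm (k i) 2 (μ.prod μ)).toReal, fun ω => (hDn i ω).trans
      (ENNReal.toReal_mono (ENNReal.mul_ne_top ENNReal.coe_ne_top (hk i).1.2.ne) (by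
        have := eLpNorm_le_nnreal_smul_eLpNorm_of_ae_le_mul (c := C) (p := 2) (μ := μ.prod μ)
          (f := fun z => φ (q ω z.1, q ω z.2) * k i z) (g := k i)
          (Eventually.of_forall fun z => by
            rw [nnnorm_mul]
            gcongr
            exact hb _)
        simpa [ENNReal.smul_def] using this))⟩
  have hW : ∀ i, IsWeakIntegral m (D i) (A' i) := by
    intro i ξ η
    have hintg : Integrable (fun w : (X × X) × Ω =>
        φ (q w.2 w.1.1, q w.2 w.1.2) * (conj (ξ w.1.1) * k i w.1 * η w.1.2))
        ((μ.prod μ).prod m) := by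
      refine Integrable.bdd_mul (c := C) ((integrable_kernel_inner (hk i).1 ξ η).comp_fst m)
        hmeas.aestronglyMeasurable (Eventually.of_forall fun w => hb _)
    have e1 : ∀ ω, inner ℂ ξ (D i ω η) = ∫ z : X × X, φ (q ω z.1, q ω z.2) *
        (conj (ξ z.1) * k i z * η z.2) ∂(μ.prod μ) := by
      intro ω
      rw [(hD i ω).inner_eq]
      refine integral_congr_ae (Eventually.of_forall fun z => ?_)
      simp only
      ring
    simp only [e1]
    refine ⟨hintg.integral_prod_right, ?_⟩
    rw [← integral_integral_swap hintg, (hk' i).inner_eq]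
    refine integral_congr_ae (Eventually.of_forall fun z => ?_)
    simp only
    rw [integral_mul_const]
    ring
  have hWT := IsWeakIntegral.sum Finset.univ fun i =>
    (hW i).tensorMap (hDb i).choose_spec (B i)
  refine schattenNorm_le_of_integral hp
    (isCompactOperator_sum _ fun i => isCompactOperator_tensorMap (hk' i).isCompactOperator
      (isCompactOperator_of_memSchatten hp (hB i))) hWT fun ω => ?_
  exact h.pullback hc hν hp (hq1 ω) (fun i => ⟨k i, hk i, hD i ω⟩)
    (fun i => isCompactOperator_of_memSchatten hp (hB i)) (lt_top_iff_ne_top.2 htop)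

end Pullback

/-! ### Linearity of the multiplier relation. -/

section SchurImage

variable {X : Type u} [MeasurableSpace X] {μ : Measure X} [SFinite μ]

theorem IsKernelOf.add {k k' : X × X → ℂ} {A A' : Lp ℂ 2 μ →L[ℂ] Lp ℂ 2 μ}
    (h : IsKernelOf μ k A) (h' : IsKernelOf μ k' A') :
    IsKernelOf μ (fun z => k z + k' z) (A + A') := by
  obtain ⟨D, hD, -⟩ := exists_isKernelOf (h.1.add h'.1)
  have : D = A + A' := by
    refine ContinuousLinearMap.ext fun η => ext_inner_left ℂ fun ξ => ?_
    rw [add_apply, inner_add_right, hD.inner_eq, h.inner_eq, h'.inner_eq,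
      ← integral_add (integrable_kernel_inner h.1 ξ η) (integrable_kernel_inner h'.1 ξ η)]
    refine integral_congr_ae (Eventually.of_forall fun z => ?_)
    simp only [Pi.add_apply]
    ring
  rw [← this]
  exact hD

theorem IsSchurImage.add {φ : X × X → ℂ} {A A' D D' : Lp ℂ 2 μ →L[ℂ] Lp ℂ 2 μ}
    (h : IsSchurImage μ φ A D) (h' : IsSchurImage μ φ A' D') :
    IsSchurImage μ φ (A + A') (D + D') := by
  obtain ⟨k, hk, hD⟩ := h
  obtain ⟨k', hk', hD'⟩ := h'
  refine ⟨_, hk.add hk', ?_⟩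
  convert hD.add hD' using 2
  ring

theorem IsSchurImage.const_smul {φ : X × X → ℂ} {A D : Lp ℂ 2 μ →L[ℂ] Lp ℂ 2 μ}
    (h : IsSchurImage μ φ A D) (c : ℂ) : IsSchurImage μ φ (c • A) (c • D) := by
  obtain ⟨k, hk, hD⟩ := h
  refine ⟨_, hk.const_smul c, ?_⟩
  convert hD.const_smul c using 2
  ring

theorem isSchurImage_zero (φ : X × X → ℂ) : IsSchurImage μ φ 0 0 := by
  have : IsKernelOf μ (fun _ => 0) 0 := by
    refine ⟨MemLp.zero, fun ξ => ?_⟩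
    filter_upwards [Lp.coeFn_zero ℂ 2 μ] with x hx
    rw [zero_apply, hx]
    simp
  exact ⟨fun _ => 0, this, by simpa using this⟩

theorem IsSchurImage.sum {φ : X × X → ℂ} {ι : Type*} (s : Finset ι)
    {A D : ι → (Lp ℂ 2 μ →L[ℂ] Lp ℂ 2 μ)} (h : ∀ i ∈ s, IsSchurImage μ φ (A i) (D i)) :
    IsSchurImage μ φ (∑ i ∈ s, A i) (∑ i ∈ s, D i) := by
  classical
  induction s using Finset.induction_on with
  | empty => exact isSchurImage_zero φ
  | insert a s ha ih =>
    rw [Finset.sum_insert ha, Finset.sum_insert ha]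
    exact (h a (Finset.mem_insert_self _ _)).add
      (ih fun i hi => h i (Finset.mem_insert_of_mem hi))

end SchurImage

/-! ### Moving finite matrices between orthonormal families. -/

section Compression

variable {H L : Type*} [NormedAddCommGroup H] [InnerProductSpace ℂ H] [CompleteSpace H]
  [NormedAddCommGroup L] [InnerProductSpace ℂ L] [CompleteSpace L] {Λ : Type*}

/-- The partial isometry mapping `b γ` to `s γ` for `γ ∈ E`. -/
noncomputable def partialIsometry (s : Λ → H) (b : Λ → L) (E : Finset Λ) : L →L[ℂ] H :=
  ∑ γ ∈ E, InnerProductSpace.rankOne ℂ (s γ) (b γ)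

theorem partialIsometry_apply (s : Λ → H) (b : Λ → L) (E : Finset Λ) (x : L) :
    partialIsometry s b E x = ∑ γ ∈ E, inner ℂ (b γ) x • s γ := by
  simp [partialIsometry]

theorem adjoint_partialIsometry (s : Λ → H) (b : Λ → L) (E : Finset Λ) :
    ContinuousLinearMap.adjoint (partialIsometry s b E) = partialIsometry b s E := by
  symm
  rw [ContinuousLinearMap.eq_adjoint_iff]
  intro x y
  rw [partialIsometry_apply, partialIsometry_apply, sum_inner, inner_sum]
  refine Finset.sum_congr rfl fun γ _ => ?_
  rw [inner_smul_left, inner_smul_right, inner_conj_symm, mul_comm]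

theorem norm_partialIsometry_le {s : Λ → H} {b : Λ → L} (hs : Orthonormal ℂ s)
    (hb : Orthonormal ℂ b) (E : Finset Λ) : ‖partialIsometry s b E‖ ≤ 1 := by
  refine ContinuousLinearMap.opNorm_le_bound _ zero_le_one fun x => ?_
  rw [one_mul, ← sq_le_sq₀ (norm_nonneg _) (norm_nonneg _), partialIsometry_apply]
  refine le_trans (le_of_eq ?_) (hb.sum_inner_products_le (s := E) x)
  apply Complex.ofReal_injective
  have : ∀ y : H, ((‖y‖ ^ 2 : ℝ) : ℂ) = inner ℂ y y := fun y => by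
    rw [inner_self_eq_norm_sq_to_K]; norm_cast
  rw [this, hs.inner_sum]
  push_cast
  exact Finset.sum_congr rfl fun γ _ => RCLike.conj_mul _

theorem partialIsometry_conj (s : Λ → H) (b : Λ → L) (E : Finset Λ) (A : L →L[ℂ] L) :
    partialIsometry s b E ∘L A ∘L partialIsometry b s E
      = ∑ γ ∈ E, ∑ γ' ∈ E, inner ℂ (b γ) (A (b γ')) • InnerProductSpace.rankOne ℂ (s γ) (s γ') := by
  ext x
  simp only [ContinuousLinearMap.comp_apply, partialIsometry_apply, sum_apply, smul_apply,
    InnerProductSpace.rankOne_apply, map_sum, map_smul, smul_smul, Finset.smul_sum]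
  rw [Finset.sum_comm]
  exact Finset.sum_congr rfl fun γ _ => Finset.sum_congr rfl fun γ' _ => by rw [mul_comm]

end Compression

/-! ### Compressing a multiplier to step functions. -/

section Sampling

variable {X : Type u} [MeasurableSpace X] {μ : Measure X} [SFinite μ]
  {Λ : Type u} [MeasurableSpace Λ] [MeasurableSingletonClass Λ] [Countable Λ]
  {ν : Measure Λ} [SFinite ν] {c : ℝ}

theorem exists_isSchurImage_rankOne {φ : X × X → ℂ} (hφ : MemLp φ ∞ (μ.prod μ)) (ξ η : Lp ℂ 2 μ) :
    ∃ D, IsSchurImage μ φ (InnerProductSpace.rankOne ℂ ξ η) D ∧ ∀ ξ' η', inner ℂ ξ' (D η')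
      = ∫ z : X × X, conj (ξ' z.1) * (φ z * (ξ z.1 * conj (η z.2))) * η' z.2 ∂(μ.prod μ) := by
  have h := isKernelOf_rankOne ξ η
  obtain ⟨D, hD, -⟩ := exists_isKernelOf (h.1.mul' hφ : MemLp (fun z => φ z * _) 2 (μ.prod μ))
  exact ⟨D, ⟨_, h, hD⟩, hD.inner_eq⟩

set_option maxHeartbeats 1600000 in
/-- Sampling a Schur multiplier on disjoint sets of equal measure. -/
theorem IsCBSchurBound.sample (hc : 0 < c) (hν : ∀ γ, ν {γ} = ENNReal.ofReal c) {p : ℝ≥0∞}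
    (hp : 1 ≤ p) {φ : X × X → ℂ} {C : ℝ≥0} (h : IsCBSchurBound p μ φ C) {S : Λ → Set X}
    (hS : ∀ γ, MeasurableSet (S γ)) (hd : Pairwise fun γ γ' => Disjoint (S γ) (S γ')) {a : ℝ}
    (ha : 0 < a) (hμ : ∀ γ, μ (S γ) = ENNReal.ofReal a) {ψ : Λ × Λ → ℂ}
    (hψ : ∀ γ γ', ψ (γ, γ') = ((a : ℂ) ^ 2)⁻¹ * ∫ z in S γ ×ˢ S γ', φ z ∂(μ.prod μ))
    (hψb : MemLp ψ ∞ (ν.prod ν)) :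
    IsCBSchurBound p ν ψ C := by
  classical
  obtain ⟨b, hb1, -⟩ := exists_pointBasis hc hν
  have hfin : ∀ γ, μ (S γ) ≠ ∞ := fun γ => by rw [hμ]; exact ENNReal.ofReal_ne_top
  have hsq : (√a : ℂ) * (√a : ℂ) = a := by
    rw [← Complex.ofReal_mul, Real.mul_self_sqrt ha.le]
  have hsa : (√a : ℂ) ≠ 0 := by exact_mod_cast (Real.sqrt_pos.2 ha).ne'
  -- The factor `a^{-1/2}` makes the indicators orthonormal.
  let s : Λ → Lp ℂ 2 μ := fun γ => indicatorConstLp 2 (hS γ) (hfin γ) ((√a : ℂ)⁻¹)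
  have hsv : ∀ γ, s γ =ᵐ[μ] (S γ).indicator fun _ => (√a : ℂ)⁻¹ := fun γ =>
    indicatorConstLp_coeFn
  have hdis : ∀ γ γ' x, γ ≠ γ' → x ∈ S γ → x ∉ S γ' := fun γ γ' x hne h1 h2 =>
    (hd hne).le_bot ⟨h1, h2⟩
  have hon : Orthonormal ℂ s := by
    rw [orthonormal_iff_ite]
    intro γ γ'
    rw [L2.inner_indicatorConstLp_indicatorConstLp (hS γ) (hS γ') (hfin γ) (hfin γ')]
    by_cases hne : γ = γ'
    · subst hne
      rw [if_pos rfl, Set.inter_self, measureReal_def, hμ, ENNReal.toReal_ofReal ha.le]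
      simp only [RCLike.inner_apply, map_inv₀, Complex.conj_ofReal, Complex.real_smul]
      rw [← hsq]
      field_simp
    · rw [if_neg hne, (hd hne).inter_eq]
      simp
  choose D hD hDin using fun γ γ' => exists_isSchurImage_rankOne h.1 (s γ) (s γ')
  -- Among the coefficients of `M_φ |s γ⟩⟨s γ'|` in the family `s`, only the one at `(γ, γ')`
  -- survives, and it is the mean of `φ` over `S γ × S γ'`: on the span of `s` the compressed
  -- multiplier has symbol `ψ`.
  have hDs : ∀ γ γ' δ δ', inner ℂ (s δ) (D γ γ' (s δ'))
      = if δ = γ ∧ δ' = γ' then ψ (γ, γ') else 0 := by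
    intro γ γ' δ δ'
    have hall : ∀ᵐ z ∂(μ.prod μ), s γ z.1 = (S γ).indicator (fun _ => (√a : ℂ)⁻¹) z.1 ∧
        s δ z.1 = (S δ).indicator (fun _ => (√a : ℂ)⁻¹) z.1 ∧
        s γ' z.2 = (S γ').indicator (fun _ => (√a : ℂ)⁻¹) z.2 ∧
        s δ' z.2 = (S δ').indicator (fun _ => (√a : ℂ)⁻¹) z.2 := by
      filter_upwards [Measure.quasiMeasurePreserving_fst.ae (hsv γ),
        Measure.quasiMeasurePreserving_fst.ae (hsv δ),
        Measure.quasiMeasurePreserving_snd.ae (hsv γ'),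
        Measure.quasiMeasurePreserving_snd.ae (hsv δ')] with z h1 h2 h3 h4
      exact ⟨h1, h2, h3, h4⟩
    rw [hDin]
    split_ifs with hcase
    · obtain ⟨rfl, rfl⟩ := hcase
      rw [hψ, ← integral_const_mul, ← integral_indicator ((hS δ).prod (hS δ'))]
      refine integral_congr_ae ?_
      filter_upwards [hall] with z hz
      rw [hz.1, hz.2.2.1]
      by_cases h1 : z.1 ∈ S δ
      · by_cases h2 : z.2 ∈ S δ'
        · simp only [Set.indicator_of_mem h1, Set.indicator_of_mem h2,
            Set.indicator_of_mem (Set.mem_prod.2 ⟨h1, h2⟩), map_inv₀, Complex.conj_ofReal]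
          rw [← hsq]
          field_simp
        · simp [h1, h2]
      · simp [h1]
    · refine integral_eq_zero_of_ae ?_
      filter_upwards [hall] with z ⟨h1, h2, h3, h4⟩
      rw [h1, h2, h3, h4, Pi.zero_apply]
      by_cases hδ : δ = γ
      · have hδ' : δ' ≠ γ' := fun h' => hcase ⟨hδ, h'⟩
        by_cases hz : z.2 ∈ S δ'
        · simp [hdis δ' γ' _ hδ' hz]
        · simp [hz]
      · by_cases hz : z.1 ∈ S δ
        · simp [hdis δ γ _ hδ hz]
        · simp [hz]
  refine ⟨hψb, fun K _ _ _ n A A' B hA hA' hB => ?_⟩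
  simp only [tensorOp_eq_tensorMap]
  have hBc : ∀ i, IsCompactOperator (B i) := fun i => isCompactOperator_of_memSchatten hp (hB i)
  have hcomp := isCompactOperator_sum Finset.univ fun i =>
    isCompactOperator_tensorMap (hA' i).isCompactOperator (hBc i)
  have hPn : ∀ E : Finset Λ, ‖partialIsometry b b E‖ ≤ 1 :=
    norm_partialIsometry_le b.orthonormal b.orthonormal
  have hlim : ∀ z : HilbertTensor (Lp ℂ 2 ν) K, Tendsto (fun E : Finset Λ =>
      tensorMap (partialIsometry b b E) (ContinuousLinearMap.id ℂ K) z) atTop (nhds z) :=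
    tendsto_tensorMap_id hPn fun x => by
      have := b.hasSum_repr x
      simp only [partialIsometry_apply, ← b.repr_apply_apply]
      exact this
  have hadj : ∀ {H L : Type u} [NormedAddCommGroup H] [InnerProductSpace ℂ H] [CompleteSpace H]
      [NormedAddCommGroup L] [InnerProductSpace ℂ L] [CompleteSpace L] (s : Λ → H) (b : Λ → L)
      (E : Finset Λ), ContinuousLinearMap.adjoint
        (tensorMap (partialIsometry s b E) (ContinuousLinearMap.id ℂ K))
        = tensorMap (partialIsometry b s E) (ContinuousLinearMap.id ℂ K) := by
    intro H L _ _ _ _ _ _ s b E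
    rw [tensorMap_adjoint, adjoint_partialIsometry]
    congr 1
    exact ContinuousLinearMap.adjoint_id
  have hconj : ∀ {H L : Type u} [NormedAddCommGroup H] [InnerProductSpace ℂ H]
      [NormedAddCommGroup L] [InnerProductSpace ℂ L] (R : L →L[ℂ] H) (T : Fin n → (L →L[ℂ] L))
      (R' : H →L[ℂ] L), tensorMap R (ContinuousLinearMap.id ℂ K) ∘L
        (∑ i, tensorMap (T i) (B i)) ∘L tensorMap R' (ContinuousLinearMap.id ℂ K)
        = ∑ i, tensorMap (R ∘L T i ∘L R') (B i) := by
    intro H L _ _ _ _ R T R'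
    rw [ContinuousLinearMap.finsetSum_comp, ContinuousLinearMap.comp_finsetSum]
    refine Finset.sum_congr rfl fun i _ => ?_
    rw [← tensorMap_comp, ← tensorMap_comp, ContinuousLinearMap.id_comp,
      ContinuousLinearMap.comp_id]
  have hnt : ∀ {H L : Type u} [NormedAddCommGroup H] [InnerProductSpace ℂ H]
      [NormedAddCommGroup L] [InnerProductSpace ℂ L] (R : L →L[ℂ] H), ‖R‖ ≤ 1 →
      ‖tensorMap R (ContinuousLinearMap.id ℂ K)‖ ≤ 1 := fun R hR =>
    (norm_tensorMap_le _ _).trans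
      (mul_le_one₀ hR (norm_nonneg _) ContinuousLinearMap.norm_id_le)
  -- Reduce to the `E × E` corner of the matrices, which the finite rank partial isometries carry to
  -- `L²(X, μ)` and back.
  refine schattenNorm_le_of_tendsto hp hcomp (l := atTop)
    (S := fun E : Finset Λ => tensorMap (partialIsometry b b E) (ContinuousLinearMap.id ℂ K) ∘L
      (∑ i, tensorMap (A' i) (B i)) ∘L
        tensorMap (partialIsometry b b E) (ContinuousLinearMap.id ℂ K)) (fun x y => ?_) fun E => ?_
  · have h1 := (hlim x).inner (𝕜 := ℂ)
      (((∑ i, tensorMap (A' i) (B i)).continuous.tendsto y).comp (hlim y))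
    refine h1.congr fun E => ?_
    rw [ContinuousLinearMap.comp_apply, ← ContinuousLinearMap.adjoint_inner_left _ _ x, hadj]
    rfl
  · let D' : Fin n → (Lp ℂ 2 μ →L[ℂ] Lp ℂ 2 μ) := fun i =>
      ∑ γ ∈ E, ∑ γ' ∈ E, inner ℂ (b γ) (A i (b γ')) • D γ γ'
    have hD' : ∀ i, IsSchurImage μ φ
        (partialIsometry s b E ∘L A i ∘L partialIsometry b s E) (D' i) := by
      intro i
      rw [partialIsometry_conj]
      exact IsSchurImage.sum _ fun γ _ => IsSchurImage.sum _ fun γ' _ => (hD γ γ').const_smul _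
    have hDe : ∀ i, ∀ γ ∈ E, ∀ γ' ∈ E,
        inner ℂ (s γ) (D' i (s γ')) = inner ℂ (b γ) (A' i (b γ')) := by
      intro i γ hγ γ' hγ'
      simp only [D', sum_apply, smul_apply, inner_sum, inner_smul_right, hDs]
      rw [Finset.sum_eq_single γ, Finset.sum_eq_single γ', if_pos ⟨rfl, rfl⟩,
        (hA' i).inner_eq hc hν hb1, mul_comm]
      · intro δ' _ hne
        rw [if_neg (fun h => hne h.2.symm), mul_zero]
      · exact fun h => absurd hγ' h
      · intro δ _ hne
        refine Finset.sum_eq_zero fun δ' _ => ?_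
        rw [if_neg (fun h => hne h.1.symm), mul_zero]
      · exact fun h => absurd hγ h
    have e1 : ∀ i, partialIsometry b b E ∘L A' i ∘L partialIsometry b b E
        = partialIsometry b s E ∘L D' i ∘L partialIsometry s b E := by
      intro i
      rw [partialIsometry_conj, partialIsometry_conj]
      refine Finset.sum_congr rfl fun γ hγ => Finset.sum_congr rfl fun γ' hγ' => ?_
      rw [hDe i γ hγ γ' hγ']
    have hJ := hnt _ (norm_partialIsometry_le hon b.orthonormal E)
    have hJ' := hnt _ (norm_partialIsometry_le b.orthonormal hon E)
    rw [hconj]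
    simp only [e1]
    rw [← hconj, ← hadj]
    refine (schattenNorm_conj_le hp _ hJ hJ).trans ?_
    have hAm : ∀ i, MemSchatten p (partialIsometry s b E ∘L A i ∘L partialIsometry b s E) := by
      intro i
      have h1 := norm_partialIsometry_le b.orthonormal hon E
      have := schattenNorm_conj_le hp (A i) h1 h1
      rw [adjoint_partialIsometry] at this
      exact this.trans_lt (hA i)
    refine (h.bound_fintype K _ D' B hAm hD' hB).trans ?_
    gcongr
    rw [← hconj, ← hadj]
    exact schattenNorm_conj_le hp _ hJ' hJ'

end Sampling

/-! ### Transferring coefficients between unitary representations. -/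

section Intertwiner

variable {H L : Type*} [NormedAddCommGroup H] [InnerProductSpace ℂ H] [CompleteSpace H]
  [NormedAddCommGroup L] [InnerProductSpace ℂ L] [CompleteSpace L] {Λ : Type*} [Group Λ]

/-- An injective intertwiner of unitary representations yields an isometric one. -/
theorem exists_isometric_intertwiner {π : Λ → (H →L[ℂ] H)} {ρ : Λ → (L →L[ℂ] L)}
    (hπ : ∀ g, ContinuousLinearMap.adjoint (π g) = π g⁻¹)
    (hρ : ∀ g, ContinuousLinearMap.adjoint (ρ g) = ρ g⁻¹) (S : H →L[ℂ] L)
    (hS : ∀ x, S x = 0 → x = 0) (hintg : ∀ g, S ∘L π g = ρ g ∘L S) :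
    ∃ W : H →L[ℂ] L, (∀ x y, inner ℂ (W x) (W y) = inner ℂ x y) ∧ ∀ g, W ∘L π g = ρ g ∘L W := by
  let N : H →L[ℂ] H := ContinuousLinearMap.adjoint S ∘L S
  have hN0 : (0 : H →L[ℂ] H) ≤ N := by
    rw [ContinuousLinearMap.nonneg_iff_isPositive]
    exact ContinuousLinearMap.isPositive_adjoint_comp_self S
  -- Polar decomposition `S = W T` with `T = |S|`. Injectivity of `S` makes the range of `T` dense,
  -- so `W` is isometric; `T` commutes with `π` because `S* S` does, so `W` intertwines.
  let T : H →L[ℂ] H := CFC.sqrt N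
  have hT0 : (0 : H →L[ℂ] H) ≤ T := CFC.sqrt_nonneg N
  have hTT : T * T = N := CFC.sqrt_mul_sqrt_self N hN0
  have hTsa : ContinuousLinearMap.adjoint T = T := hT0.isSelfAdjoint
  have hnorm : ∀ x, ‖S x‖ = ‖T x‖ := by
    intro x
    have h1 : inner ℂ (T x) (T x) = inner ℂ (S x) (S x) := by
      rw [← ContinuousLinearMap.adjoint_inner_right, hTsa,
        ← ContinuousLinearMap.adjoint_inner_right S]
      exact congrArg (fun A : H →L[ℂ] H => inner ℂ x (A x)) hTT
    rw [inner_self_eq_norm_sq_to_K, inner_self_eq_norm_sq_to_K] at h1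
    have h2 : ‖T x‖ ^ 2 = ‖S x‖ ^ 2 := by exact_mod_cast h1
    exact ((sq_eq_sq₀ (norm_nonneg _) (norm_nonneg _)).1 h2).symm
  obtain ⟨W, -, hW⟩ := exists_contraction_comp_eq S T fun x => (hnorm x).le
  have hWT : ∀ x, W (T x) = S x := fun x => congrArg (fun A : H →L[ℂ] L => A x) hW
  have hdense : DenseRange T := by
    have : (LinearMap.range T.toLinearMap).topologicalClosure = ⊤ := by
      rw [Submodule.topologicalClosure_eq_top_iff, eq_bot_iff]
      intro y hy
      rw [Submodule.mem_bot]
      refine hS y (norm_eq_zero.1 ?_)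
      rw [hnorm, norm_eq_zero]
      refine ext_inner_left ℂ fun x => ?_
      rw [inner_zero_right, ← hTsa, ContinuousLinearMap.adjoint_inner_right]
      exact (Submodule.mem_orthogonal _ _).1 hy _ ⟨x, rfl⟩
    rw [DenseRange, dense_iff_closure_eq]
    have h2 := congrArg (fun M : Submodule ℂ H => (M : Set H)) this
    rw [Submodule.topologicalClosure_coe, Submodule.top_coe] at h2
    exact h2
  have hcomm : ∀ g, Commute N (π g) := by
    intro g
    have h1 : π g ∘L ContinuousLinearMap.adjoint S = ContinuousLinearMap.adjoint S ∘L ρ g := by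
      have := congrArg ContinuousLinearMap.adjoint (hintg g⁻¹)
      rw [ContinuousLinearMap.adjoint_comp, ContinuousLinearMap.adjoint_comp, hπ, hρ,
        inv_inv] at this
      exact this
    change (ContinuousLinearMap.adjoint S ∘L S) ∘L π g
      = π g ∘L (ContinuousLinearMap.adjoint S ∘L S)
    rw [← ContinuousLinearMap.comp_assoc, h1, ContinuousLinearMap.comp_assoc, hintg,
      ContinuousLinearMap.comp_assoc]
  have hcommT : ∀ g x, T (π g x) = π g (T x) := by
    intro g x
    have h1 : Commute T (π g) := by
      change Commute (CFC.sqrt N) (π g)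
      rw [CFC.sqrt]
      exact (hcomm g).cfcₙ_nnreal _
    exact congrArg (fun A : H →L[ℂ] H => A x) h1
  refine ⟨W, fun x y => ?_, fun g => ?_⟩
  · have hiso : ∀ x, ‖W x‖ = ‖x‖ := fun x => by
      refine hdense.induction_on (p := fun x => ‖W x‖ = ‖x‖) x
        (isClosed_eq (by fun_prop) (by fun_prop)) fun a => ?_
      rw [hWT, hnorm]
    have h1 := (W.norm_map_iff_adjoint_comp_self).1 hiso
    rw [← ContinuousLinearMap.adjoint_inner_right, ← ContinuousLinearMap.comp_apply, h1]
    rfl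
  · ext x
    refine hdense.induction_on (p := fun x => (W ∘L π g) x = (ρ g ∘L W) x) x
      (isClosed_eq (by fun_prop) (by fun_prop)) fun a => ?_
    rw [ContinuousLinearMap.comp_apply, ContinuousLinearMap.comp_apply, ← hcommT, hWT, hWT]
    exact congrArg (fun A : H →L[ℂ] L => A a) (hintg g)

/-- If the coefficients of `ξ` against a total set of vectors are implemented in `ρ`, then all
coefficients of `ξ` are coefficients of `ρ`. -/
theorem exists_coefficient_eq {π : Λ → (H →L[ℂ] H)} {ρ : Λ → (L →L[ℂ] L)}
    (hπ : ∀ g, ContinuousLinearMap.adjoint (π g) = π g⁻¹)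
    (hρ : ∀ g, ContinuousLinearMap.adjoint (ρ g) = ρ g⁻¹)
    (hπm : ∀ g g', π (g * g') = π g ∘L π g') (hρm : ∀ g g', ρ (g * g') = ρ g ∘L ρ g')
    (hπ1 : π 1 = ContinuousLinearMap.id ℂ H) {D : Set H}
    (hD : ∀ y, (∀ ζ ∈ D, inner ℂ ζ y = 0) → y = 0) (ξ : H) (δ : L)
    (hξ : ∀ ζ ∈ D, ∃ v : L, ∀ g, inner ℂ v (ρ g δ) = inner ℂ ζ (π g ξ)) (η : H) :
    ∃ f h : L, ∀ g, inner ℂ η (π g ξ) = inner ℂ h (ρ g f) := by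
  let e := WithLp.prodContinuousLinearEquiv 2 ℂ L H
  let p₁ : WithLp 2 (L × H) →L[ℂ] L := ContinuousLinearMap.fst ℂ L H ∘L (e : _ →L[ℂ] L × H)
  let p₂ : WithLp 2 (L × H) →L[ℂ] H := ContinuousLinearMap.snd ℂ L H ∘L (e : _ →L[ℂ] L × H)
  have hinner : ∀ z w : WithLp 2 (L × H),
      inner ℂ z w = inner ℂ (p₁ z) (p₁ w) + inner ℂ (p₂ z) (p₂ w) := fun z w =>
    WithLp.prod_inner_apply z w
  have hext : ∀ z w : WithLp 2 (L × H), p₁ z = p₁ w → p₂ z = p₂ w → z = w := fun z w h1 h2 =>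
    e.injective (Prod.ext h1 h2)
  let τ : Λ → (WithLp 2 (L × H) →L[ℂ] WithLp 2 (L × H)) := fun g =>
    (e.symm : (L × H) →L[ℂ] _) ∘L ((ρ g).prodMap (π g)) ∘L (e : _ →L[ℂ] L × H)
  have hτ₁ : ∀ g z, p₁ (τ g z) = ρ g (p₁ z) := fun g z => rfl
  have hτ₂ : ∀ g z, p₂ (τ g z) = π g (p₂ z) := fun g z => rfl
  let x : Λ → WithLp 2 (L × H) := fun g => e.symm (ρ g δ, π g ξ)
  have hx₁ : ∀ g, p₁ (x g) = ρ g δ := fun g => rfl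
  have hx₂ : ∀ g, p₂ (x g) = π g ξ := fun g => rfl
  clear_value p₁ p₂ τ x
  -- The closed invariant span of the orbit of `(δ, ξ)` in `L ⊕ H`, that is, the closure of the
  -- relation `ρ g δ ↦ π g ξ`.
  let 𝒢 : Submodule ℂ (WithLp 2 (L × H)) := (Submodule.span ℂ (Set.range x)).topologicalClosure
  have hcs : CompleteSpace 𝒢 := (Submodule.isClosed_topologicalClosure _).completeSpace_coe
  have hx : ∀ g, x g ∈ 𝒢 := fun g =>
    Submodule.le_topologicalClosure _ (Submodule.subset_span ⟨g, rfl⟩)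
  have hinv : ∀ g, ∀ z ∈ 𝒢, τ g z ∈ 𝒢 := by
    intro g
    have h1 : 𝒢 ≤ 𝒢.comap (τ g).toLinearMap := by
      refine Submodule.topologicalClosure_minimal _ ?_
        ((Submodule.isClosed_topologicalClosure _).preimage (τ g).continuous)
      rw [Submodule.span_le]
      rintro _ ⟨g', rfl⟩
      have : τ g (x g') = x (g * g') := hext _ _
        (by rw [hτ₁, hx₁, hx₁, hρm]; rfl) (by rw [hτ₂, hx₂, hx₂, hπm]; rfl)
      change τ g (x g') ∈ 𝒢
      rw [this]
      exact hx _
    exact fun z hz => h1 hz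
  let P : Λ → (𝒢 →L[ℂ] 𝒢) := fun g =>
    ((τ g) ∘L 𝒢.subtypeL).codRestrict 𝒢 fun z => hinv g z z.2
  have hP : ∀ g z, (P g z : WithLp 2 (L × H)) = τ g z := fun g z => rfl
  have hPadj : ∀ g, ContinuousLinearMap.adjoint (P g) = P g⁻¹ := by
    intro g
    symm
    rw [ContinuousLinearMap.eq_adjoint_iff]
    intro z w
    rw [Submodule.coe_inner, Submodule.coe_inner, hP, hP, hinner, hinner, hτ₁, hτ₁, hτ₂, hτ₂,
      ← hρ, ← hπ, ContinuousLinearMap.adjoint_inner_left, ContinuousLinearMap.adjoint_inner_left]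
  -- On `𝒢` the coefficients of the second component against `D` are determined by the first
  -- component. As `D` is total, the first projection is injective on `𝒢`.
  have hclos : ∀ ζ ∈ D, ∃ v : L, ∀ z ∈ 𝒢, inner ℂ ζ (p₂ z) = inner ℂ v (p₁ z) := by
    intro ζ hζ
    obtain ⟨v, hv⟩ := hξ ζ hζ
    refine ⟨v, ?_⟩
    have h1 : 𝒢 ≤ LinearMap.ker (innerSL ℂ ζ ∘L p₂ - innerSL ℂ v ∘L p₁).toLinearMap := by
      refine Submodule.topologicalClosure_minimal _ ?_ (ContinuousLinearMap.isClosed_ker _)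
      rw [Submodule.span_le]
      rintro _ ⟨g, rfl⟩
      change inner ℂ ζ (p₂ (x g)) - inner ℂ v (p₁ (x g)) = 0
      rw [hx₁, hx₂, hv, sub_self]
    intro z hz
    exact sub_eq_zero.1 (h1 hz)
  obtain ⟨W, hW, hWint⟩ := exists_isometric_intertwiner hPadj hρ (p₁ ∘L 𝒢.subtypeL)
    (fun z hz => by
      refine Subtype.ext (hext _ _ (hz.trans (map_zero p₁).symm) ?_)
      rw [Submodule.coe_zero, map_zero]
      refine hD _ fun ζ hζ => ?_
      obtain ⟨v, hv⟩ := hclos ζ hζ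
      rw [hv _ z.2]
      have : p₁ z = 0 := hz
      rw [this, inner_zero_right])
    (fun g => by
      ext z
      exact hτ₁ g z)
  let x₀ : 𝒢 := ⟨x 1, hx 1⟩
  -- `ξ = p₂ x₀`, so the coefficient against `η` is one of `x₀` against `p₂* η` inside `𝒢`, which
  -- `W` moves isometrically into `L`.
  refine ⟨W x₀, W (ContinuousLinearMap.adjoint (p₂ ∘L 𝒢.subtypeL) η), fun g => ?_⟩
  have h1 : ρ g (W x₀) = W (P g x₀) := (congrArg (fun A : 𝒢 →L[ℂ] L => A x₀) (hWint g)).symm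
  rw [h1, hW, ContinuousLinearMap.adjoint_inner_left]
  change _ = inner ℂ η (p₂ (τ g (x 1)))
  rw [hτ₂, hx₂, hπ1]
  rfl

end Intertwiner

/-! ### The left regular representation. -/

section Translation

variable {G : Type*} [Group G] [MeasurableSpace G] [MeasurableMul G] (μ : Measure G)
  [μ.IsMulLeftInvariant]

/-- The left regular representation on `L²`. -/
noncomputable def leftTranslation (g : G) : Lp ℂ 2 μ →L[ℂ] Lp ℂ 2 μ :=
  (Lp.compMeasurePreservingₗᵢ ℂ (fun x => g⁻¹ * x)
    (measurePreserving_mul_left μ g⁻¹)).toContinuousLinearMap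

theorem leftTranslation_coe (g : G) (f : Lp ℂ 2 μ) :
    leftTranslation μ g f =ᵐ[μ] fun x => f (g⁻¹ * x) :=
  Lp.coeFn_compMeasurePreserving f (measurePreserving_mul_left μ g⁻¹)

theorem norm_leftTranslation (g : G) (f : Lp ℂ 2 μ) : ‖leftTranslation μ g f‖ = ‖f‖ :=
  Lp.norm_compMeasurePreserving f (measurePreserving_mul_left μ g⁻¹)

theorem leftTranslation_one : leftTranslation μ (1 : G) = ContinuousLinearMap.id ℂ _ := by
  ext1 f
  refine Lp.ext ?_
  filter_upwards [leftTranslation_coe μ 1 f] with x hx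
  rw [hx, inv_one, one_mul]
  rfl

theorem leftTranslation_mul (g g' : G) :
    leftTranslation μ (g * g') = leftTranslation μ g ∘L leftTranslation μ g' := by
  ext1 f
  refine Lp.ext ?_
  filter_upwards [leftTranslation_coe μ (g * g') f, leftTranslation_coe μ g (leftTranslation μ g' f),
    (measurePreserving_mul_left μ g⁻¹).quasiMeasurePreserving.ae (leftTranslation_coe μ g' f)]
    with x h1 h2 h3
  rw [h1, ContinuousLinearMap.comp_apply, h2, h3, mul_inv_rev, mul_assoc]

theorem adjoint_leftTranslation (g : G) :
    ContinuousLinearMap.adjoint (leftTranslation μ g) = leftTranslation μ g⁻¹ := by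
  symm
  rw [ContinuousLinearMap.eq_adjoint_iff]
  intro x y
  have h1 : ∀ z w, inner ℂ (leftTranslation μ g z) (leftTranslation μ g w) = inner ℂ z w := by
    intro z w
    exact (Lp.compMeasurePreservingₗᵢ ℂ (fun x => g⁻¹ * x)
      (measurePreserving_mul_left μ g⁻¹)).inner_map_map z w
  rw [← h1, ← ContinuousLinearMap.comp_apply, ← leftTranslation_mul, mul_inv_cancel,
    leftTranslation_one]
  rfl

variable {μ}

theorem inner_leftTranslation_toLp {f h : G → ℂ} (hf : MemLp f 2 μ) (hh : MemLp h 2 μ) (g : G) :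
    inner ℂ (hh.toLp h) (leftTranslation μ g (hf.toLp f)) = ∫ x, f (g⁻¹ * x) * conj (h x) ∂μ := by
  rw [inner_toLp_left]
  refine integral_congr_ae ?_
  filter_upwards [leftTranslation_coe μ g (hf.toLp f),
    (measurePreserving_mul_left μ g⁻¹).quasiMeasurePreserving.ae hf.coeFn_toLp] with x h1 h2
  rw [h1, h2, mul_comm]

/-- Coefficients of the regular representation are bounded. -/
theorem MemFourierAlgebra.exists_norm_le {φ : G → ℂ} (h : MemFourierAlgebra μ φ) :
    ∃ M : ℝ, ∀ g, ‖φ g‖ ≤ M := by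
  obtain ⟨f, k, hf, hk, hφ⟩ := h
  refine ⟨‖hk.toLp k‖ * ‖hf.toLp f‖, fun g => ?_⟩
  rw [hφ, ← inner_leftTranslation_toLp hf hk]
  exact (norm_inner_le_norm _ _).trans_eq (by rw [norm_leftTranslation])

end Translation

/-! ### Restricting coefficients from `G` to `Γ`. -/

section Restriction

variable {G : Type u} [Group G] [MeasurableSpace G] [MeasurableMul G] {μ : Measure G}
  [μ.IsMulLeftInvariant] {Γ : Subgroup G} [Countable Γ] [MeasurableSingletonClass Γ]
  {ν : Measure Γ} [ν.IsMulLeftInvariant] {c : ℝ}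

/-- Coefficients of the regular representation of `G` restrict to coefficients of the regular
representation of a discrete subgroup with a measurable fundamental domain. -/
theorem memFourierAlgebra_restrict (hc : 0 < c) (hν : ∀ γ, ν {γ} = ENNReal.ofReal c) {κ : G → Γ}
    (hκ : Measurable κ) (hκm : ∀ (γ : Γ) x, κ (γ * x) = γ * κ x) {f h : G → ℂ} (hf : MemLp f 2 μ)
    (hh : MemLp h 2 μ) :
    MemFourierAlgebra ν fun γ => ∫ x, f ((γ : G)⁻¹ * x) * conj (h x) ∂μ := by
  have : MeasurableMul Γ := ⟨fun _ => .of_discrete, fun _ => .of_discrete⟩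
  obtain ⟨b, hb1, hb2⟩ := exists_pointBasis hc hν
  let R : Γ → (Lp ℂ 2 μ →L[ℂ] Lp ℂ 2 μ) := fun γ => indicatorCLM μ (hκ (measurableSet_singleton γ))
  have hRsa : ∀ γ, ContinuousLinearMap.adjoint (R γ) = R γ := fun γ => adjoint_indicatorCLM _
  have hRid : ∀ γ, R γ ∘L R γ = R γ := fun γ => indicatorCLM_comp_self _
  have hRo : ∀ γ γ', γ ≠ γ' → R γ ∘L R γ' = 0 := fun γ γ' hne =>
    indicatorCLM_comp_of_disjoint _ _ (Disjoint.preimage _ (by simpa using hne))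
  -- Equivariance of `κ`: translation by `γ'` permutes the fibres.
  have hRt : ∀ (γ γ' : Γ) ξ, R γ (leftTranslation μ (γ' : G) ξ)
      = leftTranslation μ (γ' : G) (R (γ'⁻¹ * γ) ξ) := by
    intro γ γ' ξ
    refine Lp.ext ?_
    filter_upwards [indicatorCLM_coe (hκ (measurableSet_singleton γ)) (leftTranslation μ (γ' : G) ξ),
      leftTranslation_coe μ (γ' : G) ξ, leftTranslation_coe μ (γ' : G) (R (γ'⁻¹ * γ) ξ),
      (measurePreserving_mul_left μ (γ' : G)⁻¹).quasiMeasurePreserving.ae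
        (indicatorCLM_coe (hκ (measurableSet_singleton (γ'⁻¹ * γ))) ξ)] with x h1 h2 h3 h4
    rw [h1, h3, h4]
    have hk : κ ((γ' : G)⁻¹ * x) = γ'⁻¹ * κ x := hκm γ'⁻¹ x
    by_cases hx : κ x = γ
    · rw [Set.indicator_of_mem (by simpa using hx), h2, Set.indicator_of_mem]
      simp [hk, hx]
    · rw [Set.indicator_of_notMem (by simpa using hx), Set.indicator_of_notMem]
      simpa [hk] using hx
  have hbt : ∀ g : Γ, leftTranslation ν g (b 1) = b g := by
    intro g
    refine Lp.ext ?_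
    filter_upwards [leftTranslation_coe ν g (b 1)] with x hx
    rw [hx, hb2, hb2]
    have : g⁻¹ * x = 1 ↔ x = g := by rw [inv_mul_eq_one, eq_comm]
    by_cases hxg : x = g
    · rw [if_pos (this.2 hxg), if_pos hxg]
    · rw [if_neg (fun h => hxg (this.1 h)), if_neg hxg]
  -- The total set `D` consists of the vectors supported on one fibre of `κ`, and `δ` is the point
  -- mass at `1`, whose translates form the basis `b`; implementing a coefficient then only requires
  -- square summability.
  obtain ⟨f', h', hfh⟩ := exists_coefficient_eq (Λ := Γ)
    (π := fun γ => leftTranslation μ (γ : G)) (ρ := fun γ => leftTranslation ν γ)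
    (fun g => by rw [adjoint_leftTranslation]; rfl) (fun g => adjoint_leftTranslation ν g)
    (fun g g' => leftTranslation_mul μ _ _) (fun g g' => leftTranslation_mul ν _ _)
    (leftTranslation_one μ) (D := {ζ | ∃ γ, R γ ζ = ζ})
    (fun y hy => by
      have h0 : ∀ γ, R γ y = 0 := fun γ => by
        refine ext_inner_left ℂ fun z => ?_
        rw [inner_zero_right, ← hRsa, ContinuousLinearMap.adjoint_inner_right]
        exact hy _ ⟨γ, congrArg (fun A : Lp ℂ 2 μ →L[ℂ] Lp ℂ 2 μ => A z) (hRid γ)⟩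
      have h1 := tendsto_sum_indicatorCLM hκ y
      refine tendsto_nhds_unique h1 (tendsto_const_nhds.congr fun E => ?_)
      rw [sum_apply]
      exact (Finset.sum_eq_zero fun γ _ => h0 γ).symm)
    (hf.toLp f) (b 1)
    (by
      rintro ζ ⟨γ₀, hζ⟩
      let a : Γ → ℂ := fun g => conj (inner ℂ ζ (leftTranslation μ (g : G) (hf.toLp f)))
      -- A vector `ζ` on the fibre of `γ₀` meets, after translation by `g`, only the piece of `f` on
      -- the fibre of `g⁻¹ γ₀`; these pieces are orthogonal.
      have ha : Memℓp a 2 := by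
        refine memℓp_gen' (C := (‖ζ‖ * ‖hf.toLp f‖) ^ 2) fun E => ?_
        have h1 : ∀ g, ‖a g‖ ^ (2 : ℝ≥0∞).toReal
            ≤ ‖ζ‖ ^ 2 * ‖R (g⁻¹ * γ₀) (hf.toLp f)‖ ^ 2 := by
          intro g
          simp only [a, RCLike.norm_conj, ENNReal.toReal_ofNat, Real.rpow_ofNat]
          rw [← hζ, ← ContinuousLinearMap.adjoint_inner_right, hRsa, hRt, ← mul_pow, hζ]
          gcongr
          exact (norm_inner_le_norm _ _).trans_eq (by rw [norm_leftTranslation])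
        refine (Finset.sum_le_sum fun g _ => h1 g).trans ?_
        rw [← Finset.mul_sum, mul_pow]
        gcongr
        classical
        have h2 := (sum_norm_sq_le_of_orthogonal hRsa hRid hRo
          (E.image fun g => g⁻¹ * γ₀) (hf.toLp f)).1
        rwa [Finset.sum_image fun x _ y _ hxy => by simpa using hxy] at h2
      refine ⟨b.repr.symm ⟨a, ha⟩, fun g => ?_⟩
      rw [hbt, ← inner_conj_symm, ← b.repr_apply_apply, LinearIsometryEquiv.apply_symm_apply]
      exact Complex.conj_conj _)
    (hh.toLp h)
  refine ⟨f', h', Lp.memLp f', Lp.memLp h', fun g => ?_⟩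
  rw [← inner_leftTranslation_toLp (Lp.memLp f') (Lp.memLp h'), Lp.toLp_coeFn, Lp.toLp_coeFn,
    ← hfh g, inner_leftTranslation_toLp hf hh]

end Restriction

/-! ### A measurable fundamental domain, and unimodularity. -/

section FundamentalDomain

variable {G : Type u} [Group G] [TopologicalSpace G] [IsTopologicalGroup G]
  [SecondCountableTopology G] [MeasurableSpace G] [BorelSpace G] {Γ : Subgroup G}

/-- A discrete subgroup `Γ` has a measurable `Γ`-equivariant map `G → Γ`, i.e. a measurable
strict fundamental domain. -/
theorem exists_equivariant_map [T1Space G] [DiscreteTopology Γ] [Countable Γ] :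
    ∃ κ : G → Γ, Measurable κ ∧ ∀ (γ : Γ) x, κ (γ * x) = γ * κ x := by
  obtain ⟨W, hWo, hW⟩ : ∃ W : Set G, IsOpen W ∧ ∀ γ : Γ, (γ : G) ∈ W ↔ γ = 1 := by
    have h1 : IsOpen ({1} : Set Γ) := isOpen_discrete _
    obtain ⟨W, hWo, hW⟩ := isOpen_induced_iff.1 h1
    refine ⟨W, hWo, fun γ => ?_⟩
    have : γ ∈ Subtype.val ⁻¹' W ↔ γ ∈ ({1} : Set Γ) := by rw [hW]
    simpa using this
  obtain ⟨U, hUo, hU1, hU⟩ : ∃ U : Set G, IsOpen U ∧ (1 : G) ∈ U ∧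
      ∀ u ∈ U, ∀ u' ∈ U, u' * u⁻¹ ∈ W := by
    have hcont : ContinuousAt (fun z : G × G => z.2 * z.1⁻¹) (1, 1) := by fun_prop
    have hnhds : W ∈ nhds ((1 : G) * 1⁻¹) := by
      rw [inv_one, mul_one]
      exact hWo.mem_nhds ((hW 1).2 rfl)
    have h2 := hcont.preimage_mem_nhds hnhds
    rw [nhds_prod_eq, mem_prod_self_iff] at h2
    obtain ⟨t, ht, hts⟩ := h2
    obtain ⟨U, hUt, hUo, hU1⟩ := mem_nhds_iff.1 ht
    exact ⟨U, hUo, hU1, fun u hu u' hu' => @hts (u, u') ⟨hUt hu, hUt hu'⟩⟩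
  let d : ℕ → G := TopologicalSpace.denseSeq G
  -- The sets `V n = U d n` cover `G`, and the choice of `U` makes each of them meet every `Γ`-orbit
  -- at most once.
  let V : ℕ → Set G := fun n => {x | x * (d n)⁻¹ ∈ U}
  have hVo : ∀ n, IsOpen (V n) := fun n => hUo.preimage (by fun_prop)
  have huniq : ∀ n (x : G) (γ γ' : Γ), (γ : G) * x ∈ V n → (γ' : G) * x ∈ V n → γ = γ' := by
    intro n x γ γ' h1 h2
    have h3 := hU _ h1 _ h2
    have h4 : (γ' : G) * x * (d n)⁻¹ * ((γ : G) * x * (d n)⁻¹)⁻¹ = ((γ' * γ⁻¹ : Γ) : G) := by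
      push_cast; group
    rw [h4, hW] at h3
    exact (mul_inv_eq_one.1 h3).symm
  have hcover : ∀ x : G, ∃ n, ∃ γ : Γ, (γ : G) * x ∈ V n := by
    intro x
    have h1 : IsOpen {y : G | x * y⁻¹ ∈ U} := hUo.preimage (by fun_prop)
    obtain ⟨_, hy, n, rfl⟩ := (TopologicalSpace.denseRange_denseSeq G).inter_open_nonempty _ h1
      ⟨x, by simpa using hU1⟩
    exact ⟨n, 1, by simpa [V] using hy⟩
  classical
  let N : G → ℕ := fun x => Nat.find (hcover x)
  have hN : ∀ x : G, ∃ γ : Γ, (γ : G) * x ∈ V (N x) := fun x => Nat.find_spec (hcover x)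
  -- `N x` is the first index whose `V n` meets the orbit of `x`; it depends only on the orbit, and
  -- `κ x` is the inverse of the unique element carrying `x` into `V (N x)`.
  let κ : G → Γ := fun x => (hN x).choose⁻¹
  have hκ : ∀ x, ((κ x)⁻¹ : G) * x ∈ V (N x) := fun x => by
    simpa [κ] using (hN x).choose_spec
  have hNm : ∀ (γ : Γ) x, N (γ * x) = N x := by
    intro γ x
    refine Nat.find_congr' fun {n} => ⟨?_, ?_⟩
    · rintro ⟨γ', h⟩
      exact ⟨γ' * γ, by simpa [mul_assoc] using h⟩
    · rintro ⟨γ', h⟩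
      exact ⟨γ' * γ⁻¹, by simpa [mul_assoc] using h⟩
  refine ⟨κ, measurable_to_countable' fun γ => ?_, fun γ x => ?_⟩
  · have hpre : κ ⁻¹' {γ} = ⋃ n, {x | ((γ⁻¹ : Γ) : G) * x ∈ V n} \
        ⋃ m ∈ Finset.range n, ⋃ γ' : Γ, {x | (γ' : G) * x ∈ V m} := by
      ext x
      simp only [Set.mem_preimage, Set.mem_singleton_iff, Set.mem_iUnion, Set.mem_sdiff,
        Finset.mem_range, not_exists, Set.mem_ofPred_eq]
      constructor
      · rintro rfl
        exact ⟨N x, hκ x, fun m hm γ' h => Nat.find_min (hcover x) hm ⟨γ', h⟩⟩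
      · rintro ⟨n, h1, h2⟩
        have hn : N x = n := (Nat.find_eq_iff (hcover x)).2
          ⟨⟨_, h1⟩, fun m hm ⟨γ', h⟩ => h2 m hm γ' h⟩
        have h3 := hκ x
        rw [hn] at h3
        have := huniq n x (κ x)⁻¹ γ⁻¹ h3 h1
        exact inv_injective this
    rw [hpre]
    have hmeas : ∀ (γ : G) n, MeasurableSet {x | γ * x ∈ V n} := fun γ n =>
      ((hVo n).preimage (continuous_const_mul γ)).measurableSet
    refine MeasurableSet.iUnion fun n => (hmeas _ n).diff ?_
    exact Finset.measurableSet_biUnion _ fun m _ => MeasurableSet.iUnion fun γ' => hmeas _ m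
  · have h1 := hκ (γ * x)
    rw [hNm] at h1
    have h2 := huniq (N x) x ((κ (γ * x))⁻¹ * γ) (κ x)⁻¹ (by simpa [mul_assoc] using h1) (hκ x)
    have h3 := congrArg (·⁻¹) h2
    simp only [mul_inv_rev, inv_inv] at h3
    rw [← h3, mul_inv_cancel_left]

variable {μ : Measure G} {κ : G → Γ}

theorem isFundamentalDomain_preimage_one [MeasurableSingletonClass Γ] (hκ : Measurable κ)
    (hκm : ∀ (γ : Γ) x, κ (γ * x) = γ * κ x) : IsFundamentalDomain Γ (κ ⁻¹' {1}) μ := by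
  refine IsFundamentalDomain.mk' (hκ (measurableSet_singleton 1)).nullMeasurableSet fun x => ?_
  refine ⟨(κ x)⁻¹, ?_, fun γ hγ => ?_⟩
  · change κ (((κ x)⁻¹ : Γ) * x) = 1
    rw [hκm, inv_mul_cancel]
  · have : κ (γ * x) = 1 := hγ
    rw [hκm] at this
    exact eq_inv_of_mul_eq_one_left this

theorem comp_mul_right_equivariant (hκm : ∀ (γ : Γ) x, κ (γ * x) = γ * κ x) (g : G) (γ : Γ) (x : G) :
    κ (γ * x * g) = γ * κ (x * g) := by
  rw [mul_assoc, hκm]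

variable [LocallyCompactSpace G] [μ.IsHaarMeasure] [Countable Γ] [MeasurableSingletonClass Γ]

theorem measure_preimage_one_ne_top (hΓ : IsLattice Γ μ) (hκ : Measurable κ)
    (hκm : ∀ (γ : Γ) x, κ (γ * x) = γ * κ x) : μ (κ ⁻¹' {1}) ≠ ∞ := by
  obtain ⟨F, hF, hfin⟩ := hΓ.finite_covolume
  rw [(isFundamentalDomain_preimage_one hκ hκm).measure_eq hF]
  exact hfin.ne

theorem measure_preimage_one_ne_zero (hκ : Measurable κ)
    (hκm : ∀ (γ : Γ) x, κ (γ * x) = γ * κ x) : μ (κ ⁻¹' {1}) ≠ 0 :=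
  (isFundamentalDomain_preimage_one hκ hκm).measure_ne_zero (NeZero.ne μ)

/-- A right translate of `μ` is a left Haar measure, hence a multiple of `μ`. Right translates of
`F` are again fundamental domains, of the same finite nonzero measure, so the factor is `1`. -/
theorem isMulRightInvariant_of_isLattice (hΓ : IsLattice Γ μ) (hκ : Measurable κ)
    (hκm : ∀ (γ : Γ) x, κ (γ * x) = γ * κ x) : μ.IsMulRightInvariant := by
  refine ⟨fun g => ?_⟩
  have h1 := Measure.isMulLeftInvariant_eq_smul (Measure.map (· * g) μ) μ
  have h2 : Measure.map (· * g) μ (κ ⁻¹' {1}) = μ (κ ⁻¹' {1}) := by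
    rw [Measure.map_apply (measurable_mul_const g) (hκ (measurableSet_singleton 1))]
    exact (isFundamentalDomain_preimage_one (κ := fun x => κ (x * g))
      (hκ.comp (measurable_mul_const g)) (comp_mul_right_equivariant hκm g)).measure_eq
      (isFundamentalDomain_preimage_one hκ hκm)
  rw [h1] at h2 ⊢
  rw [Measure.smul_apply] at h2
  have h3 : Measure.haarScalarFactor (Measure.map (· * g) μ) μ = 1 := by
    have := (ENNReal.mul_eq_right (measure_preimage_one_ne_zero hκ hκm)
      (measure_preimage_one_ne_top hΓ hκ hκm)).1 h2
    exact_mod_cast this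
  rw [h3, one_smul]

/-- The inverted measure is left invariant, so it is `c • μ`; inverting twice gives `c² = 1`. -/
theorem isInvInvariant_of_isMulRightInvariant [μ.IsMulRightInvariant] : μ.IsInvInvariant := by
  refine ⟨?_⟩
  have h1 := Measure.isMulLeftInvariant_eq_smul μ.inv μ
  set c := Measure.haarScalarFactor μ.inv μ
  have h2 : μ = (c * c) • μ := by
    conv_lhs => rw [← Measure.inv_inv μ]
    conv_lhs => rw [h1]
    rw [Measure.inv_def, Measure.map_smul, ← Measure.inv_def, h1, smul_smul]
  obtain ⟨K, hK⟩ := exists_compact_mem_nhds (1 : G)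
  have h0 : μ K ≠ 0 := (Measure.measure_pos_of_mem_nhds μ hK.2).ne'
  have h3 := congrArg (fun m : Measure G => m K) h2
  simp only [Measure.smul_apply] at h3
  have h4 : c * c = 1 := by
    have := (ENNReal.mul_eq_right h0 hK.1.measure_ne_top).1 h3.symm
    exact_mod_cast this
  have h5 : c = 1 := by
    rw [← sq] at h4
    exact (pow_eq_one_iff_of_nonneg zero_le two_ne_zero).1 h4
  rw [h1, h5, one_smul]

end FundamentalDomain

/-! ### From `Γ` to `G`: averages over the fundamental domain. -/

section Induction

variable {G : Type u} [Group G] [TopologicalSpace G] [IsTopologicalGroup G]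
  [SecondCountableTopology G] [LocallyCompactSpace G] [MeasurableSpace G] [BorelSpace G]
  {Γ : Subgroup G} [Countable Γ] [MeasurableSingletonClass Γ] {μ : Measure G} [μ.IsHaarMeasure]
  {κ : G → Γ}

/-- The normalized restriction of a measure to the fundamental domain `κ⁻¹(1)`. -/
noncomputable def domainMeasure (μ : Measure G) (κ : G → Γ) : Measure G :=
  (μ (κ ⁻¹' {1}))⁻¹ • μ.restrict (κ ⁻¹' {1})

theorem isProbabilityMeasure_domainMeasure (hΓ : IsLattice Γ μ) (hκ : Measurable κ)
    (hκm : ∀ (γ : Γ) x, κ (γ * x) = γ * κ x) : IsProbabilityMeasure (domainMeasure μ κ) :=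
  ProbabilityTheory.cond_isProbabilityMeasure_of_finite (measure_preimage_one_ne_zero hκ hκm)
    (measure_preimage_one_ne_top hΓ hκ hκm)

theorem ae_domainMeasure (hκ : Measurable κ) : ∀ᵐ y ∂(domainMeasure μ κ), κ y = 1 :=
  Measure.ae_smul_measure (ae_restrict_mem (hκ (measurableSet_singleton 1))) _

/-- The average of `φ ∘ κ` over right translates of the fundamental domain. -/
noncomputable def induced (μ : Measure G) (κ : G → Γ) (φ : Γ → ℂ) (g : G) : ℂ :=
  ∫ y, φ (κ (y * g)) ∂(domainMeasure μ κ)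

/-- A left `Γ`-invariant function has the same integral over the fundamental domains `F` and `F g`.
-/
theorem integral_domainMeasure_mul_right [μ.IsMulRightInvariant] (hκ : Measurable κ)
    (hκm : ∀ (γ : Γ) x, κ (γ * x) = γ * κ x) {E : Type*} [NormedAddCommGroup E] [NormedSpace ℝ E]
    {w : G → E} (hw : ∀ (γ : Γ) x, w (γ * x) = w x) (g : G) :
    ∫ y, w (y * g) ∂(domainMeasure μ κ) = ∫ y, w y ∂(domainMeasure μ κ) := by
  rw [domainMeasure, integral_smul_measure, integral_smul_measure]
  congr 1
  have h1 := (measurePreserving_mul_right μ g).setIntegral_preimage_emb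
    (measurableEmbedding_mulRight g) w ((fun x => κ (x * g⁻¹)) ⁻¹' {1})
  have h2 : (fun x => x * g) ⁻¹' ((fun x => κ (x * g⁻¹)) ⁻¹' {1}) = κ ⁻¹' {1} := by
    ext x; simp
  rw [h2] at h1
  rw [h1]
  exact (isFundamentalDomain_preimage_one (κ := fun x => κ (x * g⁻¹))
    (hκ.comp (measurable_mul_const g⁻¹)) (comp_mul_right_equivariant hκm g⁻¹)).setIntegral_eq
    (isFundamentalDomain_preimage_one hκ hκm) hw

/-- On `F` one has `κ x = 1`, so the integrand may be replaced by `φ (κ(x)⁻¹ κ(x g⁻¹ h))`. This is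
left `Γ`-invariant, and the average does not change under `x ↦ x g`. -/
theorem herzSchurSymbol_induced [μ.IsMulRightInvariant] (hκ : Measurable κ)
    (hκm : ∀ (γ : Γ) x, κ (γ * x) = γ * κ x) (φ : Γ → ℂ) :
    herzSchurSymbol (induced μ κ φ) = fun z => ∫ y, herzSchurSymbol φ (κ (y * z.1), κ (y * z.2))
      ∂(domainMeasure μ κ) := by
  funext z
  have h1 := integral_domainMeasure_mul_right (μ := μ) hκ hκm
    (w := fun x => φ ((κ x)⁻¹ * κ (x * (z.1⁻¹ * z.2)))) (fun γ x => by
      rw [comp_mul_right_equivariant hκm, hκm]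
      group) z.1
  simp only [herzSchurSymbol, induced]
  rw [← integral_congr_ae (f := fun x => φ ((κ x)⁻¹ * κ (x * (z.1⁻¹ * z.2)))), ← h1]
  · simp [mul_assoc]
  · filter_upwards [ae_domainMeasure hκ] with x hx
    rw [hx, inv_one, one_mul]

theorem cbSchurNorm_induced_le {ν : Measure Γ} [SFinite ν] {c : ℝ} (hc : 0 < c)
    (hν : ∀ γ, ν {γ} = ENNReal.ofReal c) (hΓ : IsLattice Γ μ) (hκ : Measurable κ)
    (hκm : ∀ (γ : Γ) x, κ (γ * x) = γ * κ x) {p : ℝ≥0∞} (hp : 1 ≤ p) {φ : Γ → ℂ} {C : ℝ≥0}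
    (h : cbSchurNorm p ν (herzSchurSymbol φ) ≤ C) :
    cbSchurNorm p μ (herzSchurSymbol (induced μ κ φ)) ≤ C := by
  have := isMulRightInvariant_of_isLattice hΓ hκ hκm
  have := isProbabilityMeasure_domainMeasure hΓ hκ hκm
  rw [cbSchurNorm_le_iff] at h ⊢
  intro C' hC'
  rw [herzSchurSymbol_induced hκ hκm]
  exact (h C' hC').average hc hν hp (lt_of_le_of_lt (zero_le) hC') (q := fun y x => κ (y * x))
    (hκ.comp measurable_mul)

/-- `G` is the disjoint union of the sets `γ⁻¹ F`, and each point of `Γ` has mass `c`. -/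
theorem measurePreserving_unfold {ν : Measure Γ} [SFinite ν] {c : ℝ}
    (hν : ∀ γ, ν {γ} = ENNReal.ofReal c) (hκ : Measurable κ)
    (hκm : ∀ (γ : Γ) x, κ (γ * x) = γ * κ x) :
    MeasurePreserving (fun z : Γ × G => (z.1 : G)⁻¹ * z.2) (ν.prod (μ.restrict (κ ⁻¹' {1})))
      (ENNReal.ofReal c • μ) := by
  have hm : Measurable fun z : Γ × G => (z.1 : G)⁻¹ * z.2 := by fun_prop
  refine ⟨hm, Measure.ext fun s hs => ?_⟩
  rw [Measure.map_apply hm hs, Measure.prod_apply (hm hs), lintegral_countable', Measure.smul_apply,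
    (isFundamentalDomain_preimage_one hκ hκm).measure_eq_tsum s, smul_eq_mul, ← ENNReal.tsum_mul_left]
  refine tsum_congr fun γ => ?_
  rw [hν, mul_comm, Measure.restrict_apply (measurable_prodMk_left (hm hs))]
  congr 2
  ext x
  simp only [Set.mem_inter_iff, Set.mem_preimage, Set.mem_smul_set_iff_inv_smul_mem]
  rfl

theorem memFourierAlgebra_induced {ν : Measure Γ} [SFinite ν] {c : ℝ} (hc : 0 < c)
    (hν : ∀ γ, ν {γ} = ENNReal.ofReal c) (hΓ : IsLattice Γ μ) (hκ : Measurable κ)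
    (hκm : ∀ (γ : Γ) x, κ (γ * x) = γ * κ x) {φ : Γ → ℂ} (h : MemFourierAlgebra ν φ) :
    MemFourierAlgebra μ (induced μ κ φ) := by
  have := isMulRightInvariant_of_isLattice hΓ hκ hκm
  have := isInvInvariant_of_isMulRightInvariant (μ := μ)
  have hF := measure_preimage_one_ne_top hΓ hκ hκm
  have hfin : IsFiniteMeasure (μ.restrict (κ ⁻¹' {1})) := ⟨by simpa using hF.lt_top⟩
  have hunf := measurePreserving_unfold (μ := μ) hν hκ hκm
  have hc0 : ENNReal.ofReal c ≠ 0 := by simpa using hc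
  have hval : ∀ᵐ z : Γ × G ∂(ν.prod (μ.restrict (κ ⁻¹' {1}))), κ z.2 = 1 :=
    Measure.quasiMeasurePreserving_snd.ae (ae_restrict_mem (hκ (measurableSet_singleton 1)))
  have hlift : ∀ f : Γ → ℂ, MemLp f 2 ν → MemLp (fun x => f (κ x)⁻¹) 2 μ := by
    intro f hf
    have hmeas : Measurable fun x => f (κ x)⁻¹ :=
      (Measurable.of_discrete (f := fun γ : Γ => f γ⁻¹)).comp hκ
    have h1 : MemLp (fun x => f (κ x)⁻¹) 2 (ENNReal.ofReal c • μ) := by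
      rw [← hunf.map_eq, memLp_map_measure_iff hmeas.aestronglyMeasurable hunf.aemeasurable]
      refine (hf.comp_fst (μ.restrict (κ ⁻¹' {1}))).ae_eq ?_
      filter_upwards [hval] with z hz
      have hk : κ ((z.1 : G)⁻¹ * z.2) = z.1⁻¹ * κ z.2 := hκm z.1⁻¹ z.2
      simp [hk, hz]
    refine h1.of_measure_le_smul (c := (ENNReal.ofReal c)⁻¹) (ENNReal.inv_ne_top.2 hc0) ?_
    rw [smul_smul, ENNReal.inv_mul_cancel hc0 ENNReal.ofReal_ne_top, one_smul]
  obtain ⟨f, k, hf, hk, hφ⟩ := h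
  have hf' := hlift f hf
  have hk' := hlift k hk
  -- The constant combines the normalization `1 / μ(F)` with the mass `c` gained by unfolding `Γ ×
  -- F` onto `G`.
  let a : ℂ := ((μ (κ ⁻¹' {1}))⁻¹.toReal * c : ℝ)
  -- The integral over `Γ × F` unfolds to a coefficient of right translation on `G`; the
  -- substitution `x ↦ x⁻¹` turns it into a coefficient of left translation.
  refine ⟨fun x => a * f (κ x⁻¹)⁻¹, fun x => k (κ x⁻¹)⁻¹,
    (hf'.comp_measurePreserving (Measure.measurePreserving_inv μ)).const_mul a,
    hk'.comp_measurePreserving (Measure.measurePreserving_inv μ), fun g => ?_⟩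
  let I : G → ℂ := fun y => f (κ (y * g))⁻¹ * conj (k (κ y)⁻¹)
  have hI : Integrable I μ :=
    (hf'.comp_measurePreserving (measurePreserving_mul_right μ g)).integrable_mul hk'.star
  have hIc : Integrable I (ENNReal.ofReal c • μ) := hI.smul_measure ENNReal.ofReal_ne_top
  have hIs : Integrable (fun z : Γ × G => I ((z.1 : G)⁻¹ * z.2)) (ν.prod (μ.restrict (κ ⁻¹' {1}))) :=
    hunf.integrable_comp_of_integrable hIc
  have e1 : ∫ y in κ ⁻¹' {1}, φ (κ (y * g)) ∂μ = c * ∫ y, I y ∂μ := by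
    have h1 : (c : ℂ) * ∫ y, I y ∂μ = ∫ y, I y ∂(ENNReal.ofReal c • μ) := by
      rw [integral_smul_measure, ENNReal.toReal_ofReal hc.le, Complex.real_smul]
    rw [h1, ← hunf.map_eq, integral_map hunf.aemeasurable
      (by rw [hunf.map_eq]; exact hIc.aestronglyMeasurable), integral_prod_symm _ hIs]
    refine integral_congr_ae ?_
    filter_upwards [ae_restrict_mem (hκ (measurableSet_singleton 1))] with y hy
    rw [hφ]
    refine integral_congr_ae (Eventually.of_forall fun x => ?_)
    have h2 : κ ((x : G)⁻¹ * y * g) = x⁻¹ * κ (y * g) := by rw [mul_assoc]; exact hκm x⁻¹ (y * g)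
    have h3 : κ ((x : G)⁻¹ * y) = x⁻¹ * κ y := hκm x⁻¹ y
    have h4 : κ y = 1 := hy
    simp [I, h2, h3, h4]
  have e2 : ∫ x, a * f (κ (g⁻¹ * x)⁻¹)⁻¹ * conj (k (κ x⁻¹)⁻¹) ∂μ = a * ∫ y, I y ∂μ := by
    rw [← integral_inv_eq_self I μ, ← integral_const_mul]
    refine integral_congr_ae (Eventually.of_forall fun x => ?_)
    simp [I, mul_assoc]
  rw [e2, induced, domainMeasure, integral_smul_measure, e1, Complex.real_smul]
  simp only [a]
  push_cast
  ring

/-- Take a compact `L ⊆ F` carrying almost all of `F`. If `y` and the representative of `y g` in `F`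
both lie in `L`, then `κ (y g)` lies in the compact set `L Q L⁻¹ ∩ Γ`, where convergence is uniform.
Each condition fails with probability at most `δ`, uniformly in `g`, and there the bound `M` is
used. -/
theorem tendstoUniformlyOn_induced [T2Space G] (hΓ : IsLattice Γ μ) (hκ : Measurable κ)
    (hκm : ∀ (γ : Γ) x, κ (γ * x) = γ * κ x) {ι : Type*} {l : Filter ι} {φ : ι → Γ → ℂ} {M : ℝ}
    (hM : ∀ α γ, ‖φ α γ‖ ≤ M)
    (h : ∀ Q : Set Γ, IsCompact Q → TendstoUniformlyOn φ (fun _ => 1) l Q) {Q : Set G}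
    (hQ : IsCompact Q) :
    TendstoUniformlyOn (fun α => induced μ κ (φ α)) (fun _ => 1) l Q := by
  have := hΓ.discrete
  have := isMulRightInvariant_of_isLattice hΓ hκ hκm
  have := isProbabilityMeasure_domainMeasure hΓ hκ hκm
  have hFm : MeasurableSet (κ ⁻¹' {1}) := hκ (measurableSet_singleton 1)
  have hF := measure_preimage_one_ne_top hΓ hκ hκm
  have hF0 := measure_preimage_one_ne_zero (μ := μ) hκ hκm
  rw [Metric.tendstoUniformlyOn_iff]
  intro ε hε
  have hM0 : 0 ≤ |M| := abs_nonneg M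
  obtain ⟨δ, hδ0, hδ⟩ : ∃ δ : ℝ, 0 < δ ∧ 2 * ((|M| + 1) * δ) < ε / 2 :=
    ⟨ε / (8 * (|M| + 1)), by positivity, by
      have : 2 * ((|M| + 1) * (ε / (8 * (|M| + 1)))) = ε / 4 := by field_simp; norm_num
      rw [this]; linarith⟩
  obtain ⟨L, hLF, hLc, hLm⟩ := hFm.exists_isCompact_sdiff_lt hF
    (ε := μ (κ ⁻¹' {1}) * ENNReal.ofReal δ) (mul_ne_zero hF0 (by simpa using hδ0))
  have hLmeas : MeasurableSet L := hLc.measurableSet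
  have hLd : (domainMeasure μ κ).real Lᶜ ≤ δ := by
    rw [measureReal_def]
    refine ENNReal.toReal_le_of_le_ofReal hδ0.le ?_
    rw [domainMeasure, Measure.smul_apply, Measure.restrict_apply hLmeas.compl, Set.inter_comm,
      ← Set.sdiff_eq, smul_eq_mul]
    calc _ ≤ (μ (κ ⁻¹' {1}))⁻¹ * (μ (κ ⁻¹' {1}) * ENNReal.ofReal δ) := by gcongr
      _ = ENNReal.ofReal δ := by rw [← mul_assoc, ENNReal.inv_mul_cancel hF0 hF, one_mul]
  let T : Set Γ := Subtype.val ⁻¹' ((fun z : (G × G) × G => z.1.1 * z.1.2 * z.2⁻¹) '' ((L ×ˢ Q) ×ˢ L))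
  have hT : IsCompact T :=
    (Subgroup.isClosed_of_discrete (H := Γ)).isClosedEmbedding_subtypeVal.isCompact_preimage
      (((hLc.prod hQ).prod hLc).image (by fun_prop))
  filter_upwards [Metric.tendstoUniformlyOn_iff.1 (h T hT) (ε / 2) (half_pos hε)] with α hα g hg
  have hmeasφ : Measurable fun y => φ α (κ (y * g)) :=
    (Measurable.of_discrete (f := φ α)).comp (hκ.comp (measurable_mul_const g))
  have hintg : Integrable (fun y => φ α (κ (y * g))) (domainMeasure μ κ) :=
    Integrable.of_bound hmeasφ.aestronglyMeasurable M (Eventually.of_forall fun y => hM _ _)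
  -- `w y` tells whether the representative of `y` in `F` leaves `L`. Being left `Γ`-invariant, it
  -- has the same mean after right translation by any `g`.
  let w : G → ℝ := fun y => Lᶜ.indicator (fun _ => (1 : ℝ)) ((κ y : G)⁻¹ * y)
  have hwm : Measurable w := by
    refine (measurable_const.indicator hLmeas.compl).comp ?_
    exact ((measurable_subtype_coe.comp hκ).inv).mul measurable_id
  have hwint : ∀ g, Integrable (fun y => w (y * g)) (domainMeasure μ κ) := fun g =>
    Integrable.of_bound (hwm.comp (measurable_mul_const g)).aestronglyMeasurable 1
      (Eventually.of_forall fun y => (norm_indicator_le_norm_self _ _).trans (by simp))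
  have hw1 : ∀ g, ∫ y, w (y * g) ∂(domainMeasure μ κ) ≤ δ := by
    intro g
    rw [integral_domainMeasure_mul_right hκ hκm (w := w) (fun γ x => by
      simp only [w, hκm]
      congr 1
      push_cast
      group) g]
    refine le_trans (le_of_eq ?_) hLd
    rw [← integral_indicator_one hLmeas.compl]
    refine integral_congr_ae ?_
    filter_upwards [ae_domainMeasure hκ] with y hy
    simp only [w, hy, OneMemClass.coe_one, inv_one, one_mul]
    rfl
  have hbound : ∀ᵐ y ∂(domainMeasure μ κ), ‖1 - φ α (κ (y * g))‖
      ≤ ε / 2 + (|M| + 1) * (w (y * 1) + w (y * g)) := by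
    filter_upwards [ae_domainMeasure hκ] with y hy
    have hb : ‖1 - φ α (κ (y * g))‖ ≤ |M| + 1 := by
      refine (norm_sub_le _ _).trans ?_
      rw [norm_one, add_comm]
      gcongr
      exact (hM _ _).trans (le_abs_self M)
    have hw0 : ∀ x, 0 ≤ w x := fun x => Set.indicator_nonneg (fun _ _ => zero_le_one) _
    by_cases h1 : y ∈ L
    · by_cases h2 : ((κ (y * g) : G)⁻¹ * (y * g)) ∈ L
      · have hmem : κ (y * g) ∈ T := by
          refine ⟨((y, g), (κ (y * g) : G)⁻¹ * (y * g)), ⟨⟨h1, hg⟩, h2⟩, ?_⟩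
          simp only
          group
        have h3 := (hα _ hmem).le
        rw [dist_eq_norm] at h3
        exact h3.trans (le_add_of_nonneg_right
          (mul_nonneg (by positivity) (add_nonneg (hw0 _) (hw0 _))))
      · have : w (y * g) = 1 := by
          simp only [w]
          exact Set.indicator_of_mem h2 _
        rw [this]
        nlinarith [hw0 (y * 1)]
    · have : w (y * 1) = 1 := by
        simp only [w, mul_one, hy]
        exact Set.indicator_of_mem (by simpa using h1) _
      rw [this]
      nlinarith [hw0 (y * g)]
  rw [dist_eq_norm]
  have e1 : 1 - induced μ κ (φ α) g = ∫ y, (1 - φ α (κ (y * g))) ∂(domainMeasure μ κ) := by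
    rw [integral_sub (integrable_const _) hintg, induced]
    simp
  rw [e1]
  have hwi : Integrable (fun y => (|M| + 1) * (w (y * 1) + w (y * g))) (domainMeasure μ κ) :=
    ((hwint 1).add (hwint g)).const_mul _
  refine (norm_integral_le_of_norm_le ((integrable_const _).add hwi) hbound).trans_lt ?_
  simp only [Pi.add_apply]
  rw [integral_add (integrable_const _) hwi, integral_const_mul,
    integral_add (hwint 1) (hwint g)]
  simp only [integral_const, probReal_univ, one_smul]
  have h5 : (|M| + 1) * (∫ y, w (y * 1) ∂(domainMeasure μ κ) + ∫ y, w (y * g) ∂(domainMeasure μ κ))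
      ≤ (|M| + 1) * (δ + δ) := by
    gcongr
    · exact hw1 1
    · exact hw1 g
  linarith

end Induction

/-! ### From `G` to `Γ`: averages over a subset of the fundamental domain. -/

section Sampled

variable {G : Type u} [Group G] [MeasurableSpace G] [MeasurableMul₂ G] [MeasurableInv G]
  {μ : Measure G} [SFinite μ] [μ.IsMulLeftInvariant]

/-- By invariance of `μ`, passing to measurable representatives of `f` and `k` does not change the
integral for any `g`, so `φ` itself is measurable, not just almost everywhere equal to a measurable
function. -/
theorem MemFourierAlgebra.measurable {φ : G → ℂ} (h : MemFourierAlgebra μ φ) : Measurable φ := by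
  obtain ⟨f, k, hf, hk, hφ⟩ := h
  have h1 : φ = fun g => ∫ x, hf.1.mk f (g⁻¹ * x) * conj (hk.1.mk k x) ∂μ := by
    funext g
    rw [hφ]
    refine integral_congr_ae ?_
    filter_upwards [(measurePreserving_mul_left μ g⁻¹).quasiMeasurePreserving.ae hf.1.ae_eq_mk,
      hk.1.ae_eq_mk] with x h1 h2
    rw [h1, h2]
  rw [h1]
  have h2 : StronglyMeasurable fun z : G × G => hf.1.mk f (z.1⁻¹ * z.2) * conj (hk.1.mk k z.2) := by
    refine (hf.1.stronglyMeasurable_mk.comp_measurable (by fun_prop)).mul ?_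
    exact RCLike.continuous_conj.comp_stronglyMeasurable
      (hk.1.stronglyMeasurable_mk.comp_measurable measurable_snd)
  exact h2.integral_prod_right'.measurable

theorem memFourierAlgebra_inner (ξ η : Lp ℂ 2 μ) :
    MemFourierAlgebra μ fun g => inner ℂ η (leftTranslation μ g ξ) :=
  ⟨ξ, η, Lp.memLp ξ, Lp.memLp η, fun g => by
    rw [← inner_leftTranslation_toLp (Lp.memLp ξ) (Lp.memLp η), Lp.toLp_coeFn, Lp.toLp_coeFn]⟩

/-- Averages of translates of a vector over a set of finite measure. -/
theorem exists_average_leftTranslation {U : Set G} (hU : μ U ≠ ∞) (ξ : Lp ℂ 2 μ) :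
    ∃ ζ : Lp ℂ 2 μ, ∀ η, inner ℂ η ζ = ∫ g in U, inner ℂ η (leftTranslation μ g ξ) ∂μ := by
  have hfin : IsFiniteMeasure (μ.restrict U) := ⟨by simpa using hU.lt_top⟩
  have hintg : ∀ η, Integrable (fun g => inner ℂ η (leftTranslation μ g ξ)) (μ.restrict U) := by
    intro η
    obtain ⟨M, hM⟩ := (memFourierAlgebra_inner ξ η).exists_norm_le
    exact Integrable.of_bound (memFourierAlgebra_inner ξ η).measurable.aestronglyMeasurable M
      (Eventually.of_forall hM)
  have hintg' : ∀ η, Integrable (fun g => inner ℂ (leftTranslation μ g ξ) η) (μ.restrict U) := by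
    intro η
    refine ((RCLike.conjCLE (K := ℂ)).toContinuousLinearMap.integrable_comp (hintg η)).congr
      (Eventually.of_forall fun g => ?_)
    exact inner_conj_symm _ _
  -- The average is defined weakly, by the Riesz representation of this functional.
  let ℓ : Lp ℂ 2 μ →L[ℂ] ℂ := LinearMap.mkContinuous
    { toFun := fun η => ∫ g in U, inner ℂ (leftTranslation μ g ξ) η ∂μ
      map_add' := fun η η' => by
        simp only [inner_add_right]
        exact integral_add (hintg' η) (hintg' η')
      map_smul' := fun c η => by
        simp only [inner_smul_right]
        exact integral_const_mul _ _ } (‖ξ‖ * μ.real U) fun η => by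
    change ‖∫ g in U, inner ℂ (leftTranslation μ g ξ) η ∂μ‖ ≤ _
    refine (norm_setIntegral_le_of_norm_le_const (C := ‖ξ‖ * ‖η‖) hU.lt_top fun g _ => ?_).trans_eq
      (by ring)
    exact (norm_inner_le_norm _ _).trans_eq (by rw [norm_leftTranslation])
  refine ⟨(InnerProductSpace.toDual ℂ _).symm ℓ, fun η => ?_⟩
  rw [← inner_conj_symm, InnerProductSpace.toDual_symm_apply]
  change conj (∫ g in U, inner ℂ (leftTranslation μ g ξ) η ∂μ) = _
  rw [← integral_conj]
  exact integral_congr_ae (Eventually.of_forall fun g => inner_conj_symm _ _)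

/-- The average of `φ(u⁻¹ γ u')` over `u, u' ∈ U`. -/
noncomputable def sampled (μ : Measure G) (U : Set G) (Γ : Subgroup G) (φ : G → ℂ) (γ : Γ) : ℂ :=
  ((μ.real U : ℂ) ^ 2)⁻¹ * ∫ z in U ×ˢ U, φ (z.1⁻¹ * γ * z.2) ∂(μ.prod μ)

theorem MemFourierAlgebra.integrableOn_sampled {φ : G → ℂ} (h : MemFourierAlgebra μ φ) {U : Set G}
    (hU : μ U ≠ ∞) (g : G) :
    IntegrableOn (fun z : G × G => φ (z.1⁻¹ * g * z.2)) (U ×ˢ U) (μ.prod μ) := by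
  obtain ⟨M, hM⟩ := h.exists_norm_le
  refine Measure.integrableOn_of_bounded (M := M) ?_ ?_ (Eventually.of_forall fun z => hM _)
  · rw [Measure.prod_prod]
    exact ENNReal.mul_ne_top hU hU
  · exact (h.measurable.comp (by fun_prop)).aestronglyMeasurable

/-- Averaging `⟨λ(u) k, λ(γ) λ(u') f⟩` over `u` and `u'` gives the coefficient of the two averaged
vectors at `γ`, so only the restriction to `Γ` remains. -/
theorem memFourierAlgebra_sampled {Γ : Subgroup G} [Countable Γ] [MeasurableSingletonClass Γ]
    {ν : Measure Γ} [ν.IsMulLeftInvariant] {c : ℝ} (hc : 0 < c)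
    (hν : ∀ γ, ν {γ} = ENNReal.ofReal c) {κ : G → Γ} (hκ : Measurable κ)
    (hκm : ∀ (γ : Γ) x, κ (γ * x) = γ * κ x) {φ : G → ℂ} (h : MemFourierAlgebra μ φ) {U : Set G}
    (hU : μ U ≠ ∞) : MemFourierAlgebra ν (sampled μ U Γ φ) := by
  have hintg := h.integrableOn_sampled hU
  obtain ⟨f, k, hf, hk, hφ⟩ := h
  obtain ⟨F, hF⟩ := exists_average_leftTranslation hU (hf.toLp f)
  obtain ⟨K, hK⟩ := exists_average_leftTranslation hU (hk.toLp k)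
  let a : ℂ := ((μ.real U : ℂ) ^ 2)⁻¹
  have hres := memFourierAlgebra_restrict (μ := μ) hc hν hκ hκm (Lp.memLp (a • F)) (Lp.memLp K)
  convert hres using 1
  funext γ
  rw [← inner_leftTranslation_toLp (Lp.memLp (a • F)) (Lp.memLp K), Lp.toLp_coeFn, Lp.toLp_coeFn,
    map_smul, inner_smul_right, sampled]
  congr 1
  rw [setIntegral_prod _ (hintg γ)]
  have h1 : ∀ y, inner ℂ K y = ∫ g in U, inner ℂ (leftTranslation μ g (hk.toLp k)) y ∂μ := by
    intro y
    rw [← inner_conj_symm, hK, ← integral_conj]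
    exact integral_congr_ae (Eventually.of_forall fun g => inner_conj_symm _ _)
  rw [h1]
  refine integral_congr_ae (Eventually.of_forall fun u => ?_)
  simp only
  rw [← ContinuousLinearMap.adjoint_inner_left, hF]
  refine integral_congr_ae (Eventually.of_forall fun u' => ?_)
  simp only
  rw [ContinuousLinearMap.adjoint_inner_left, hφ, ← inner_leftTranslation_toLp hf hk,
    leftTranslation_mul, leftTranslation_mul, ContinuousLinearMap.comp_apply,
    ContinuousLinearMap.comp_apply, ← adjoint_leftTranslation,
    ContinuousLinearMap.adjoint_inner_right]

/-- The substitution of `(γ⁻¹ z₁, γ'⁻¹ z₂)` for the two variables identifies the value with the mean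
of `φ̌` over `γ U × γ' U`. -/
theorem herzSchurSymbol_sampled {Γ : Subgroup G} (φ : G → ℂ) (U : Set G) (γ γ' : Γ) :
    herzSchurSymbol (sampled μ U Γ φ) (γ, γ') = ((μ.real U : ℂ) ^ 2)⁻¹ *
      ∫ z in ((fun x => (γ : G)⁻¹ * x) ⁻¹' U) ×ˢ ((fun x => (γ' : G)⁻¹ * x) ⁻¹' U),
        herzSchurSymbol φ z ∂(μ.prod μ) := by
  have h1 := ((measurePreserving_mul_left μ (γ : G)⁻¹).prod
    (measurePreserving_mul_left μ (γ' : G)⁻¹)).setIntegral_preimage_emb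
    ((measurableEmbedding_mulLeft (γ : G)⁻¹).prodMap (measurableEmbedding_mulLeft (γ' : G)⁻¹))
    (fun z : G × G => φ (z.1⁻¹ * ((γ⁻¹ * γ' : Γ) : G) * z.2)) (U ×ˢ U)
  simp only [herzSchurSymbol, sampled]
  rw [← h1]
  congr 1
  refine integral_congr_ae (Eventually.of_forall fun z => ?_)
  simp [mul_assoc]

/-- Since `U` lies in a fundamental domain, the sets `γ U` are disjoint, and they have equal
measure: the hypotheses of `IsCBSchurBound.sample`. -/
theorem cbSchurNorm_sampled_le {Γ : Subgroup G} [Countable Γ] [MeasurableSingletonClass Γ]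
    {ν : Measure Γ} [SFinite ν] [ν.IsMulLeftInvariant] {c : ℝ} (hc : 0 < c)
    (hν : ∀ γ, ν {γ} = ENNReal.ofReal c) {κ : G → Γ} (hκ : Measurable κ)
    (hκm : ∀ (γ : Γ) x, κ (γ * x) = γ * κ x) {U : Set G} (hUm : MeasurableSet U)
    (hUκ : U ⊆ κ ⁻¹' {1}) (hU : μ U ≠ ∞) (hU0 : μ U ≠ 0) {p : ℝ≥0∞} (hp : 1 ≤ p) {φ : G → ℂ}
    (hφ : MemFourierAlgebra μ φ) {C : ℝ≥0} (h : cbSchurNorm p μ (herzSchurSymbol φ) ≤ C) :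
    cbSchurNorm p ν (herzSchurSymbol (sampled μ U Γ φ)) ≤ C := by
  have : MeasurableMul Γ := ⟨fun _ => .of_discrete, fun _ => .of_discrete⟩
  rw [cbSchurNorm_le_iff] at h ⊢
  intro C' hC'
  obtain ⟨M, hM⟩ := (memFourierAlgebra_sampled hc hν hκ hκm hφ hU).exists_norm_le
  refine (h C' hC').sample hc hν hp (S := fun γ => (fun x => (γ : G)⁻¹ * x) ⁻¹' U)
    (fun γ => hUm.preimage (measurable_const_mul _)) (fun γ γ' hne => ?_)
    (ENNReal.toReal_pos hU0 hU) (fun γ => ?_) (herzSchurSymbol_sampled φ U)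
    (memLp_top_of_bound (Measurable.of_discrete).aestronglyMeasurable M
      (Eventually.of_forall fun z => hM _))
  · refine Set.disjoint_left.2 fun x h1 h2 => hne ?_
    have h3 : ∀ γ : Γ, (γ : G)⁻¹ * x ∈ U → κ x = γ := by
      intro γ hγ
      have h4 : κ ((γ : G)⁻¹ * x) = 1 := hUκ hγ
      have h5 : κ ((γ : G)⁻¹ * x) = γ⁻¹ * κ x := hκm γ⁻¹ x
      rw [h5, inv_mul_eq_one] at h4
      exact h4.symm
    rw [← h3 γ h1, h3 γ' h2]
  · rw [measure_preimage_mul, ENNReal.ofReal_toReal hU]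

/-- For `γ ∈ Q` all points `u⁻¹ γ u'` lie in the compact set `U⁻¹ Q U`; this is why `U` is taken
compact instead of all of `F`. -/
theorem tendstoUniformlyOn_sampled [TopologicalSpace G] [IsTopologicalGroup G] {Γ : Subgroup G}
    {U : Set G} (hUc : IsCompact U) (hU : μ U ≠ ∞) (hU0 : μ U ≠ 0) {ι : Type*} {l : Filter ι}
    {φ : ι → G → ℂ} (hφ : ∀ α, MemFourierAlgebra μ (φ α))
    (h : ∀ Q : Set G, IsCompact Q → TendstoUniformlyOn φ (fun _ => 1) l Q) {Q : Set Γ}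
    (hQ : IsCompact Q) :
    TendstoUniformlyOn (fun α => sampled μ U Γ (φ α)) (fun _ => 1) l Q := by
  have hT : IsCompact ((fun z : (G × G) × G => z.1.1⁻¹ * z.1.2 * z.2) ''
      ((U ×ˢ (Subtype.val '' Q)) ×ˢ U)) :=
    ((hUc.prod (hQ.image continuous_subtype_val)).prod hUc).image (by fun_prop)
  have ha : 0 < μ.real U := ENNReal.toReal_pos hU0 hU
  have hac : (μ.real U : ℂ) ≠ 0 := by exact_mod_cast ha.ne'
  rw [Metric.tendstoUniformlyOn_iff]
  intro ε hε
  filter_upwards [Metric.tendstoUniformlyOn_iff.1 (h _ hT) (ε / 2) (half_pos hε)] with α hα γ hγ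
  have hfin : (μ.prod μ) (U ×ˢ U) ≠ ∞ := by
    rw [Measure.prod_prod]
    exact ENNReal.mul_ne_top hU hU
  have hreal : (μ.prod μ).real (U ×ˢ U) = μ.real U ^ 2 := by
    rw [measureReal_prod_prod, sq]
  have e1 : 1 - sampled μ U Γ (φ α) γ = ((μ.real U : ℂ) ^ 2)⁻¹ *
      ∫ z in U ×ˢ U, (1 - φ α (z.1⁻¹ * γ * z.2)) ∂(μ.prod μ) := by
    have hc1 : Integrable (fun _ => (1 : ℂ)) ((μ.prod μ).restrict (U ×ˢ U)) :=
      integrableOn_const hfin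
    rw [integral_sub hc1 ((hφ α).integrableOn_sampled hU γ), sampled, mul_sub,
      setIntegral_const, hreal]
    congr 1
    rw [Complex.real_smul, mul_one]
    push_cast
    field_simp
  have e2 : ‖∫ z in U ×ˢ U, (1 - φ α (z.1⁻¹ * γ * z.2)) ∂(μ.prod μ)‖ ≤ ε / 2 * μ.real U ^ 2 := by
    rw [← hreal]
    refine norm_setIntegral_le_of_norm_le_const hfin.lt_top fun z hz => ?_
    have := (hα _ ⟨((z.1, (γ : G)), z.2), ⟨⟨hz.1, ⟨γ, hγ, rfl⟩⟩, hz.2⟩, rfl⟩).le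
    rwa [dist_eq_norm] at this
  rw [dist_eq_norm, e1, norm_mul, norm_inv, norm_pow, Complex.norm_real, Real.norm_of_nonneg ha.le]
  calc _ ≤ (μ.real U ^ 2)⁻¹ * (ε / 2 * μ.real U ^ 2) := by gcongr
    _ = ε / 2 := by field_simp
    _ < ε := half_lt_self hε

end Sampled

/-! ### Both directions together. -/

section Lattice

variable {G : Type u} [Group G] [TopologicalSpace G] [IsTopologicalGroup G]
  [T2Space G] [LocallyCompactSpace G] [SecondCountableTopology G] [MeasurableSpace G] [BorelSpace G]
  {μ : Measure G} [μ.IsHaarMeasure] {Γ : Subgroup G} {ν : Measure Γ} [ν.IsHaarMeasure]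

theorem exists_measure_singleton [DiscreteTopology Γ] :
    ∃ c : ℝ, 0 < c ∧ ∀ γ : Γ, ν {γ} = ENNReal.ofReal c := by
  have h1 : ∀ γ : Γ, ν {γ} = ν {1} := fun γ => by
    have := measure_preimage_mul ν γ⁻¹ {1}
    rw [← this]
    congr 1
    ext x
    simp [eq_comm]
  have htop : ν {1} ≠ ∞ := isCompact_singleton.measure_ne_top
  have hpos : ν {1} ≠ 0 := ((isOpen_discrete ({1} : Set Γ)).measure_pos ν (Set.singleton_nonempty 1)).ne'
  exact ⟨(ν {1}).toReal, ENNReal.toReal_pos hpos htop, fun γ => by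
    rw [h1, ENNReal.ofReal_toReal htop]⟩

theorem hasSchurApprox_iff (hΓ : IsLattice Γ μ) {p : ℝ≥0∞} (hp : 1 ≤ p) {C : ℝ≥0} :
    HasSchurApprox p μ C ↔ HasSchurApprox p ν C := by
  have := hΓ.discrete
  have hcount : Countable Γ := countable_of_Lindelof_of_discrete
  obtain ⟨c, hc, hν⟩ := exists_measure_singleton (ν := ν)
  obtain ⟨κ, hκ, hκm⟩ := exists_equivariant_map (Γ := Γ)
  constructor
  · rintro ⟨ι, i1, i2, i3, φ, hA, hconv, hcb⟩
    have hF := measure_preimage_one_ne_top hΓ hκ hκm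
    have hF0 := measure_preimage_one_ne_zero (μ := μ) hκ hκm
    -- Inner regularity with tolerance `μ(F)` itself leaves a compact set of positive measure.
    obtain ⟨U, hUF, hUc, hUlt⟩ :=
      (hκ (measurableSet_singleton 1)).exists_isCompact_sdiff_lt hF hF0
    have hU : μ U ≠ ∞ := hUc.measure_ne_top
    have hU0 : μ U ≠ 0 := by
      intro h0
      have : μ (κ ⁻¹' {1}) ≤ μ (κ ⁻¹' {1} \ U) + μ U :=
        (measure_mono fun x hx => by
          by_cases h : x ∈ U
          · exact Or.inr h
          · exact Or.inl ⟨hx, h⟩).trans (measure_union_le _ _)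
      rw [h0, add_zero] at this
      exact absurd hUlt (not_lt.2 this)
    exact ⟨ι, i1, i2, i3, fun α => sampled μ U Γ (φ α),
      fun α => memFourierAlgebra_sampled hc hν hκ hκm (hA α) hU,
      fun Q hQ => tendstoUniformlyOn_sampled hUc hU hU0 hA hconv hQ,
      fun α => cbSchurNorm_sampled_le hc hν hκ hκm hUc.measurableSet hUF hU hU0 hp (hA α) (hcb α)⟩
  · rintro ⟨ι, i1, i2, i3, φ, hA, hconv, hcb⟩
    refine ⟨ι, i1, i2, i3, fun α => induced μ κ (φ α),
      fun α => memFourierAlgebra_induced hc hν hΓ hκ hκm (hA α),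
      -- The cb norm dominates the supremum norm on `Γ`, so the net is uniformly bounded; `C + 1` is
      -- an admissible constant strictly above `C`.
      fun Q hQ => tendstoUniformlyOn_induced (M := (C + 1 : ℝ≥0)) hΓ hκ hκm (fun α γ => ?_) hconv hQ,
      fun α => cbSchurNorm_induced_le hc hν hΓ hκ hκm hp (hcb α)⟩
    have := (cbSchurNorm_le_iff.1 (hcb α) (C + 1) (lt_add_one C)).norm_le hc hν hp (1, γ)
    simpa [herzSchurSymbol] using this

end Lattice

end SchurAP

theorem theorem2p5 {G : Type u} [Group G] [TopologicalSpace G] [IsTopologicalGroup G]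
    [T2Space G] [LocallyCompactSpace G] [SecondCountableTopology G]
    [MeasurableSpace G] [BorelSpace G]
    (μ : Measure G) [μ.IsHaarMeasure]
    (Γ : Subgroup G) (hΓ : SchurAP.IsLattice Γ μ)
    (ν : Measure Γ) [ν.IsHaarMeasure]
    (p : ℝ≥0∞) (hp : 1 ≤ p) :
    SchurAP.schurConst p μ = SchurAP.schurConst p ν ∧
      (SchurAP.SchurAPpcb p μ ↔ SchurAP.SchurAPpcb p ν) := by
  have h := fun C => SchurAP.hasSchurApprox_iff (ν := ν) hΓ hp (C := C)
  constructor
  · simp only [SchurAP.schurConst, h]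
  · simp only [SchurAP.SchurAPpcb, h]
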